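/- For $n\ge 1$, the semirandom tree process on $[n]=\{1,\dots,n\}$ is the following one-player game. Start with the empty graph on $[n]$. In each round $t=1,2,\dots$ the player, Builder, is offered (the edge set of) a spanning tree $T_t$ chosen uniformly at random from all spanning trees of $K_n$, independently of all previous rounds; Builder then chooses at most one edge of $T_t$ and adds it to the graph. A strategy of Builder selects the edge to be claimed (or no edge) as a function of the trees offered so far, including the current one. **Theorem.** There is a function $f:\mathbb{N}\to[0,\infty)$ with $f(\Delta)\to 0$ as $\Delta\to\infty$ such that the following holds. For every sequence of graphs $(H_n)_{n\ge1}$, where $H_n$ has $n$ vertices and maximum degree $\Delta=\Delta(n)$, Builder has strategies (one for each $n$) such that the probability that the graph constructed after $$\left\lfloor (1+f(\Delta))\frac{\Delta n}{2}\right\rfloor$$ rounds contains a copy of $H_n$ tends to $1$ as $n\to\infty$. Furthermore, the same statement holds (for some such function $f$) if the number of rounds is instead a random variable with distribution $\mathrm{Poisson}\left((1+f(\Delta))\frac{\Delta n}{2}\right)$, independent of the offers. -/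

import Mathlib

open Filter Topology MeasureTheory ProbabilityTheory
open scoped NNReal ENNReal

/-- A spanning tree of the complete graph on `V`, that is, a tree with vertex set `V`. -/
abbrev SpanningTree (V : Type*) : Type _ := {T : SimpleGraph V // T.IsTree}

/-- The law of a uniformly random spanning tree of the complete graph on a finite vertex set. -/
noncomputable def uniformTree (V : Type*) : Measure (SpanningTree V) :=
  uniformOn Set.univ

/-- The law of the sequence of offers: independent uniformly random spanning trees, where `T t` is
the tree offered in round `t + 1`. -/
noncomputable def offerLaw (V : Type*) : Measure (ℕ → SpanningTree V) :=
  Measure.infinitePi fun _ : ℕ => uniformTree V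

/-- A strategy of Builder: given the number `t` of earlier rounds, the trees offered in them and
the tree offered now, Builder claims one edge of the tree offered now, or claims nothing (`none`).
Builder's earlier choices are determined by the earlier offers, so they need not be recorded. -/
def BuilderStrategy (V : Type*) : Type _ :=
  (t : ℕ) → (Fin t → SpanningTree V) → (T : SpanningTree V) → Option T.1.edgeSet

/-- The set of edges (at most one) claimed in round `t + 1` when the offers are `T`. -/
def claimedEdge {V : Type*} (S : BuilderStrategy V) (T : ℕ → SpanningTree V) (t : ℕ) :
    Set (Sym2 V) :=
  {e | ∃ h : e ∈ (T t).1.edgeSet, S t (fun i => T i) (T t) = some ⟨e, h⟩}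

/-- Builder's graph after a given number of rounds, starting with the empty graph. -/
def builderGraph {V : Type*} (S : BuilderStrategy V) (T : ℕ → SpanningTree V) :
    ℕ → SimpleGraph V
  | 0 => ⊥
  | t + 1 => builderGraph S T t ⊔ SimpleGraph.fromEdgeSet (claimedEdge S T t)

/-- The probability that Builder's graph contains a copy of `H` after `m` rounds. -/
noncomputable def successProb {V : Type*} (S : BuilderStrategy V) (H : SimpleGraph V) (m : ℕ) :
    ℝ≥0∞ :=
  offerLaw V {T | H.IsContained (builderGraph S T m)}

/-- The probability that Builder's graph contains a copy of `H` after a number of rounds that is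
Poisson distributed with mean `r` and independent of the offers (and not known to Builder). -/
noncomputable def poissonSuccessProb {V : Type*} (S : BuilderStrategy V) (H : SimpleGraph V)
    (r : ℝ≥0) : ℝ≥0∞ :=
  ((offerLaw V).prod (poissonMeasure r)) {p | H.IsContained (builderGraph S p.1 p.2)}

noncomputable section

open scoped Classical

/-! ### Averages over spanning trees -/

/-! The game is studied through its value: `loss A k G` is the least probability of failing to reach
the family `A` within `k` more rounds from the graph `G`. By `loss_add_le`, phases compose by adding
failure probabilities, and the optimal strategy for a fixed horizon attains the value. Hence no
strategy is ever glued together explicitly; it suffices to bound `loss` phase by phase.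

Two facts about a uniform spanning tree drive the phases. Its edge indicators have mean `2 / n`, and
pair correlations are `O(1 / n ^ 2)`; those of disjoint pairs are close to `4 / n ^ 2`. The second
moment method (`le_treeAvg_hit`) shows that a tree meets a set of `x * n` pairs with probability at
least `x / (x + 15)`, so hardly any round is wasted while many edges are missing. In a set of at
most `n / 16` pairs, each pair is the only one in the tree with probability at least `1 / n`
(`le_treeAvg_unique`); a prescribed subset of `q` pairs is then missed for `t` rounds with
probability at most `exp (-q * t / n)`, simultaneously for all subsets, and union bounds apply
(`loss_hit_all_le`).

Let `κ` be about `√Δ` and `s = 2 ^ (10 * κ)`. Fix a labelling of `H` and collect its edges greedily: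
`Δ * n / 2 + O(κ * n)` rounds leave at most `κ * n` missing edges, and `O(κ * n)` more leave at most
`n / 16`, then `n / s ^ 4`. Waiting for the last prescribed edges would cost order `n * log n`
rounds, so the labelling is changed instead. An exceptional vertex `u` is exchanged with one of many
candidates, far apart in `H`; an exchange needs only `O(Δ)` pairs, and there is freedom in which
candidate succeeds.

Exchanging all exceptional vertices at once, with `s` candidates each (`loss_simultaneous_le`),
leaves `n * exp (-s)` of them after `O(κ * n)` rounds. After that, exchanges are made for an
independent set of exceptional vertices, gaining one pair at a time while most candidates are
discarded (`loss_sequential_le`). The number of candidates grows as the number of exceptional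
vertices falls, so successive scales take geometrically decreasing time, at most `n` rounds in total
(`loss_late_le`, `loss_finish_le`). The overhead `O(κ * n)` is negligible against `Δ * n / 2` as `Δ`
grows. In the Poisson version the mean has twice this overhead, and Chernoff's bound applies. -/

instance SpanningTree.fintype {V : Type*} [Finite V] : Fintype (SpanningTree V) :=
  Fintype.ofFinite _

lemma SpanningTree.nonempty (V : Type*) [Nonempty V] : Nonempty (SpanningTree V) :=
  ((SimpleGraph.connected_top (V := V)).exists_isTree_le).elim fun T hT => ⟨⟨T, hT.2⟩⟩

/-- The average of a function over all spanning trees. -/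
def treeAvg {V : Type*} [Finite V] (F : SpanningTree V → ℝ) : ℝ :=
  (∑ T, F T) / Fintype.card (SpanningTree V)

section treeAvg
variable {V : Type*} [Finite V]

lemma treeAvg_mono {F G : SpanningTree V → ℝ} (h : ∀ T, F T ≤ G T) : treeAvg F ≤ treeAvg G := by
  unfold treeAvg
  gcongr
  exact h _

lemma treeAvg_nonneg {F : SpanningTree V → ℝ} (h : ∀ T, 0 ≤ F T) : 0 ≤ treeAvg F :=
  div_nonneg (Finset.sum_nonneg fun _ _ => h _) (Nat.cast_nonneg _)

lemma treeAvg_const [Nonempty V] (c : ℝ) : treeAvg (fun _ : SpanningTree V => c) = c := by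
  have := SpanningTree.nonempty V
  have h : (Fintype.card (SpanningTree V) : ℝ) ≠ 0 := by exact_mod_cast Fintype.card_ne_zero
  simp [treeAvg, h]

lemma treeAvg_add (F G : SpanningTree V → ℝ) :
    treeAvg (fun T => F T + G T) = treeAvg F + treeAvg G := by
  simp [treeAvg, Finset.sum_add_distrib, add_div]

lemma treeAvg_sub (F G : SpanningTree V → ℝ) :
    treeAvg (fun T => F T - G T) = treeAvg F - treeAvg G := by
  simp [treeAvg, Finset.sum_sub_distrib, sub_div]

lemma treeAvg_mul_const (F : SpanningTree V → ℝ) (c : ℝ) :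
    treeAvg (fun T => F T * c) = treeAvg F * c := by
  simp only [treeAvg, ← Finset.sum_mul]
  ring

lemma treeAvg_sum {ι : Type*} (s : Finset ι) (F : ι → SpanningTree V → ℝ) :
    treeAvg (fun T => ∑ i ∈ s, F i T) = ∑ i ∈ s, treeAvg (F i) := by
  simp only [treeAvg]
  rw [Finset.sum_comm, Finset.sum_div]

end treeAvg

/-- Relabelling the vertices of a spanning tree. -/
def SpanningTree.relabel {V : Type*} (σ : Equiv.Perm V) : SpanningTree V ≃ SpanningTree V where
  toFun T := ⟨T.1.map σ.toEmbedding, ((SimpleGraph.Iso.map σ T.1).isTree_iff).1 T.2⟩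
  invFun T := ⟨T.1.map σ.symm.toEmbedding, ((SimpleGraph.Iso.map σ.symm T.1).isTree_iff).1 T.2⟩
  left_inv T := Subtype.ext (by ext; simp)
  right_inv T := Subtype.ext (by ext; simp)

lemma SpanningTree.relabel_adj {V : Type*} (σ : Equiv.Perm V) (T : SpanningTree V) (x y : V) :
    (SpanningTree.relabel σ T).1.Adj (σ x) (σ y) ↔ T.1.Adj x y := by
  exact (SimpleGraph.Iso.map σ T.1).map_adj_iff

lemma treeAvg_relabel {V : Type*} [Finite V] (σ : Equiv.Perm V) (F : SpanningTree V → ℝ) :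
    treeAvg (fun T => F (SpanningTree.relabel σ T)) = treeAvg F := by
  simp only [treeAvg]
  rw [Equiv.sum_comp (SpanningTree.relabel σ) F]

/-- The indicator of adjacency in a spanning tree. -/
def adjInd {V : Type*} (x y : V) (T : SpanningTree V) : ℝ := if T.1.Adj x y then 1 else 0

section adjInd
variable {V : Type*}

lemma adjInd_nonneg (x y : V) (T : SpanningTree V) : 0 ≤ adjInd x y T := by
  unfold adjInd; split_ifs <;> norm_num

lemma adjInd_comm (x y : V) : adjInd x y = adjInd y x := by
  funext T; simp [adjInd, SimpleGraph.adj_comm]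

lemma adjInd_relabel (σ : Equiv.Perm V) (T : SpanningTree V) (x y : V) :
    adjInd (σ x) (σ y) (SpanningTree.relabel σ T) = adjInd x y T := by
  simp [adjInd, SpanningTree.relabel_adj]

lemma sum_sum_adjInd [Fintype V] (T : SpanningTree V) :
    ∑ x, ∑ y, adjInd x y T = 2 * ((Fintype.card V : ℝ) - 1) := by
  have h1 := T.1.sum_degrees_eq_twice_card_edges
  have h2 := T.2.card_edgeFinset
  have h3 : ∀ x, ∑ y, adjInd x y T = T.1.degree x := by
    intro x
    simp [adjInd, ← SimpleGraph.card_neighborFinset_eq_degree, SimpleGraph.neighborFinset_eq_filter]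
  simp only [h3]
  have h4 : (Fintype.card V : ℝ) - 1 = T.1.edgeFinset.card := by
    rw [← h2]; push_cast; ring
  rw [h4]
  exact_mod_cast h1

lemma exists_perm_of_injective {ι : Type*} [Finite ι] {f g : ι → V}
    (hf : Function.Injective f) (hg : Function.Injective g) : ∃ σ : Equiv.Perm V, ∀ i, σ (f i) = g i := by
  obtain ⟨σ, h⟩ := Equiv.Perm.exists_smul_eq_embedding (ι := ι) ⟨f, hf⟩ ⟨g, hg⟩
  exact ⟨σ, fun i => DFunLike.congr_fun h i⟩

lemma treeAvg_adjInd_mul_eq [Finite V] {f g : Fin 4 → V} (σ : Equiv.Perm V) (h : ∀ i, σ (f i) = g i) :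
    treeAvg (fun T => adjInd (f 0) (f 1) T * adjInd (f 2) (f 3) T) =
      treeAvg (fun T => adjInd (g 0) (g 1) T * adjInd (g 2) (g 3) T) := by
  rw [← treeAvg_relabel σ (fun T => adjInd (g 0) (g 1) T * adjInd (g 2) (g 3) T)]
  simp only [← h, adjInd_relabel]

variable [Fintype V]

/-- By symmetry all `n * (n - 1)` ordered pairs are equally likely, and every tree contains `2 * (n
- 1)` of them. -/
lemma treeAvg_adjInd [Nonempty V] {x y : V} (h : x ≠ y) :
    treeAvg (adjInd x y) = 2 / Fintype.card V := by
  have hn : 2 ≤ Fintype.card V := by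
    have := Fintype.one_lt_card_iff.2 ⟨x, y, h⟩
    omega
  have key : ∀ x' y' : V, x' ≠ y' → treeAvg (adjInd x' y') = treeAvg (adjInd x y) := by
    intro x' y' h'
    obtain ⟨σ, hσ⟩ := exists_perm_of_injective (f := ![x', y']) (g := ![x, y])
      (by intro i j; fin_cases i <;> fin_cases j <;> simp [h', h'.symm])
      (by intro i j; fin_cases i <;> fin_cases j <;> simp [h, h.symm])
    have h0 : σ x' = x := hσ 0
    have h1 : σ y' = y := hσ 1
    rw [← treeAvg_relabel σ (adjInd x y)]
    simp only [← h0, ← h1, adjInd_relabel]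
  have h1 : treeAvg (fun T : SpanningTree V => ∑ x, ∑ y, adjInd x y T)
      = 2 * ((Fintype.card V : ℝ) - 1) := by
    simp only [sum_sum_adjInd, treeAvg_const]
  rw [treeAvg_sum] at h1
  simp only [treeAvg_sum] at h1
  have h2 : ∀ a : V, ∑ b, treeAvg (adjInd a b) = ((Fintype.card V : ℝ) - 1) * treeAvg (adjInd x y) := by
    intro a
    rw [← Finset.sum_erase_add _ _ (Finset.mem_univ a), Finset.sum_congr rfl
      (g := fun _ => treeAvg (adjInd x y)) (fun b hb => key a b (Finset.ne_of_mem_erase hb).symm)]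
    have : treeAvg (adjInd a a) = 0 := by simp [treeAvg, adjInd]
    simp [this, Finset.card_erase_of_mem, Nat.cast_sub (by omega : 1 ≤ Fintype.card V)]
  simp only [h2, Finset.sum_const, nsmul_eq_mul, Finset.card_univ] at h1
  have h3 : (2 : ℝ) ≤ Fintype.card V := by exact_mod_cast hn
  have h4 : ((Fintype.card V : ℝ) - 1) ≠ 0 := by linarith
  rw [eq_div_iff (by linarith)]
  apply mul_left_cancel₀ h4
  linarith

/-- Keep `ab` fixed. By symmetry the `(n - 2) * (n - 3)` ordered pairs avoiding `a` and `b`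
contribute equally, and together they contribute at most `2 * (n - 1)` whenever `ab` is an edge. -/
lemma treeAvg_adjInd_mul_disjoint_le [Nonempty V] {a b c d : V} (hab : a ≠ b) (hac : a ≠ c)
    (had : a ≠ d) (hbc : b ≠ c) (hbd : b ≠ d) (hcd : c ≠ d) :
    ((Fintype.card V : ℝ) * (Fintype.card V - 2) * (Fintype.card V - 3)) *
      treeAvg (fun T => adjInd a b T * adjInd c d T) ≤ 4 * ((Fintype.card V : ℝ) - 1) := by
  set n := Fintype.card V with hn
  have hinj : ∀ c' d' : V, c' ≠ a → c' ≠ b → d' ≠ a → d' ≠ b → c' ≠ d' →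
      Function.Injective ![a, b, c', d'] := by
    intro c' d' h1 h2 h3 h4 h5 i j
    fin_cases i <;> fin_cases j <;>
      simp [hab, h1, h2, h3, h4, h5, hab.symm, h1.symm, h2.symm, h3.symm, h4.symm, h5.symm]
  have key : ∀ c' d' : V, c' ≠ a → c' ≠ b → d' ≠ a → d' ≠ b → c' ≠ d' →
      treeAvg (fun T => adjInd a b T * adjInd c' d' T) =
        treeAvg (fun T => adjInd a b T * adjInd c d T) := by
    intro c' d' h1 h2 h3 h4 h5
    obtain ⟨σ, hσ⟩ := exists_perm_of_injective (hinj c' d' h1 h2 h3 h4 h5)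
      (hinj c d hac.symm hbc.symm had.symm hbd.symm hcd)
    exact treeAvg_adjInd_mul_eq σ hσ
  have hcard : 4 ≤ n := by
    have := Fintype.card_le_of_injective _ (hinj c d hac.symm hbc.symm had.symm hbd.symm hcd)
    simpa using this
  have h1 : treeAvg (fun T : SpanningTree V => adjInd a b T * (2 * ((n : ℝ) - 1)))
      = 2 / n * (2 * ((n : ℝ) - 1)) := by
    rw [treeAvg_mul_const, treeAvg_adjInd hab]
  set S : Finset V := (Finset.univ.erase a).erase b with hS
  have hSc : S.card = n - 2 := by
    rw [hS, Finset.card_erase_of_mem (by simp [hab.symm]), Finset.card_erase_of_mem (by simp)]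
    simp [hn]; omega
  have h2 : ∑ c' ∈ S, ∑ d' ∈ S.erase c', treeAvg (fun T => adjInd a b T * adjInd c' d' T) ≤
      treeAvg (fun T : SpanningTree V => adjInd a b T * (2 * ((n : ℝ) - 1))) := by
    simp only [← treeAvg_sum]
    apply treeAvg_mono
    intro T
    simp only [← Finset.mul_sum]
    apply mul_le_mul_of_nonneg_left _ (adjInd_nonneg _ _ _)
    rw [← sum_sum_adjInd T]
    apply (Finset.sum_le_sum fun c' _ => _).trans (Finset.sum_le_sum_of_subset_of_nonneg
      (Finset.subset_univ S) fun c' _ _ => Finset.sum_nonneg fun d' _ => adjInd_nonneg _ _ _)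
    intro c' _
    exact Finset.sum_le_sum_of_subset_of_nonneg (Finset.subset_univ _)
      fun _ _ _ => adjInd_nonneg _ _ _
  have h3 : ∑ c' ∈ S, ∑ d' ∈ S.erase c', treeAvg (fun T => adjInd a b T * adjInd c' d' T) =
      ((n : ℝ) - 2) * (((n : ℝ) - 3) * treeAvg (fun T => adjInd a b T * adjInd c d T)) := by
    have : ∀ c' ∈ S, ∑ d' ∈ S.erase c', treeAvg (fun T => adjInd a b T * adjInd c' d' T) =
        ((n : ℝ) - 3) * treeAvg (fun T => adjInd a b T * adjInd c d T) := by
      intro c' hc'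
      rw [Finset.sum_congr rfl (g := fun _ => treeAvg (fun T => adjInd a b T * adjInd c d T))]
      · rw [Finset.sum_const, Finset.card_erase_of_mem hc', hSc, nsmul_eq_mul,
          show n - 2 - 1 = n - 3 by omega, Nat.cast_sub (by omega)]
        simp
      · intro d' hd'
        simp only [hS, Finset.mem_erase, Finset.mem_univ, and_true] at hc' hd'
        exact key c' d' hc'.2 hc'.1 hd'.2.2 hd'.2.1 hd'.1.symm
    rw [Finset.sum_congr rfl this, Finset.sum_const, hSc, nsmul_eq_mul, Nat.cast_sub (by omega)]
    simp
  have hn0 : (0 : ℝ) < n := by exact_mod_cast (by omega : 0 < n)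
  calc _ = n * (((n : ℝ) - 2) * (((n : ℝ) - 3) * treeAvg (fun T => adjInd a b T * adjInd c d T))) := by
        ring
    _ ≤ n * (2 / n * (2 * ((n : ℝ) - 1))) := by
        rw [← h3, ← h1]
        exact mul_le_mul_of_nonneg_left h2 hn0.le
    _ = _ := by field_simp; ring

/-- The expected degree of `z` on the event that `xy` is an edge: all `z` outside `{x, y}`
contribute equally, and the degrees sum to `2 * (n - 1)`. -/
lemma treeAvg_adjInd_mul_sum_le [Nonempty V] {x y z : V} (hxy : x ≠ y) (hxz : x ≠ z) (hyz : y ≠ z) :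
    ((Fintype.card V : ℝ) * (Fintype.card V - 2)) *
      treeAvg (fun T => adjInd x y T * ∑ w, adjInd z w T) ≤ 4 * ((Fintype.card V : ℝ) - 1) := by
  set n := Fintype.card V with hn
  have hinj : ∀ z' : V, z' ≠ x → z' ≠ y → Function.Injective ![x, y, z'] := by
    intro z' h1 h2 i j
    fin_cases i <;> fin_cases j <;> simp [hxy, h1, h2, hxy.symm, h1.symm, h2.symm]
  have key : ∀ z' : V, z' ≠ x → z' ≠ y →
      treeAvg (fun T => adjInd x y T * ∑ w, adjInd z' w T) =
        treeAvg (fun T => adjInd x y T * ∑ w, adjInd z w T) := by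
    intro z' h1 h2
    obtain ⟨σ, hσ⟩ := exists_perm_of_injective (hinj z' h1 h2) (hinj z hxz.symm hyz.symm)
    have e0 : σ x = x := hσ 0
    have e1 : σ y = y := hσ 1
    have e2 : σ z' = z := hσ 2
    rw [← treeAvg_relabel σ (fun T => adjInd x y T * ∑ w, adjInd z w T)]
    congr 1
    funext T
    rw [← Equiv.sum_comp σ (fun w => adjInd z w (SpanningTree.relabel σ T))]
    congr 1
    · conv_rhs => rw [← e0, ← e1, adjInd_relabel]
    · refine Finset.sum_congr rfl fun w _ => ?_
      rw [← e2, adjInd_relabel]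
  have hcard : 3 ≤ n := by
    have := Fintype.card_le_of_injective _ (hinj z hxz.symm hyz.symm)
    simpa using this
  have h1 : treeAvg (fun T : SpanningTree V => adjInd x y T * (2 * ((n : ℝ) - 1)))
      = 2 / n * (2 * ((n : ℝ) - 1)) := by
    rw [treeAvg_mul_const, treeAvg_adjInd hxy]
  set S : Finset V := (Finset.univ.erase x).erase y with hS
  have hSc : S.card = n - 2 := by
    rw [hS, Finset.card_erase_of_mem (by simp [hxy.symm]), Finset.card_erase_of_mem (by simp)]
    simp [hn]; omega
  have h2 : ∑ z' ∈ S, treeAvg (fun T => adjInd x y T * ∑ w, adjInd z' w T) ≤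
      treeAvg (fun T : SpanningTree V => adjInd x y T * (2 * ((n : ℝ) - 1))) := by
    simp only [← treeAvg_sum]
    apply treeAvg_mono
    intro T
    simp only [← Finset.mul_sum]
    apply mul_le_mul_of_nonneg_left _ (adjInd_nonneg _ _ _)
    rw [← sum_sum_adjInd T]
    exact Finset.sum_le_sum_of_subset_of_nonneg
      (Finset.subset_univ S) fun c' _ _ => Finset.sum_nonneg fun d' _ => adjInd_nonneg _ _ _
  have h3 : ∑ z' ∈ S, treeAvg (fun T => adjInd x y T * ∑ w, adjInd z' w T) =
      ((n : ℝ) - 2) * treeAvg (fun T => adjInd x y T * ∑ w, adjInd z w T) := by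
    rw [Finset.sum_congr rfl (g := fun _ => treeAvg (fun T => adjInd x y T * ∑ w, adjInd z w T)),
      Finset.sum_const, hSc, nsmul_eq_mul, Nat.cast_sub (by omega)]
    · simp
    · intro z' hz'
      simp only [hS, Finset.mem_erase, Finset.mem_univ, and_true] at hz'
      exact key z' hz'.2 hz'.1
  have hn0 : (0 : ℝ) < n := by exact_mod_cast (by omega : 0 < n)
  calc _ = n * (((n : ℝ) - 2) * treeAvg (fun T => adjInd x y T * ∑ w, adjInd z w T)) := by ring
    _ ≤ n * (2 / n * (2 * ((n : ℝ) - 1))) := by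
        rw [← h3, ← h1]
        exact mul_le_mul_of_nonneg_left h2 hn0.le
    _ = _ := by field_simp; ring

end adjInd

/-! ### Pairs of edges in a random spanning tree -/

lemma SimpleGraph.Reachable.of_adj_reachable {V : Type*} {G G' : SimpleGraph V} {u v : V}
    (h : G.Reachable u v) (H : ∀ a b, G.Adj a b → G'.Reachable a b) : G'.Reachable u v := by
  obtain ⟨p⟩ := h
  induction p with
  | nil => rfl
  | cons hab _ ih => exact (H _ _ hab).trans ih

lemma SimpleGraph.IsTree.not_reachable_deleteEdges {V : Type*} {T : SimpleGraph V} (hT : T.IsTree)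
    {y z : V} (hyz : T.Adj y z) : ¬ (T.deleteEdges {s(y, z)}).Reachable y z :=
  (SimpleGraph.isAcyclic_iff_forall_adj_isBridge.1 hT.isAcyclic hyz)

/-- Moving the endpoint `y` of the edge `yz` of a tree to a vertex on the side of `y`. -/
lemma SimpleGraph.IsTree.move_edge {V : Type*} {T : SimpleGraph V} (hT : T.IsTree) {y z w : V}
    (hyz : T.Adj y z) (hr : (T.deleteEdges {s(y, z)}).Reachable y w) :
    (T.deleteEdges {s(y, z)} ⊔ SimpleGraph.edge z w).IsTree := by
  have hb := hT.not_reachable_deleteEdges hyz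
  have hzw : ¬ (T.deleteEdges {s(y, z)}).Reachable z w := fun h => hb (hr.trans h.symm)
  have hne : z ≠ w := fun h => hzw (h ▸ SimpleGraph.Reachable.refl _)
  have := hT.connected.nonempty
  refine ⟨⟨fun u v => ?_⟩, ?_⟩
  · refine (hT.connected.preconnected u v).of_adj_reachable fun a b hab => ?_
    have hyz' : (T.deleteEdges {s(y, z)} ⊔ SimpleGraph.edge z w).Reachable y z := by
      refine (hr.mono le_sup_left).trans (SimpleGraph.Adj.reachable ?_)
      right
      rw [SimpleGraph.edge_adj]
      exact ⟨Or.inr ⟨rfl, rfl⟩, hne.symm⟩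
    by_cases h : s(a, b) = s(y, z)
    · rcases Sym2.eq_iff.1 h with ⟨rfl, rfl⟩ | ⟨rfl, rfl⟩
      · exact hyz'
      · exact hyz'.symm
    · refine SimpleGraph.Adj.reachable (Or.inl ?_)
      rw [SimpleGraph.deleteEdges_adj]
      exact ⟨hab, h⟩
  · exact (hT.isAcyclic.anti (SimpleGraph.deleteEdges_le _)).sup_edge_of_not_reachable hzw

/-- The path from `y` to `w` starts with at most one of the edges `yz` and `yx`; deleting the other
one does not affect it. -/
lemma SimpleGraph.IsTree.reachable_deleteEdges_or {V : Type*} {T : SimpleGraph V} (hT : T.IsTree)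
    {x y z : V} (hxz : x ≠ z) (w : V) :
    (T.deleteEdges {s(y, z)}).Reachable y w ∨ (T.deleteEdges {s(y, x)}).Reachable y w := by
  obtain ⟨p, hp⟩ := (hT.connected.preconnected y w).exists_isPath
  cases p with
  | nil => exact Or.inl (SimpleGraph.Reachable.refl _)
  | @cons _ b _ h q =>
    rw [SimpleGraph.Walk.cons_isPath_iff] at hp
    have key : ∀ c, c ≠ b → (T.deleteEdges {s(y, c)}).Reachable y w := by
      intro c hc
      have hq : ∀ e ∈ q.edges, e ∉ ({s(y, c)} : Set (Sym2 V)) := by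
        intro e he hec
        rw [Set.mem_singleton_iff] at hec
        subst hec
        exact hp.2 (q.fst_mem_support_of_mem_edges he)
      have h1 : (T.deleteEdges {s(y, c)}).Adj y b := by
        rw [SimpleGraph.deleteEdges_adj]
        refine ⟨h, fun hh => hc ?_⟩
        rcases Sym2.eq_iff.1 (Set.mem_singleton_iff.1 hh) with ⟨_, h2⟩ | ⟨h2, h3⟩
        · exact h2.symm
        · exact (h.ne h3.symm).elim
      exact h1.reachable.trans ⟨q.toDeleteEdges _ hq⟩
    by_cases hb : z = b
    · exact Or.inr (key x (hb ▸ hxz))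
    · exact Or.inl (key z hb)

/-- A switching: replace the edge `yz` by `zw`. The result is a tree because `w` lies on the side of
`y`, and the original tree is recovered by switching back. -/
lemma card_cherry_side_le {V : Type*} [Finite V] {x y z : V} (hxy : x ≠ y)
    (hxz : x ≠ z) (w : V) :
    (Finset.univ.filter fun T : SpanningTree V => T.1.Adj x y ∧ T.1.Adj y z ∧
        (T.1.deleteEdges {s(y, z)}).Reachable y w).card ≤
      (Finset.univ.filter fun T : SpanningTree V => T.1.Adj x y ∧ T.1.Adj z w).card := by
  refine Finset.card_le_card_of_injOn
    (fun T => if h : (T.1.deleteEdges {s(y, z)} ⊔ SimpleGraph.edge z w).IsTree then ⟨_, h⟩ else T)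
    ?_ ?_
  · intro T hT
    simp only [Finset.coe_filter, Finset.mem_univ, true_and, Set.mem_ofPred_eq] at hT ⊢
    rw [dif_pos (T.2.move_edge hT.2.1 hT.2.2)]
    have hzw : z ≠ w := fun h => T.2.not_reachable_deleteEdges hT.2.1 (h ▸ hT.2.2)
    constructor
    · left
      rw [SimpleGraph.deleteEdges_adj]
      refine ⟨hT.1, fun h => ?_⟩
      rcases Sym2.eq_iff.1 (Set.mem_singleton_iff.1 h) with ⟨h2, _⟩ | ⟨h2, _⟩
      · exact hxy h2
      · exact hxz h2
    · right
      rw [SimpleGraph.edge_adj]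
      exact ⟨Or.inl ⟨rfl, rfl⟩, hzw⟩
  · intro T hT T' hT' h
    simp only [Finset.coe_filter, Finset.mem_univ, true_and, Set.mem_ofPred_eq] at hT hT'
    simp only [dif_pos (T.2.move_edge hT.2.1 hT.2.2), dif_pos (T'.2.move_edge hT'.2.1 hT'.2.2),
      Subtype.mk.injEq] at h
    have hrec : ∀ T : SpanningTree V, T.1.Adj y z → (T.1.deleteEdges {s(y, z)}).Reachable y w →
        T.1.edgeSet = ((T.1.deleteEdges {s(y, z)} ⊔ SimpleGraph.edge z w).edgeSet \ {s(z, w)}) ∪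
          {s(y, z)} := by
      intro T h1 h2
      have h3 := T.2.not_reachable_deleteEdges h1
      have hzw : z ≠ w := fun h => h3 (h ▸ h2)
      have h4 : s(z, w) ∉ (T.1.deleteEdges {s(y, z)}).edgeSet := fun h5 =>
        h3 (h2.trans (SimpleGraph.Adj.reachable h5).symm)
      rw [SimpleGraph.edgeSet_sup, SimpleGraph.edgeSet_edge_of_ne hzw, Set.union_sdiff_right,
        Set.sdiff_singleton_eq_self h4, SimpleGraph.edgeSet_deleteEdges, Set.sdiff_union_self,
        Set.union_eq_self_of_subset_right]
      simpa using h1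
    apply Subtype.ext
    apply SimpleGraph.edgeSet_injective
    rw [hrec T hT.2.1 hT.2.2, hrec T' hT'.2.1 hT'.2.2, h]

/-- For every `w`, one of the two edges of the path `x y z` can be switched to end at `w`. Summing
over `w` bounds `n` times the probability of the path by two expected degrees as in
`treeAvg_adjInd_mul_sum_le`. -/
lemma treeAvg_cherry_le {V : Type*} [Fintype V] [Nonempty V] {x y z : V} (hxy : x ≠ y)
    (hyz : y ≠ z) (hxz : x ≠ z) :
    (Fintype.card V : ℝ) ^ 2 * (Fintype.card V - 2) *
      treeAvg (fun T => adjInd x y T * adjInd y z T) ≤ 8 * ((Fintype.card V : ℝ) - 1) := by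
  have hcard : ∀ (p : SpanningTree V → Prop) [DecidablePred p]
      (F : SpanningTree V → ℝ),
      (∀ T, F T = if p T then 1 else 0) → treeAvg F =
        ((Finset.univ.filter p).card : ℝ) / Fintype.card (SpanningTree V) := by
    intro p _ F hF
    simp [treeAvg, hF]
  have step : ∀ w, treeAvg (fun T => adjInd x y T * adjInd y z T) ≤
      treeAvg (fun T => adjInd x y T * adjInd z w T) +
        treeAvg (fun T => adjInd z y T * adjInd x w T) := by
    intro w
    rw [hcard (fun T => T.1.Adj x y ∧ T.1.Adj y z) _
        (fun T => by unfold adjInd; split_ifs <;> simp_all),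
      hcard (fun T => T.1.Adj x y ∧ T.1.Adj z w) _
        (fun T => by unfold adjInd; split_ifs <;> simp_all),
      hcard (fun T => T.1.Adj z y ∧ T.1.Adj x w) _
        (fun T => by unfold adjInd; split_ifs <;> simp_all), ← add_div]
    gcongr
    norm_cast
    refine le_trans ?_ (add_le_add (card_cherry_side_le hxy hxz w)
      (card_cherry_side_le hyz.symm hxz.symm w))
    refine (Finset.card_le_card ?_).trans (Finset.card_union_le _ _)
    intro T
    simp only [Finset.mem_filter, Finset.mem_univ, true_and, Finset.mem_union]
    rintro ⟨h1, h2⟩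
    rcases T.2.reachable_deleteEdges_or (y := y) hxz w with h | h
    · exact Or.inl ⟨h1, h2, h⟩
    · exact Or.inr ⟨h2.symm, h1.symm, h⟩
  have hsum := Finset.sum_le_sum (s := Finset.univ) fun w _ => step w
  rw [Finset.sum_const, Finset.sum_add_distrib, ← treeAvg_sum, ← treeAvg_sum, Finset.card_univ,
    nsmul_eq_mul] at hsum
  simp only [← Finset.mul_sum] at hsum
  have h1 := treeAvg_adjInd_mul_sum_le hxy hxz hyz
  have h2 := treeAvg_adjInd_mul_sum_le hyz.symm hxz.symm hxy.symm
  have hn : (2 : ℝ) ≤ Fintype.card V := by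
    have := Fintype.one_lt_card_iff.2 ⟨x, y, hxy⟩
    exact_mod_cast this
  have h3 : 0 ≤ (Fintype.card V : ℝ) * (Fintype.card V - 2) :=
    mul_nonneg (by linarith) (by linarith)
  have h4 := mul_le_mul_of_nonneg_left hsum h3
  nlinarith

/-- The indicator of a pair being an edge of a spanning tree. -/
def edgeInd {V : Type*} (e : Sym2 V) (T : SpanningTree V) : ℝ := if e ∈ T.1.edgeSet then 1 else 0

lemma edgeInd_mk {V : Type*} (x y : V) : edgeInd s(x, y) = adjInd x y := rfl

lemma edgeInd_nonneg {V : Type*} (e : Sym2 V) (T : SpanningTree V) : 0 ≤ edgeInd e T := by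
  unfold edgeInd; split_ifs <;> norm_num

/-! ### Second moments of the number of tree edges in a set of pairs. -/

section edges
variable {V : Type*} [Fintype V] [Nonempty V]

lemma treeAvg_edgeInd {e : Sym2 V} (he : ¬ e.IsDiag) : treeAvg (edgeInd e) = 2 / Fintype.card V := by
  induction e with | _ x y => ?_
  exact treeAvg_adjInd (by simpa using he)

lemma treeAvg_edgeInd_mul_disjoint_le {e f : Sym2 V} (he : ¬ e.IsDiag) (hf : ¬ f.IsDiag)
    (h : ∀ v, v ∈ e → v ∉ f) (hn : 5 ≤ Fintype.card V) :
    treeAvg (fun T => edgeInd e T * edgeInd f T) ≤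
      4 / (Fintype.card V : ℝ) ^ 2 * (1 + 12 / Fintype.card V) := by
  induction e with | _ a b => ?_
  induction f with | _ c d => ?_
  have hn' : (5 : ℝ) ≤ Fintype.card V := by exact_mod_cast hn
  simp only [Sym2.mk_isDiag_iff, Sym2.mem_iff, not_or, forall_eq_or_imp, forall_eq] at he hf h
  have h1 := treeAvg_adjInd_mul_disjoint_le he h.1.1 h.1.2 h.2.1 h.2.2 hf
  set n : ℝ := (Fintype.card V : ℝ)
  set p := treeAvg fun T => adjInd a b T * adjInd c d T
  change p ≤ _
  have h0 : 0 < n * (n - 2) * (n - 3) :=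
    mul_pos (mul_pos (by linarith) (by linarith)) (by linarith)
  rw [mul_comm, ← le_div_iff₀ h0] at h1
  refine h1.trans ?_
  rw [show 4 / n ^ 2 * (1 + 12 / n) = 4 * (n + 12) / n ^ 3 by field_simp, div_le_div_iff₀ h0 (by positivity)]
  -- The difference of the two sides after cross-multiplication, expanded around `n = 5` so that all
  -- coefficients are positive.
  have h2 : 0 ≤ 4 * n * (8 * (n - 5) ^ 2 + 26 * (n - 5) + 2) := by
    have : 0 ≤ n - 5 := by linarith
    have : 0 ≤ n := by linarith
    positivity
  nlinarith [h2]

lemma treeAvg_edgeInd_mul_le {e f : Sym2 V} (he : ¬ e.IsDiag) (hf : ¬ f.IsDiag)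
    (h : e ≠ f) (hn : 5 ≤ Fintype.card V) :
    treeAvg (fun T => edgeInd e T * edgeInd f T) ≤ 16 / (Fintype.card V : ℝ) ^ 2 := by
  have hn' : (5 : ℝ) ≤ Fintype.card V := by exact_mod_cast hn
  by_cases hd : ∀ v, v ∈ e → v ∉ f
  · refine (treeAvg_edgeInd_mul_disjoint_le he hf hd hn).trans ?_
    have : 12 / (Fintype.card V : ℝ) ≤ 12 / 5 := by rw [div_le_iff₀ (by linarith)]; linarith
    rw [div_mul_eq_mul_div]
    gcongr
    linarith
  · push Not at hd
    obtain ⟨y, hy, hy'⟩ := hd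
    obtain ⟨x, rfl⟩ := Sym2.mem_iff_exists.1 hy
    obtain ⟨z, rfl⟩ := Sym2.mem_iff_exists.1 hy'
    simp only [Sym2.mk_isDiag_iff] at he hf
    have hxz : x ≠ z := fun h' => h (h' ▸ rfl)
    have h1 := treeAvg_cherry_le (Ne.symm he) hf hxz
    rw [edgeInd_mk, edgeInd_mk, adjInd_comm y x]
    set n : ℝ := (Fintype.card V : ℝ)
    rw [le_div_iff₀ (by positivity), mul_comm]
    nlinarith

/-- Second moment bound for the probability that a random tree meets a bounded-degree set of
pairs. -/
lemma le_treeAvg_hit {Q : Finset (Sym2 V)} {Δ : ℕ} (hQ : ∀ e ∈ Q, ¬ e.IsDiag)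
    (hΔ : ∀ v, (Q.filter fun e => v ∈ e).card ≤ Δ) (hΔn : Δ ≤ Fintype.card V)
    (hn : 5 ≤ Fintype.card V) :
    (Q.card : ℝ) / (Q.card + 15 * Fintype.card V) ≤
      treeAvg (fun T => if ∃ e ∈ Q, e ∈ T.1.edgeSet then 1 else 0) := by
  set n : ℝ := (Fintype.card V : ℝ) with hn0
  set m : ℝ := (Q.card : ℝ) with hm
  have hn' : (5 : ℝ) ≤ n := by rw [hn0]; exact_mod_cast hn
  have hΔn' : (Δ : ℝ) ≤ n := by rw [hn0]; exact_mod_cast hΔn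
  have hm0 : 0 ≤ m := Nat.cast_nonneg _
  have hn1 : 0 < n := by linarith
  rcases eq_or_lt_of_le hm0 with hm1 | hm1
  · rw [← hm1]
    simp only [zero_div]
    exact treeAvg_nonneg fun T => by split_ifs <;> norm_num
  set X : SpanningTree V → ℝ := fun T => ∑ e ∈ Q, edgeInd e T with hX
  set Y : SpanningTree V → ℝ := fun T => if ∃ e ∈ Q, e ∈ T.1.edgeSet then 1 else 0 with hY
  have hEX : treeAvg X = 2 * m / n := by
    rw [hX, treeAvg_sum, Finset.sum_congr rfl (fun e he => treeAvg_edgeInd (hQ e he)),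
      Finset.sum_const, nsmul_eq_mul]
    ring
  have hXY : ∀ T, X T = X T * Y T := by
    intro T
    by_cases h : ∃ e ∈ Q, e ∈ T.1.edgeSet
    · simp [hY, h]
    · have : X T = 0 := Finset.sum_eq_zero fun e he => by
        simp only [edgeInd, ite_eq_right_iff]
        exact fun h' => (h ⟨e, he, h'⟩).elim
      simp [this]
  have hY2 : ∀ T, Y T ^ 2 = Y T := by intro T; simp only [hY]; split_ifs <;> norm_num
  have := SpanningTree.nonempty V
  have hN : (0 : ℝ) < Fintype.card (SpanningTree V) := by exact_mod_cast Fintype.card_pos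
  -- Cauchy–Schwarz for `X = X * Y`, where `Y` indicates `X > 0`.
  have hCS : (treeAvg X) ^ 2 ≤ treeAvg (fun T => X T ^ 2) * treeAvg Y := by
    have h1 := Finset.sum_mul_sq_le_sq_mul_sq Finset.univ X Y
    simp only [← hXY, hY2] at h1
    simp only [treeAvg]
    rw [div_pow, div_mul_div_comm, ← sq]
    gcongr
  have hm2 : 2 * m ≤ n ^ 2 := by
    have h1 : Q ⊆ (⊤ : SimpleGraph V).edgeFinset := by
      intro e he
      simp only [SimpleGraph.mem_edgeFinset, SimpleGraph.edgeSet_top]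
      exact hQ e he
    have h2 := Finset.card_le_card h1
    rw [SimpleGraph.card_edgeFinset_top_eq_card_choose_two, Nat.choose_two_right] at h2
    have h3 : 2 * Q.card ≤ Fintype.card V * (Fintype.card V - 1) := by omega
    have h4 : 2 * Q.card ≤ Fintype.card V ^ 2 := by
      refine h3.trans ?_
      rw [sq]
      exact Nat.mul_le_mul_left _ (Nat.sub_le _ _)
    rw [hm, hn0]
    exact_mod_cast h4
  have hEX2 : treeAvg (fun T => X T ^ 2) ≤ 4 * m ^ 2 / n ^ 2 + 60 * m / n := by
    have h1 : ∀ T, X T ^ 2 = ∑ e ∈ Q, ∑ f ∈ Q, edgeInd e T * edgeInd f T := by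
      intro T
      rw [sq, Finset.sum_mul_sum]
    simp only [h1, treeAvg_sum]
    -- The diagonal, the intersecting pairs and the disjoint pairs. The first two contribute `O(m /
    -- n)` since an edge meets at most `2 * Δ ≤ 2 * n` others; the third gives the square of the
    -- mean up to `O(m / n)`, as `2 * m ≤ n ^ 2`.
    have h2 : ∀ e ∈ Q, ∀ f ∈ Q, treeAvg (fun T => edgeInd e T * edgeInd f T) ≤
        (if e = f then 2 / n else 0) + (if ∃ v, v ∈ e ∧ v ∈ f then 16 / n ^ 2 else 0) +
          4 / n ^ 2 * (1 + 12 / n) := by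
      intro e he f hf
      have p1 : (0 : ℝ) ≤ if e = f then 2 / n else 0 := by split_ifs <;> positivity
      have p2 : (0 : ℝ) ≤ if ∃ v, v ∈ e ∧ v ∈ f then 16 / n ^ 2 else 0 := by
        split_ifs <;> positivity
      have p3 : (0 : ℝ) ≤ 4 / n ^ 2 * (1 + 12 / n) := by positivity
      by_cases h : e = f
      · subst h
        have : (fun T => edgeInd e T * edgeInd e T) = edgeInd e := by
          funext T; unfold edgeInd; split_ifs <;> norm_num
        rw [this, treeAvg_edgeInd (hQ e he), if_pos rfl]
        linarith
      · by_cases h' : ∃ v, v ∈ e ∧ v ∈ f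
        · have := treeAvg_edgeInd_mul_le (hQ e he) (hQ f hf) h hn
          rw [if_pos h']
          linarith
        · have := treeAvg_edgeInd_mul_disjoint_le (hQ e he) (hQ f hf)
            (fun v h1 h2 => h' ⟨v, h1, h2⟩) hn
          linarith
    have h3 : ∀ e ∈ Q, ∑ f ∈ Q, treeAvg (fun T => edgeInd e T * edgeInd f T) ≤
        2 / n + 2 * n * (16 / n ^ 2) + m * (4 / n ^ 2 * (1 + 12 / n)) := by
      intro e he
      refine (Finset.sum_le_sum fun f hf => h2 e he f hf).trans ?_
      rw [Finset.sum_add_distrib, Finset.sum_add_distrib, Finset.sum_const, nsmul_eq_mul,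
        Finset.sum_ite_eq, if_pos he, ← Finset.sum_filter, Finset.sum_const, nsmul_eq_mul]
      gcongr
      have : (Q.filter fun f => ∃ v, v ∈ e ∧ v ∈ f).card ≤ 2 * Δ := by
        induction e with | _ x y => ?_
        refine (Finset.card_le_card (t := (Q.filter fun f => x ∈ f) ∪ (Q.filter fun f => y ∈ f))
          ?_).trans ((Finset.card_union_le _ _).trans (by have := hΔ x; have := hΔ y; omega))
        intro f
        simp only [Sym2.mem_iff, exists_eq_or_imp, exists_eq_left, Finset.mem_filter,
          Finset.mem_union]
        tauto
      calc ((Q.filter fun f => ∃ v, v ∈ e ∧ v ∈ f).card : ℝ) ≤ ((2 * Δ : ℕ) : ℝ) := by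
            exact_mod_cast this
        _ ≤ _ := by push_cast; linarith
    refine (Finset.sum_le_sum h3).trans ?_
    rw [Finset.sum_const, nsmul_eq_mul, ← hm]
    have e1 : m * (2 / n + 2 * n * (16 / n ^ 2) + m * (4 / n ^ 2 * (1 + 12 / n))) =
        4 * m ^ 2 / n ^ 2 + m / n * (34 + 24 * (2 * m / n ^ 2)) := by
      field_simp
      ring
    rw [e1]
    have e2 : 2 * m / n ^ 2 ≤ 1 := by
      rw [div_le_one (pow_pos hn1 2)]; exact hm2
    have e3 : m / n * (34 + 24 * (2 * m / n ^ 2)) ≤ m / n * 60 :=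
      mul_le_mul_of_nonneg_left (by linarith) (div_nonneg hm0 hn1.le)
    have e4 : 60 * m / n = m / n * 60 := by ring
    linarith
  have hYnn : 0 ≤ treeAvg Y := treeAvg_nonneg fun T => by simp only [hY]; split_ifs <;> norm_num
  have h5 : (2 * m / n) ^ 2 ≤ (4 * m ^ 2 / n ^ 2 + 60 * m / n) * treeAvg Y := by
    rw [← hEX]
    exact hCS.trans (mul_le_mul_of_nonneg_right hEX2 hYnn)
  rw [div_le_iff₀ (by linarith)]
  have e5 : (2 * m / n) ^ 2 = (4 * m / n ^ 2) * m := by ring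
  have e6 : (4 * m ^ 2 / n ^ 2 + 60 * m / n) * treeAvg Y = (4 * m / n ^ 2) * (treeAvg Y * (m + 15 * n)) := by
    field_simp
    ring
  rw [e5, e6] at h5
  exact le_of_mul_le_mul_left h5 (div_pos (by linarith) (pow_pos hn1 2))

/-- In a small set of pairs, each is the only one in a random spanning tree with probability
at least `1 / n`. -/
lemma le_treeAvg_unique {R : Finset (Sym2 V)} (hR : ∀ e ∈ R, ¬ e.IsDiag)
    (hRn : 16 * R.card ≤ Fintype.card V) (hn : 5 ≤ Fintype.card V) {e : Sym2 V} (he : e ∈ R) :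
    1 / (Fintype.card V : ℝ) ≤
      treeAvg (fun T => if e ∈ T.1.edgeSet ∧ ∀ f ∈ R, f ∈ T.1.edgeSet → f = e then 1 else 0) := by
  set n : ℝ := (Fintype.card V : ℝ) with hn0
  have hn' : (5 : ℝ) ≤ n := by rw [hn0]; exact_mod_cast hn
  -- Bonferroni: the probability of `e` minus the probabilities of `e` together with another pair of
  -- `R`. This gives at least `2 / n - 1 / n`.
  have h1 : treeAvg (fun T => edgeInd e T - ∑ f ∈ R.erase e, edgeInd e T * edgeInd f T) ≤
      treeAvg (fun T => if e ∈ T.1.edgeSet ∧ ∀ f ∈ R, f ∈ T.1.edgeSet → f = e then 1 else 0) := by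
    apply treeAvg_mono
    intro T
    have hs : 0 ≤ ∑ f ∈ R.erase e, edgeInd e T * edgeInd f T :=
      Finset.sum_nonneg fun f _ => mul_nonneg (edgeInd_nonneg _ _) (edgeInd_nonneg _ _)
    by_cases h : e ∈ T.1.edgeSet
    · by_cases h' : ∀ f ∈ R, f ∈ T.1.edgeSet → f = e
      · have h2 : edgeInd e T = 1 := if_pos h
        rw [if_pos ⟨h, h'⟩]
        linarith
      · push Not at h'
        obtain ⟨f, hf, hf', hfe⟩ := h'
        have : (1 : ℝ) ≤ ∑ f ∈ R.erase e, edgeInd e T * edgeInd f T := by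
          refine le_trans ?_ (Finset.single_le_sum (f := fun f => edgeInd e T * edgeInd f T)
            (fun f _ => mul_nonneg (edgeInd_nonneg _ _) (edgeInd_nonneg _ _))
            (Finset.mem_erase.2 ⟨hfe, hf⟩))
          simp [edgeInd, h, hf']
        have h2 : edgeInd e T = 1 := if_pos h
        rw [h2] at this ⊢
        split_ifs <;> linarith
    · have h2 : edgeInd e T = 0 := if_neg h
      rw [if_neg (fun hh => h hh.1)]
      linarith
  refine le_trans ?_ h1
  rw [treeAvg_sub, treeAvg_sum, treeAvg_edgeInd (hR e he)]
  have h2 : ∑ f ∈ R.erase e, treeAvg (fun T => edgeInd e T * edgeInd f T) ≤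
      ∑ f ∈ R.erase e, 16 / n ^ 2 := Finset.sum_le_sum fun f hf =>
    treeAvg_edgeInd_mul_le (hR e he) (hR f (Finset.mem_of_mem_erase hf))
      (Finset.ne_of_mem_erase hf).symm hn
  rw [Finset.sum_const, nsmul_eq_mul] at h2
  have h3 : ((R.erase e).card : ℝ) * (16 / n ^ 2) ≤ n * (1 / n ^ 2) := by
    have : (16 * (R.erase e).card : ℝ) ≤ n := by
      rw [hn0]
      have := Finset.card_le_card (Finset.erase_subset e R)
      exact_mod_cast (by omega : 16 * (R.erase e).card ≤ Fintype.card V)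
    calc ((R.erase e).card : ℝ) * (16 / n ^ 2) = 16 * (R.erase e).card * (1 / n ^ 2) := by ring
      _ ≤ _ := by gcongr
  have h4 : n * (1 / n ^ 2) = 1 / n := by field_simp
  have h5 : 2 / n = 1 / n + 1 / n := by ring
  linarith

end edges

/-! ### The value of the game -/

/-- Builder's graph after claiming the edge `o` (if any). -/
def claim {V : Type*} {T : SpanningTree V} (G : SimpleGraph V) (o : Option T.1.edgeSet) :
    SimpleGraph V :=
  G ⊔ SimpleGraph.fromEdgeSet {e | ∃ h : e ∈ T.1.edgeSet, o = some ⟨e, h⟩}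

lemma le_claim {V : Type*} {T : SpanningTree V} (G : SimpleGraph V) (o : Option T.1.edgeSet) :
    G ≤ claim G o := le_sup_left

lemma claim_none {V : Type*} {T : SpanningTree V} (G : SimpleGraph V) :
    claim (T := T) G none = G := by
  simp [claim]

lemma mem_claim_some {V : Type*} {T : SpanningTree V} (G : SimpleGraph V) {e : Sym2 V}
    (h : e ∈ T.1.edgeSet) : e ∈ (claim G (some ⟨e, h⟩)).edgeSet := by
  rw [claim, SimpleGraph.edgeSet_sup, SimpleGraph.edgeSet_fromEdgeSet]
  exact Or.inr ⟨⟨h, rfl⟩, T.1.not_isDiag_of_mem_edgeSet h⟩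

/-- The least probability with which Builder, starting from the graph `G`, fails to have a graph
in the family `A` after `k` further rounds. -/
def loss {V : Type*} [Finite V] (A : Set (SimpleGraph V)) : ℕ → SimpleGraph V → ℝ
  | 0, G => if G ∈ A then 0 else 1
  | k + 1, G => treeAvg fun T => ⨅ o : Option T.1.edgeSet, loss A k (claim G o)

section loss
variable {V : Type*} [Finite V] {A B : Set (SimpleGraph V)}

lemma loss_nonneg (k : ℕ) (G : SimpleGraph V) : 0 ≤ loss A k G := by
  induction k generalizing G with
  | zero => unfold loss; split_ifs <;> norm_num
  | succ k ih => exact treeAvg_nonneg fun T => le_ciInf fun o => ih _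

lemma loss_succ_le (k : ℕ) (G : SimpleGraph V) (c : ∀ T : SpanningTree V, Option T.1.edgeSet) :
    loss A (k + 1) G ≤ treeAvg fun T => loss A k (claim G (c T)) :=
  treeAvg_mono fun T => ciInf_le (Set.finite_range _).bddBelow (c T)

lemma exists_loss_succ_eq (k : ℕ) (G : SimpleGraph V) :
    ∃ c : ∀ T : SpanningTree V, Option T.1.edgeSet,
      loss A (k + 1) G = treeAvg fun T => loss A k (claim G (c T)) := by
  have h : ∀ T : SpanningTree V, ∃ o : Option T.1.edgeSet,
      loss A k (claim G o) = ⨅ o : Option T.1.edgeSet, loss A k (claim G o) :=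
    fun T => exists_eq_ciInf_of_finite
  choose c hc using h
  exact ⟨c, by simp only [hc]; rfl⟩

variable [Nonempty V]

lemma loss_succ_le_loss (k : ℕ) (G : SimpleGraph V) : loss A (k + 1) G ≤ loss A k G := by
  refine (loss_succ_le k G fun _ => none).trans ?_
  simp only [claim_none, treeAvg_const, le_refl]

lemma loss_antitone (G : SimpleGraph V) : Antitone fun k => loss A k G :=
  antitone_nat_of_succ_le fun k => loss_succ_le_loss k G

lemma loss_le_one (k : ℕ) (G : SimpleGraph V) : loss A k G ≤ 1 := by
  refine (loss_antitone G (Nat.zero_le k)).trans ?_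
  simp only [loss]
  split_ifs <;> norm_num

lemma loss_eq_zero {k : ℕ} {G : SimpleGraph V} (h : G ∈ A) : loss A k G = 0 := by
  refine le_antisymm ((loss_antitone G (Nat.zero_le k)).trans ?_) (loss_nonneg _ _)
  simp [loss, h]

/-- First reach the family `B`, then `A`. -/
lemma loss_add_le {k l : ℕ} {ε : ℝ} (hε : 0 ≤ ε) (h : ∀ G ∈ B, loss A l G ≤ ε)
    (G : SimpleGraph V) : loss A (k + l) G ≤ loss B k G + ε := by
  induction k generalizing G with
  | zero =>
    rw [zero_add]
    by_cases hG : G ∈ B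
    · rw [loss_eq_zero hG, zero_add]
      exact h G hG
    · have : loss B 0 G = 1 := by simp [loss, hG]
      rw [this]
      linarith [loss_le_one (A := A) l G]
  | succ k ih =>
    obtain ⟨c, hc⟩ := exists_loss_succ_eq (A := B) k G
    rw [hc, show k + 1 + l = k + l + 1 by omega]
    refine (loss_succ_le (k + l) G c).trans ?_
    refine (treeAvg_mono fun T => ih (claim G (c T))).trans ?_
    rw [treeAvg_add, treeAvg_const]

lemma loss_mono_set (h : A ⊆ B) (k : ℕ) (G : SimpleGraph V) : loss B k G ≤ loss A k G := by
  have := loss_add_le (A := B) (B := A) (k := k) (l := 0) le_rfl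
    (fun G hG => (loss_eq_zero (h hG)).le) G
  simpa using this

end loss

/-! ### Two greedy strategies: hitting every set of a family, and collecting most of a set. -/

section strategies
variable {V : Type*} [Fintype V] [Nonempty V]

/-- In a small set `R` of pairs every pair can be claimed at rate `1 / n`, so that given subsets
of size at least `q` are all hit, up to a union bound. -/
lemma loss_hit_all_le {R : Finset (Sym2 V)} (hR : ∀ e ∈ R, ¬ e.IsDiag)
    (hRn : 16 * R.card ≤ Fintype.card V) (hn : 5 ≤ Fintype.card V)
    {ι : Type*} [Fintype ι] (Q : ι → Finset (Sym2 V)) (hQR : ∀ i, Q i ⊆ R) {q : ℕ}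
    (hq : ∀ i, q ≤ (Q i).card) (k : ℕ) {G₀ G : SimpleGraph V} (hG : G₀ ≤ G) :
    loss {G' | G₀ ≤ G' ∧ ∀ i, ∃ e ∈ Q i, e ∈ G'.edgeSet} k G ≤
      ((Finset.univ.filter fun i => ∀ e ∈ Q i, e ∉ G.edgeSet).card : ℝ) *
        Real.exp (-(q / Fintype.card V : ℝ)) ^ k := by
  induction k generalizing G with
  | zero =>
    by_cases h : G ∈ {G' | G₀ ≤ G' ∧ ∀ i, ∃ e ∈ Q i, e ∈ G'.edgeSet}
    · rw [loss_eq_zero h]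
      positivity
    · refine (loss_le_one _ _).trans ?_
      rw [pow_zero, mul_one]
      have h' : ∃ i, ∀ e ∈ Q i, e ∉ G.edgeSet := by
        by_contra hcon
        push Not at hcon
        exact h ⟨hG, hcon⟩
      obtain ⟨i, hi⟩ := h'
      exact_mod_cast Finset.card_pos.2 ⟨i, by simpa using hi⟩
  | succ k ih =>
    set R' := R.filter fun e => e ∉ G.edgeSet with hR'
    let P : SpanningTree V → Sym2 V → Prop := fun T e =>
      e ∈ T.1.edgeSet ∧ ∀ f ∈ R', f ∈ T.1.edgeSet → f = e
    -- Claim an edge only if it is the unique unclaimed pair of `R` in the tree. There is then no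
    -- conflict between the sets `Q i`, and the events belonging to different pairs are disjoint, so
    -- their probabilities add up.
    let c : ∀ T : SpanningTree V, Option T.1.edgeSet := fun T =>
      if h : ∃ e, e ∈ R' ∧ P T e then some ⟨h.choose, h.choose_spec.2.1⟩ else none
    have hc : ∀ T e, e ∈ R' → P T e → e ∈ (claim G (c T)).edgeSet := by
      intro T e he hP
      have h : ∃ e, e ∈ R' ∧ P T e := ⟨e, he, hP⟩
      have h1 : c T = some ⟨h.choose, h.choose_spec.2.1⟩ := dif_pos h
      have h2 : e = h.choose := h.choose_spec.2.2 e he hP.1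
      rw [h1]
      exact Set.mem_of_eq_of_mem h2 (mem_claim_some G _)
    refine (loss_succ_le k G c).trans ?_
    refine (treeAvg_mono fun T => ih (hG.trans (le_claim G (c T)))).trans ?_
    rw [treeAvg_mul_const, pow_succ']
    rw [← mul_assoc]
    gcongr
    set alive := Finset.univ.filter fun i => ∀ e ∈ Q i, e ∉ G.edgeSet with halive
    -- A set that is not yet hit lies inside `R'`, so it still offers at least `q` pairs. The
    -- expected number of unhit sets therefore shrinks by the factor `1 - q / n` in each round.
    have h1 : ∀ T : SpanningTree V,
        ((Finset.univ.filter fun i => ∀ e ∈ Q i, e ∉ (claim G (c T)).edgeSet).card : ℝ) ≤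
          ∑ i ∈ alive, (1 - ∑ e ∈ Q i, if P T e then (1 : ℝ) else 0) := by
      intro T
      have h2 : (Finset.univ.filter fun i => ∀ e ∈ Q i, e ∉ (claim G (c T)).edgeSet) =
          alive.filter fun i => ∀ e ∈ Q i, e ∉ (claim G (c T)).edgeSet := by
        rw [halive, Finset.filter_filter]
        refine Finset.filter_congr fun i _ => ⟨fun h => ⟨fun e he he' => h e he ?_, h⟩, fun h => h.2⟩
        exact SimpleGraph.edgeSet_mono (le_claim G (c T)) he'
      rw [h2, Finset.card_filter]
      push_cast
      refine Finset.sum_le_sum fun i hi => ?_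
      rw [halive, Finset.mem_filter] at hi
      have hQR' : ∀ e ∈ Q i, e ∈ R' := fun e he =>
        Finset.mem_filter.2 ⟨hQR i he, hi.2 e he⟩
      by_cases h3 : ∃ e ∈ Q i, P T e
      · obtain ⟨e, he, hP⟩ := h3
        rw [if_neg (fun h => h e he (hc T e (hQR' e he) hP)), Finset.sum_eq_single e, if_pos hP]
        · norm_num
        · intro f hf hfe
          exact if_neg fun hPf => hfe (hP.2 f (hQR' f hf) hPf.1)
        · exact fun h => (h he).elim
      · push Not at h3
        rw [Finset.sum_eq_zero fun e he => if_neg (h3 e he)]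
        split_ifs <;> norm_num
    refine (treeAvg_mono h1).trans ?_
    rw [treeAvg_sum]
    have h4 : ∀ i ∈ alive, treeAvg (fun T => 1 - ∑ e ∈ Q i, if P T e then (1 : ℝ) else 0) ≤
        Real.exp (-(q / Fintype.card V : ℝ)) := by
      intro i hi
      rw [halive, Finset.mem_filter] at hi
      rw [treeAvg_sub, treeAvg_const, treeAvg_sum]
      have h5 : ∑ e ∈ Q i, 1 / (Fintype.card V : ℝ) ≤
          ∑ e ∈ Q i, treeAvg (fun T => if P T e then (1 : ℝ) else 0) := by
        refine Finset.sum_le_sum fun e he => ?_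
        refine le_treeAvg_unique (R := R') (fun f hf => hR f (Finset.mem_of_mem_filter f hf)) ?_ hn
          (Finset.mem_filter.2 ⟨hQR i he, hi.2 e he⟩)
        exact (Nat.mul_le_mul_left 16 (Finset.card_le_card (Finset.filter_subset _ R))).trans hRn
      rw [Finset.sum_const, nsmul_eq_mul, mul_one_div] at h5
      have h6 : (q : ℝ) / Fintype.card V ≤ (Q i).card / Fintype.card V := by
        gcongr
        exact_mod_cast hq i
      have h7 := Real.add_one_le_exp (-(q / Fintype.card V : ℝ))
      linarith
    refine (Finset.sum_le_sum h4).trans ?_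
    rw [Finset.sum_const, nsmul_eq_mul]

lemma loss_hit_all_le' {R : Finset (Sym2 V)} (hR : ∀ e ∈ R, ¬ e.IsDiag)
    (hRn : 16 * R.card ≤ Fintype.card V) (hn : 5 ≤ Fintype.card V)
    {ι : Type*} [Fintype ι] (Q : ι → Finset (Sym2 V)) (hQR : ∀ i, Q i ⊆ R) {q : ℕ}
    (hq : ∀ i, q ≤ (Q i).card) (k : ℕ) (G : SimpleGraph V) :
    loss {G' | G ≤ G' ∧ ∀ i, ∃ e ∈ Q i, e ∈ G'.edgeSet} k G ≤
      Fintype.card ι * Real.exp (-(q * (k / Fintype.card V : ℝ))) := by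
  refine (loss_hit_all_le hR hRn hn Q hQR hq k le_rfl).trans ?_
  rw [← Real.exp_nat_mul]
  gcongr
  · exact Finset.card_le_univ _
  · apply le_of_eq; ring

/-- The number of pairs of `Q` that are not edges of `G`. -/
def missing (Q : Finset (Sym2 V)) (G : SimpleGraph V) : ℕ :=
  (Q.filter fun e => e ∉ G.edgeSet).card

/-- As long as more than `m` pairs of `Q` are missing, one of them is offered with probability at
least `p`. -/
lemma loss_missing_le {Q : Finset (Sym2 V)} {m : ℕ} {p lam d : ℝ}
    (hp : ∀ Q' ⊆ Q, m < Q'.card →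
      p ≤ treeAvg (fun T => if ∃ e ∈ Q', e ∈ T.1.edgeSet then 1 else 0))
    (hlam : 0 ≤ lam) (hd : 0 ≤ d) (hpd : 1 - Real.exp (-lam) ≤ p * (1 - Real.exp (-(lam * d))))
    (k : ℕ) (G : SimpleGraph V) :
    loss {G' | missing Q G' ≤ m} k G ≤ Real.exp (lam * (d * missing Q G - k)) ∨
      missing Q G ≤ m := by
  rw [or_iff_not_imp_right]
  induction k generalizing G with
  | zero =>
    intro _
    refine (loss_le_one _ _).trans (Real.one_le_exp ?_)
    simp only [Nat.cast_zero, sub_zero]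
    positivity
  | succ k ih =>
    intro hG
    have ih' : ∀ G, loss {G' | missing Q G' ≤ m} k G ≤ Real.exp (lam * (d * missing Q G - k)) := by
      intro G
      by_cases h : missing Q G ≤ m
      · rw [loss_eq_zero (show G ∈ {G' | missing Q G' ≤ m} from h)]
        positivity
      · exact ih G h
    set Q' := Q.filter fun e => e ∉ G.edgeSet with hQ'
    let c : ∀ T : SpanningTree V, Option T.1.edgeSet := fun T =>
      if h : ∃ e ∈ Q', e ∈ T.1.edgeSet then some ⟨h.choose, h.choose_spec.2⟩ else none
    have hc : ∀ T : SpanningTree V, (∃ e ∈ Q', e ∈ T.1.edgeSet) →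
        missing Q (claim G (c T)) + 1 ≤ missing Q G := by
      intro T h
      have h1 : c T = some ⟨h.choose, h.choose_spec.2⟩ := dif_pos h
      rw [h1]
      apply Finset.card_lt_card
      rw [Finset.ssubset_iff_of_subset]
      · refine ⟨h.choose, h.choose_spec.1, ?_⟩
        rw [Finset.mem_filter, not_and_not_right]
        exact fun _ => mem_claim_some G _
      · intro e
        simp only [Finset.mem_filter]
        exact fun he => ⟨he.1, fun h' => he.2 (SimpleGraph.edgeSet_mono (le_claim G _) h')⟩
    have hc' : ∀ T : SpanningTree V, missing Q (claim G (c T)) ≤ missing Q G := by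
      intro T
      apply Finset.card_le_card
      intro e
      simp only [Finset.mem_filter]
      exact fun he => ⟨he.1, fun h' => he.2 (SimpleGraph.edgeSet_mono (le_claim G _) h')⟩
    refine (loss_succ_le k G c).trans ?_
    -- An exponential potential: `d` is the number of rounds budgeted per missing pair. A hit
    -- multiplies it by `exp (-(lam * d))`, each round passing by `exp lam`, and `hpd` makes it a
    -- supermartingale.
    set E := Real.exp (lam * (d * missing Q G - k)) with hE
    set Y : SpanningTree V → ℝ := fun T => if ∃ e ∈ Q', e ∈ T.1.edgeSet then 1 else 0 with hY
    have h1 : ∀ T : SpanningTree V, loss {G' | missing Q G' ≤ m} k (claim G (c T)) ≤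
        E + Y T * (E * (Real.exp (-(lam * d)) - 1)) := by
      intro T
      refine (ih' _).trans ?_
      by_cases h : ∃ e ∈ Q', e ∈ T.1.edgeSet
      · have h2 : Y T = 1 := if_pos h
        have h3 : ((missing Q (claim G (c T)) : ℕ) : ℝ) + 1 ≤ missing Q G := by exact_mod_cast hc T h
        rw [h2, one_mul, show E + E * (Real.exp (-(lam * d)) - 1) = E * Real.exp (-(lam * d)) by ring,
          hE, ← Real.exp_add, Real.exp_le_exp]
        have h4 : lam * d * ((missing Q (claim G (c T)) : ℕ) + 1) ≤ lam * d * missing Q G := by gcongr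
        linarith
      · have h2 : Y T = 0 := if_neg h
        have h3 : ((missing Q (claim G (c T)) : ℕ) : ℝ) ≤ missing Q G := by exact_mod_cast hc' T
        rw [h2, zero_mul, add_zero, hE, Real.exp_le_exp]
        gcongr
    refine (treeAvg_mono h1).trans ?_
    rw [treeAvg_add, treeAvg_const, treeAvg_mul_const]
    have h5 : p ≤ treeAvg Y := hp Q' (Finset.filter_subset _ _) (not_le.1 hG)
    have h6 : Real.exp (lam * (d * missing Q G - (k + 1 : ℕ))) = E * Real.exp (-lam) := by
      rw [hE, ← Real.exp_add]
      congr 1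
      push_cast
      ring
    rw [h6]
    have hE0 : 0 < E := Real.exp_pos _
    have h7 : 0 ≤ 1 - Real.exp (-(lam * d)) := by
      rw [sub_nonneg, Real.exp_le_one_iff]
      linarith [mul_nonneg hlam hd]
    have h8 := mul_le_mul_of_nonneg_right h5 h7
    have h9 : E * (1 - Real.exp (-lam)) ≤ E * (treeAvg Y * (1 - Real.exp (-(lam * d)))) :=
      mul_le_mul_of_nonneg_left (hpd.trans h8) hE0.le
    nlinarith

end strategies

/-! ### From values to strategies -/

instance SimpleGraph.measurableSingletonClass {V : Type*} [Finite V] :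
    MeasurableSingletonClass (SimpleGraph V) where
  measurableSet_singleton G := by
    have h : ({G} : Set (SimpleGraph V)) = SimpleGraph.edgeSet ⁻¹' {G.edgeSet} := by
      ext G'
      simp
    rw [h]
    exact SimpleGraph.measurable_edgeSet (measurableSet_singleton _)

section link
variable {V : Type*} [Finite V]

/-- An optimal choice when `k` rounds remain after the current one. -/
def bestClaim (A : Set (SimpleGraph V)) (k : ℕ) (G : SimpleGraph V) :
    ∀ T : SpanningTree V, Option T.1.edgeSet :=
  (exists_loss_succ_eq (A := A) k G).choose

lemma loss_succ_eq_bestClaim (A : Set (SimpleGraph V)) (k : ℕ) (G : SimpleGraph V) :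
    loss A (k + 1) G = treeAvg fun T => loss A k (claim G (bestClaim A k G T)) :=
  (exists_loss_succ_eq (A := A) k G).choose_spec

/-- The graph built by playing optimally with horizon `m`. -/
def optimalGraph (A : Set (SimpleGraph V)) (m : ℕ) :
    (t : ℕ) → (Fin t → SpanningTree V) → SimpleGraph V
  | 0, _ => ⊥
  | t + 1, h => claim (optimalGraph A m t fun i => h i.castSucc)
      (bestClaim A (m - (t + 1)) (optimalGraph A m t fun i => h i.castSucc) (h (Fin.last t)))

/-- The optimal strategy with horizon `m`. -/
def optimalStrategy (A : Set (SimpleGraph V)) (m : ℕ) : BuilderStrategy V :=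
  -- Beyond the horizon the truncated subtraction gives `0`. These rounds are not analysed;
  -- additional edges cannot destroy a copy.
  fun t h T => bestClaim A (m - (t + 1)) (optimalGraph A m t h) T

lemma builderGraph_optimalStrategy (A : Set (SimpleGraph V)) (m : ℕ) (T : ℕ → SpanningTree V)
    (t : ℕ) : builderGraph (optimalStrategy A m) T t = optimalGraph A m t fun i => T i := by
  induction t with
  | zero => rfl
  | succ t ih =>
    simp only [builderGraph, optimalGraph, ih, claim, claimedEdge, optimalStrategy, Fin.val_castSucc,
      Fin.val_last]

lemma optimalGraph_succ (A : Set (SimpleGraph V)) (m : ℕ) {t : ℕ} {h' : Fin (t + 1) → SpanningTree V}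
    {h : Fin t → SpanningTree V} {T : SpanningTree V} (h₁ : (fun i => h' i.castSucc) = h)
    (h₂ : h' (Fin.last t) = T) : optimalGraph A m (t + 1) h' =
      claim (optimalGraph A m t h) (bestClaim A (m - (t + 1)) (optimalGraph A m t h) T) := by
  subst h₁ h₂
  rfl

/-- Under optimal play the remaining loss is a martingale; at `t = m` the sum counts the histories
that end in failure. -/
lemma sum_loss_optimalGraph [Nonempty V] (A : Set (SimpleGraph V)) {m t : ℕ} (ht : t ≤ m) :
    ∑ h : Fin t → SpanningTree V, loss A (m - t) (optimalGraph A m t h) =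
      (Fintype.card (SpanningTree V) : ℝ) ^ t * loss A m ⊥ := by
  have := SpanningTree.nonempty V
  have hN : (Fintype.card (SpanningTree V) : ℝ) ≠ 0 := by exact_mod_cast Fintype.card_ne_zero
  induction t with
  | zero => simp [optimalGraph]
  | succ t ih =>
    rw [← Equiv.sum_comp (Fin.snocEquiv fun _ => SpanningTree V), Fintype.sum_prod_type_right,
      pow_succ', mul_assoc, ← ih (by omega), Finset.mul_sum]
    refine Finset.sum_congr rfl fun h _ => ?_
    rw [show m - t = m - (t + 1) + 1 by omega, loss_succ_eq_bestClaim, treeAvg,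
      mul_div_cancel₀ _ hN]
    refine Finset.sum_congr rfl fun T _ => ?_
    rw [optimalGraph_succ A m (h := h) (T := T) (by simp [Fin.snocEquiv]) (by simp [Fin.snocEquiv])]

instance [Nonempty V] : IsProbabilityMeasure (uniformTree V) :=
  have := SpanningTree.nonempty V
  isProbabilityMeasure_uniformOn Set.finite_univ Set.univ_nonempty

instance [Nonempty V] : IsProbabilityMeasure (offerLaw V) := by
  unfold offerLaw; infer_instance

lemma offerLaw_cylinder [Nonempty V] (m : ℕ) (s : Set (Fin m → SpanningTree V)) :
    offerLaw V {T | (fun i : Fin m => T i) ∈ s} =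
      ENNReal.ofReal (((Finset.univ.filter fun h => h ∈ s).card : ℝ) /
        (Fintype.card (SpanningTree V) : ℝ) ^ m) := by
  have := SpanningTree.nonempty V
  have hmeas : Measurable fun (T : ℕ → SpanningTree V) (i : Fin m) => T i := by fun_prop
  have h1 : (offerLaw V).map (fun T (i : Fin m) => T i) =
      uniformOn (Set.univ : Set (Fin m → SpanningTree V)) := by
    rw [offerLaw, Measure.map_infinitePi_infinitePi_of_inj (f := fun i : Fin m => (i : ℕ))
      Fin.val_injective, Measure.infinitePi_eq_pi, ← Set.pi_univ Set.univ, uniformOn_pi]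
    rfl
  have h2 : {T : ℕ → SpanningTree V | (fun i : Fin m => T i) ∈ s} =
      (fun T (i : Fin m) => T i) ⁻¹' s := rfl
  rw [h2, ← Measure.map_apply hmeas s.toFinite.measurableSet, h1, uniformOn_univ]
  have h3 : s = ((Finset.univ.filter fun h => h ∈ s : Finset _) : Set (Fin m → SpanningTree V)) := by
    ext; simp
  have hN : (0 : ℝ) < Fintype.card (SpanningTree V) := by exact_mod_cast Fintype.card_pos
  conv_lhs => rw [h3, Measure.count_apply_finset]
  rw [ENNReal.ofReal_div_of_pos (by positivity), ENNReal.ofReal_natCast, Fintype.card_fun,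
    Fintype.card_fin]
  push_cast
  rw [ENNReal.ofReal_pow (by positivity), ENNReal.ofReal_natCast]

/-- The optimal strategy achieves the value of the game. -/
lemma le_successProb_optimalStrategy [Nonempty V] (H : SimpleGraph V) (m : ℕ) :
    ENNReal.ofReal (1 - loss {G : SimpleGraph V | H.IsContained G} m ⊥) ≤
      successProb (optimalStrategy {G | H.IsContained G} m) H m := by
  set A : Set (SimpleGraph V) := {G | H.IsContained G} with hA
  have := SpanningTree.nonempty V
  have hN : (0 : ℝ) < Fintype.card (SpanningTree V) := by exact_mod_cast Fintype.card_pos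
  have h1 := sum_loss_optimalGraph A (le_refl m)
  have h2 : successProb (optimalStrategy A m) H m =
      offerLaw V {T | (fun i : Fin m => T i) ∈ {h | optimalGraph A m m h ∈ A}} := by
    simp only [successProb, builderGraph_optimalStrategy]
    rfl
  rw [h2, offerLaw_cylinder]
  apply ENNReal.ofReal_le_ofReal
  rw [le_div_iff₀ (by positivity), sub_mul, mul_comm (loss A m ⊥), ← h1]
  simp only [Nat.sub_self, loss, Set.mem_ofPred_eq]
  have h3 : (∑ h : Fin m → SpanningTree V, if optimalGraph A m m h ∈ A then (0 : ℝ) else 1) =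
      ∑ h : Fin m → SpanningTree V, (1 - if optimalGraph A m m h ∈ A then (1 : ℝ) else 0) :=
    Finset.sum_congr rfl fun h _ => by split_ifs <;> norm_num
  rw [h3, Finset.sum_sub_distrib, Finset.sum_boole]
  simp

end link

/-! ### More rounds do not hurt; passage to a random number of rounds. -/

section monotone
variable {V : Type*}

lemma builderGraph_mono (S : BuilderStrategy V) (T : ℕ → SpanningTree V) :
    Monotone (builderGraph S T) :=
  monotone_nat_of_le_succ fun _ => le_sup_left

lemma successProb_le_one [Finite V] [Nonempty V] (S : BuilderStrategy V) (H : SimpleGraph V) (m : ℕ) :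
    successProb S H m ≤ 1 := prob_le_one

lemma successProb_mono (S : BuilderStrategy V) (H : SimpleGraph V) :
    Monotone (successProb S H) := fun _ _ h =>
  measure_mono fun T hT => SimpleGraph.IsContained.trans hT
    (SimpleGraph.IsContained.of_le (builderGraph_mono S T h))

lemma poissonSuccessProb_le_one [Finite V] [Nonempty V] (S : BuilderStrategy V) (H : SimpleGraph V)
    (r : ℝ≥0) : poissonSuccessProb S H r ≤ 1 := prob_le_one

/-- A strategy that succeeds by round `m` also succeeds if the independent number of rounds is at
least `m`, so knowing that number is unnecessary. -/
lemma le_poissonSuccessProb [Finite V] [Nonempty V] (S : BuilderStrategy V) (H : SimpleGraph V) (m : ℕ)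
    (r : ℝ≥0) : successProb S H m * poissonMeasure r (Set.Ici m) ≤ poissonSuccessProb S H r := by
  rw [successProb, poissonSuccessProb, ← Measure.prod_prod]
  refine measure_mono fun p hp => SimpleGraph.IsContained.trans hp.1
    (SimpleGraph.IsContained.of_le (builderGraph_mono S p.1 hp.2))

end monotone

/-- Chernoff's bound for the lower tail of a Poisson distribution. -/
lemma poissonMeasure_Iio_le (r : ℝ≥0) (m : ℕ) {t : ℝ} (ht : 0 ≤ t) :
    poissonMeasure r (Set.Iio m) ≤ ENNReal.ofReal (Real.exp (t * m - r * (1 - Real.exp (-t)))) := by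
  have h1 : (Set.Iio m : Set ℕ) = ((Finset.range m : Finset ℕ) : Set ℕ) := by ext; simp
  rw [h1, ← MeasureTheory.sum_measure_singleton]
  simp only [poissonMeasure_singleton]
  rw [← ENNReal.ofReal_sum_of_nonneg (fun _ _ => by positivity)]
  apply ENNReal.ofReal_le_ofReal
  have h2 : ∀ k ∈ Finset.range m, Real.exp (-r) * (r : ℝ) ^ k / k.factorial ≤
      Real.exp (-r + t * m) * ((r * Real.exp (-t)) ^ k / k.factorial) := by
    intro k hk
    have h3 : (1 : ℝ) ≤ Real.exp (t * m) * Real.exp (-t) ^ k := by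
      rw [← Real.exp_nat_mul, ← Real.exp_add]
      apply Real.one_le_exp
      have : (k : ℝ) ≤ m := by exact_mod_cast (Finset.mem_range.1 hk).le
      nlinarith
    calc Real.exp (-r) * (r : ℝ) ^ k / k.factorial
        = Real.exp (-r) * (r : ℝ) ^ k / k.factorial * 1 := by ring
      _ ≤ Real.exp (-r) * (r : ℝ) ^ k / k.factorial * (Real.exp (t * m) * Real.exp (-t) ^ k) := by
        gcongr
      _ = _ := by rw [Real.exp_add, mul_pow]; ring
  refine (Finset.sum_le_sum h2).trans ?_
  rw [← Finset.mul_sum]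
  refine (mul_le_mul_of_nonneg_left (Real.sum_le_exp_of_nonneg (by positivity) m)
    (Real.exp_pos _).le).trans ?_
  rw [← Real.exp_add, Real.exp_le_exp]
  apply le_of_eq
  ring

/-! ### Almost embedded copies and swaps -/

/-- All edges of `H` avoiding `B` are present in `G`. -/
def NearCopy {V : Type*} (H : SimpleGraph V) (B : Finset V) (G : SimpleGraph V) : Prop :=
  ∀ u v, H.Adj u v → u ∉ B → v ∉ B → G.Adj u v

lemma NearCopy.mono {V : Type*} {H : SimpleGraph V} {B : Finset V} {G G' : SimpleGraph V}
    (h : NearCopy H B G) (hG : G ≤ G') : NearCopy H B G' :=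
  fun u v huv hu hv => hG (h u v huv hu hv)

/-- The graphs containing a copy of `H` up to edges meeting at most `r` vertices. -/
def almostContaining {V : Type*} (H : SimpleGraph V) (r : ℕ) : Set (SimpleGraph V) :=
  {G | ∃ (φ : Equiv.Perm V) (B : Finset V), B.card ≤ r ∧
    ∀ u v, H.Adj u v → u ∉ B → v ∉ B → G.Adj (φ u) (φ v)}

section
variable {V : Type*}

lemma almostContaining_mono (H : SimpleGraph V) {r r' : ℕ} (h : r ≤ r') :
    almostContaining H r ⊆ almostContaining H r' :=
  fun _ ⟨φ, B, hB, hG⟩ => ⟨φ, B, hB.trans h, hG⟩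

lemma isContained_of_mem_almostContaining_zero {H G : SimpleGraph V}
    (h : G ∈ almostContaining H 0) : H.IsContained G := by
  obtain ⟨φ, B, hB, hG⟩ := h
  have hB' : B = ∅ := Finset.card_eq_zero.1 (Nat.le_zero.1 hB)
  subst hB'
  exact ⟨⟨⟨φ, fun {u v} huv => hG u v huv (Finset.notMem_empty _) (Finset.notMem_empty _)⟩,
    φ.injective⟩⟩

lemma almostContaining_map_subset (H : SimpleGraph V) (σ : Equiv.Perm V) (r : ℕ) :
    almostContaining (H.map σ) r ⊆ almostContaining H r := by
  rintro G ⟨φ, B, hB, hG⟩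
  refine ⟨σ.trans φ, B.map σ.symm.toEmbedding, by simpa using hB, fun u v huv hu hv => ?_⟩
  refine hG _ _ ((SimpleGraph.Iso.map σ H).map_adj_iff.2 huv) (fun h => hu ?_) (fun h => hv ?_)
  · exact Finset.mem_map.2 ⟨σ u, h, by simp⟩
  · exact Finset.mem_map.2 ⟨σ v, h, by simp⟩

lemma exists_nearCopy_of_mem_almostContaining {H G : SimpleGraph V} {r : ℕ}
    (h : G ∈ almostContaining H r) :
    ∃ (σ : Equiv.Perm V) (B : Finset V), B.card ≤ r ∧ NearCopy (H.map σ) B G := by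
  obtain ⟨φ, B, hB, hG⟩ := h
  refine ⟨φ, B.map φ.toEmbedding, by simpa using hB, fun u v huv hu hv => ?_⟩
  have h1 : H.Adj (φ.symm u) (φ.symm v) := by
    rw [← (SimpleGraph.Iso.map φ H).map_adj_iff]
    simpa [SimpleGraph.Iso.map] using huv
  have := hG _ _ h1 (fun h' => hu (Finset.mem_map.2 ⟨_, h', by simp⟩))
    (fun h' => hv (Finset.mem_map.2 ⟨_, h', by simp⟩))
  simpa using this

/-- Exchanging the roles of `u` and `x u` for all `u ∈ U`. -/
lemma NearCopy.swap {H G : SimpleGraph V} {B U : Finset V} (hG : NearCopy H B G) (hU : U ⊆ B)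
    (x : V → V) (hinj : ∀ u ∈ U, ∀ v ∈ U, x u = x v → u = v) (hxB : ∀ u ∈ U, x u ∉ B)
    (hxadj : ∀ u ∈ U, ∀ b ∈ B, ¬ H.Adj (x u) b) (hxx : ∀ u ∈ U, ∀ v ∈ U, ¬ H.Adj (x u) (x v))
    (h1 : ∀ u ∈ U, ∀ w, H.Adj u w → w ∉ B → G.Adj (x u) w)
    (h2 : ∀ u ∈ U, ∀ y, H.Adj (x u) y → G.Adj u y)
    (h3 : ∀ u ∈ U, ∀ v ∈ U, H.Adj u v → G.Adj (x u) (x v)) :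
    G ∈ almostContaining H (B \ U).card := by
  -- The involution exchanging `u` and `x u` for `u ∈ U`; the exchanged copy is the image of `H`
  -- under it.
  let f : V → V := fun v => if v ∈ U then x v else if h : ∃ u ∈ U, x u = v then h.choose else v
  have f1 : ∀ u ∈ U, f u = x u := fun u hu => if_pos hu
  have hxU : ∀ u ∈ U, x u ∉ U := fun u hu h => hxB u hu (hU h)
  have f2 : ∀ u ∈ U, f (x u) = u := by
    intro u hu
    have h : ∃ v ∈ U, x v = x u := ⟨u, hu, rfl⟩
    simp only [f, if_neg (hxU u hu), dif_pos h]
    exact hinj _ h.choose_spec.1 _ hu h.choose_spec.2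
  have f3 : ∀ v, v ∉ U → (¬ ∃ u ∈ U, x u = v) → f v = v := by
    intro v hv h
    simp only [f, if_neg hv, dif_neg h]
  have hf : Function.Involutive f := by
    intro v
    by_cases hv : v ∈ U
    · rw [f1 v hv, f2 v hv]
    · by_cases h : ∃ u ∈ U, x u = v
      · obtain ⟨u, hu, rfl⟩ := h
        rw [f2 u hu, f1 u hu]
      · rw [f3 v hv h, f3 v hv h]
  refine ⟨hf.toPerm, B \ U, le_rfl, fun a b hab ha hb => ?_⟩
  change G.Adj (f a) (f b)
  have hcase : ∀ v, v ∉ B \ U → v ∈ U ∨ (∃ u ∈ U, x u = v) ∨ (v ∉ B ∧ f v = v) := by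
    intro v hv
    by_cases h : v ∈ U
    · exact Or.inl h
    · by_cases h' : ∃ u ∈ U, x u = v
      · exact Or.inr (Or.inl h')
      · exact Or.inr (Or.inr ⟨fun hB => hv (Finset.mem_sdiff.2 ⟨hB, h⟩), f3 v h h'⟩)
  -- Each endpoint is in `U`, is a chosen candidate, or is fixed and outside `B`. Separation rules
  -- out edges between candidates and from candidates to `U`; the other cases are `h1`, `h2`, `h3`
  -- and `hG`.
  rcases hcase a ha with ha' | ⟨u, hu, rfl⟩ | ⟨haB, hfa⟩ <;>
    rcases hcase b hb with hb' | ⟨v, hv, rfl⟩ | ⟨hbB, hfb⟩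
  · rw [f1 a ha', f1 b hb']
    exact h3 a ha' b hb' hab
  · exact (hxadj v hv a (hU ha') hab.symm).elim
  · rw [f1 a ha', hfb]
    exact h1 a ha' b hab hbB
  · exact (hxadj u hu b (hU hb') hab).elim
  · exact (hxx u hu v hv hab).elim
  · rw [f2 u hu, hfb]
    exact h2 u hu b hab
  · rw [f1 b hb', hfa]
    exact (h1 b hb' a hab.symm haB).symm
  · rw [f2 v hv, hfa]
    exact (h2 v hv a hab.symm).symm
  · rw [hfa, hfb]
    exact hG a b hab haB hbB

end

/-! ### Greedy choice of far-apart vertices. -/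

section separated
variable {V : Type*} [Fintype V]

/-- Vertices which are far from each other and from `B`. -/
structure Separated {ι : Type*} (H : SimpleGraph V) (B : Finset V) (x : ι → V) : Prop where
  injective : Function.Injective x
  notMem : ∀ i, x i ∉ B
  not_adj_of_mem : ∀ i, ∀ b ∈ B, ¬ H.Adj (x i) b
  not_adj : ∀ i j, ¬ H.Adj (x i) (x j)
  eq_of_adj : ∀ i j y, H.Adj (x i) y → H.Adj (x j) y → i = j

/-- Greedy choice: a selected vertex blocks its ball of radius two, of size at most `Δ ^ 2 + Δ + 1`,
and a vertex of `B` blocks its closed neighbourhood. -/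
lemma exists_finset_separated {H : SimpleGraph V} {Δ : ℕ}
    (hΔ : ∀ v, (H.neighborFinset v).card ≤ Δ) (B : Finset V) (N : ℕ)
    (hN : N * (Δ ^ 2 + Δ + 1) + B.card * (Δ + 1) ≤ Fintype.card V) :
    ∃ X : Finset V, X.card = N ∧ Separated H B (fun v : X => (v : V)) := by
  induction N with
  | zero =>
    exact ⟨∅, rfl, Subtype.val_injective, by simp, by simp, by simp, by simp⟩
  | succ N ih =>
    obtain ⟨X, hX, hsep⟩ := ih (le_trans (by gcongr; omega) hN)
    let N1 : Finset V → Finset V := fun S => S.biUnion fun v => H.neighborFinset v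
    have hN1 : ∀ S : Finset V, (N1 S).card ≤ S.card * Δ := fun S =>
      Finset.card_biUnion_le_card_mul _ _ _ fun v _ => hΔ v
    have hcard : (B ∪ N1 B ∪ (X ∪ N1 X ∪ N1 (N1 X))).card < Fintype.card V := by
      have e1 := Finset.card_union_le (B ∪ N1 B) (X ∪ N1 X ∪ N1 (N1 X))
      have e2 := Finset.card_union_le B (N1 B)
      have e3 := Finset.card_union_le (X ∪ N1 X) (N1 (N1 X))
      have e4 := Finset.card_union_le X (N1 X)
      have e5 := hN1 B
      have e6 := hN1 X
      have e7 := hN1 (N1 X)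
      have e8 : (N1 X).card * Δ ≤ X.card * Δ * Δ := Nat.mul_le_mul_right _ e6
      rw [hX] at e4 e6 e8
      calc _ ≤ B.card + B.card * Δ + (N + N * Δ + N * Δ * Δ) := by omega
        _ < (N + 1) * (Δ ^ 2 + Δ + 1) + B.card * (Δ + 1) := by
          ring_nf
          omega
        _ ≤ _ := hN
    obtain ⟨v, hv⟩ : ∃ v, v ∉ B ∪ N1 B ∪ (X ∪ N1 X ∪ N1 (N1 X)) := by
      by_contra h
      push Not at h
      rw [Finset.eq_univ_iff_forall.2 h] at hcard
      exact lt_irrefl _ hcard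
    simp only [Finset.mem_union, not_or, N1, Finset.mem_biUnion, SimpleGraph.mem_neighborFinset,
      not_exists, not_and] at hv
    obtain ⟨⟨hvB, hvB'⟩, ⟨hvX, hvX'⟩, hvX''⟩ := hv
    refine ⟨insert v X, by rw [Finset.card_insert_of_notMem hvX, hX], Subtype.val_injective,
      ?_, ?_, ?_, ?_⟩
    · rintro ⟨w, hw⟩
      rcases Finset.mem_insert.1 hw with rfl | hw
      · exact hvB
      · exact hsep.notMem ⟨w, hw⟩
    · rintro ⟨w, hw⟩ b hb
      rcases Finset.mem_insert.1 hw with rfl | hw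
      · exact fun h => hvB' b hb h.symm
      · exact hsep.not_adj_of_mem ⟨w, hw⟩ b hb
    · rintro ⟨w, hw⟩ ⟨w', hw'⟩
      rcases Finset.mem_insert.1 hw with h1 | h1 <;> rcases Finset.mem_insert.1 hw' with h2 | h2
      · subst h1 h2
        exact H.irrefl
      · subst h1
        exact fun h => hvX' w' h2 h.symm
      · subst h2
        exact fun h => hvX' w h1 h
      · exact hsep.not_adj ⟨w, h1⟩ ⟨w', h2⟩
    · rintro ⟨w, hw⟩ ⟨w', hw'⟩ y h h'
      rcases Finset.mem_insert.1 hw with h1 | h1 <;> rcases Finset.mem_insert.1 hw' with h2 | h2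
      · exact Subtype.ext (h1.trans h2.symm)
      · subst h1
        exact (hvX'' y ⟨w', h2, h'⟩ h.symm).elim
      · subst h2
        exact (hvX'' y ⟨w, h1, h⟩ h'.symm).elim
      · have := hsep.eq_of_adj ⟨w, h1⟩ ⟨w', h2⟩ y h h'
        simpa using this

lemma exists_separated {H : SimpleGraph V} {Δ : ℕ} (hΔ : ∀ v, (H.neighborFinset v).card ≤ Δ)
    (B : Finset V) (ι : Type*) [Fintype ι]
    (hN : Fintype.card ι * (Δ ^ 2 + Δ + 1) + B.card * (Δ + 1) ≤ Fintype.card V) :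
    ∃ x : ι → V, Separated H B x := by
  obtain ⟨X, hX, h⟩ := exists_finset_separated hΔ B _ hN
  have e : ι ≃ X := Fintype.equivOfCardEq (by simp [hX])
  exact ⟨fun i => e i, Subtype.val_injective.comp e.injective, fun i => h.notMem _,
    fun i => h.not_adj_of_mem _, fun i j => h.not_adj _ _,
    fun i j y h1 h2 => e.injective (h.eq_of_adj _ _ y h1 h2)⟩

end separated

/-- If a vertex set `O k j` has a missing pair for all `j`, one of the transversals of the `O k j`
is missing completely. -/
lemma loss_exists_subset_le {V : Type*} [Fintype V] [Nonempty V] {R : Finset (Sym2 V)}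
    (hR : ∀ e ∈ R, ¬ e.IsDiag) (hRn : 16 * R.card ≤ Fintype.card V) (hn : 5 ≤ Fintype.card V)
    {κ : Type*} [Fintype κ] (J : κ → Type*) [∀ k, Fintype (J k)] {q M : ℕ}
    (hJ : ∀ k, Fintype.card (J k) = q) (O : ∀ k, J k → Finset (Sym2 V)) (hOR : ∀ k j, O k j ⊆ R)
    (hO : ∀ k j j', j ≠ j' → Disjoint (O k j) (O k j')) (hM : ∀ k j, (O k j).card ≤ M)
    (t : ℕ) (G : SimpleGraph V) :
    loss {G' | G ≤ G' ∧ ∀ k, ∃ j, ∀ e ∈ O k j, e ∈ G'.edgeSet} t G ≤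
      Fintype.card κ * (M : ℝ) ^ q * Real.exp (-(q * (t / Fintype.card V : ℝ))) := by
  -- The transversals, at most `M ^ q` for each `k`. By disjointness each consists of `q` different
  -- pairs. If all are hit, then for each `k` some `O k j` is complete, since otherwise missing
  -- pairs would form an unhit transversal.
  let ι := Σ k, ∀ j, {e // e ∈ O k j}
  let Q : ι → Finset (Sym2 V) := fun i => Finset.univ.image fun j => (i.2 j : Sym2 V)
  have hQ : ∀ i, (Q i).card = q := by
    rintro ⟨k, f⟩
    simp only [Q]
    rw [Finset.card_image_of_injective, Finset.card_univ, hJ]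
    intro j j' h
    by_contra hne
    exact Finset.disjoint_left.1 (hO k j j' hne) (f j).2 (by
      have h' : (f j : Sym2 V) = f j' := h
      rw [h']
      exact (f j').2)
  have h := loss_hit_all_le' hR hRn hn Q (q := q) (fun i e he => by
    obtain ⟨j, _, rfl⟩ := Finset.mem_image.1 he
    exact hOR _ _ (i.2 j).2) (fun i => (hQ i).ge) t G
  refine le_trans (loss_mono_set ?_ t G) (h.trans ?_)
  · rintro G' ⟨hGG', hG'⟩
    refine ⟨hGG', fun k => ?_⟩
    by_contra hcon
    push Not at hcon
    choose f hf hf' using hcon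
    obtain ⟨e, he, he'⟩ := hG' ⟨k, fun j => ⟨f j, hf j⟩⟩
    obtain ⟨j, _, rfl⟩ := Finset.mem_image.1 he
    exact hf' j he'
  · gcongr
    rw [Fintype.card_sigma]
    push_cast
    refine (Finset.sum_le_card_nsmul _ _ ((M : ℝ) ^ q) fun k _ => ?_).trans ?_
    · rw [Fintype.card_pi]
      push_cast
      refine (Finset.prod_le_prod (g := fun _ => (M : ℝ)) (fun _ _ => Nat.cast_nonneg _)
        fun j _ => ?_).trans_eq ?_
      · simpa using hM k j
      · rw [Finset.prod_const, Finset.card_univ, hJ]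
    · simp

/-! ### Repairing all bad vertices at once -/

section simultaneous
variable {V : Type*} [Fintype V]

/-- The pairs needed for exchanging `u` and `z`, disregarding the neighbours of `u` in `B`. -/
def swapPairs (H : SimpleGraph V) (B : Finset V) (u z : V) : Finset (Sym2 V) :=
  ((H.neighborFinset u \ B).image fun w => s(z, w)) ∪ (H.neighborFinset z).image fun y => s(u, y)

lemma card_swapPairs_le {H : SimpleGraph V} {Δ : ℕ} (hΔ : ∀ v, (H.neighborFinset v).card ≤ Δ)
    (B : Finset V) (u z : V) : (swapPairs H B u z).card ≤ 2 * Δ := by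
  refine (Finset.card_union_le _ _).trans ?_
  have h1 := (Finset.card_image_le (s := H.neighborFinset u \ B) (f := fun w => s(z, w))).trans
    ((Finset.card_le_card Finset.sdiff_subset).trans (hΔ u))
  have h2 := (Finset.card_image_le (s := H.neighborFinset z) (f := fun y => s(u, y))).trans (hΔ z)
  omega

variable {H : SimpleGraph V} {B : Finset V} {s : ℕ} {x : V → Fin s → V}

/-- The candidate `x u i` for an exchange with `u`, for all `u ∈ B`. -/
structure Candidates (H : SimpleGraph V) (B : Finset V) (x : V → Fin s → V) : Prop where
  eq : ∀ u ∈ B, ∀ v ∈ B, ∀ i j, x u i = x v j → u = v ∧ i = j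
  notMem : ∀ u ∈ B, ∀ i, x u i ∉ B
  not_adj_of_mem : ∀ u ∈ B, ∀ i, ∀ b ∈ B, ¬ H.Adj (x u i) b
  not_adj : ∀ u ∈ B, ∀ v ∈ B, ∀ i j, ¬ H.Adj (x u i) (x v j)
  eq_of_adj : ∀ u ∈ B, ∀ i j y, H.Adj (x u i) y → H.Adj (x u j) y → i = j

/-- Only the vertices of `A` receive candidates, but these are kept away from the larger set `B`.
Outside `A` the value of `x` is a dummy. -/
lemma exists_candidates {Δ : ℕ} (hΔ : ∀ v, (H.neighborFinset v).card ≤ Δ) (A B : Finset V) (s : ℕ)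
    (hN : A.card * s * (Δ ^ 2 + Δ + 1) + B.card * (Δ + 1) ≤ Fintype.card V) (hA : A ⊆ B) :
    ∃ x : V → Fin s → V, Candidates H A x ∧ (∀ u ∈ A, ∀ i, x u i ∉ B) ∧
      (∀ u ∈ A, ∀ i, ∀ b ∈ B, ¬ H.Adj (x u i) b) := by
  obtain ⟨x, hx⟩ := exists_separated hΔ B (A × Fin s) (by simpa using hN)
  have key : ∀ u (hu : u ∈ A) i, (if h : u ∈ A then x (⟨u, h⟩, i) else u) = x (⟨u, hu⟩, i) :=
    fun u hu i => dif_pos hu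
  have h1 : ∀ u ∈ A, ∀ i, (if h : u ∈ A then x (⟨u, h⟩, i) else u) ∉ B := by
    intro u hu i
    rw [key u hu]
    exact hx.notMem _
  have h2 : ∀ u ∈ A, ∀ i, ∀ b ∈ B, ¬ H.Adj (if h : u ∈ A then x (⟨u, h⟩, i) else u) b := by
    intro u hu i b hb
    rw [key u hu]
    exact hx.not_adj_of_mem _ b hb
  refine ⟨fun u i => if h : u ∈ A then x (⟨u, h⟩, i) else u, ⟨?_, fun u hu i h => h1 u hu i (hA h),
    fun u hu i b hb => h2 u hu i b (hA hb), ?_, ?_⟩, h1, h2⟩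
  · intro u hu v hv i j h
    simp only [key u hu, key v hv] at h
    have := hx.injective h
    simpa using this
  · intro u hu v hv i j
    simp only [key u hu, key v hv]
    exact hx.not_adj _ _
  · intro u hu i j y
    simp only [key u hu]
    intro h h'
    have := hx.eq_of_adj _ _ y h h'
    simpa using this

/-- The pairs needed for exchanging `u` and `x u i`, where the vertices of `B \ A` may be exchanged
with any of their candidates. -/
def jointSwapPairs (H : SimpleGraph V) (B : Finset V) (x : V → Fin s → V) (A : Finset V) (u : V)
    (i : Fin s) : Finset (Sym2 V) :=
  swapPairs H B u (x u i) ∪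
    ((H.neighborFinset u ∩ (B \ A)) ×ˢ (Finset.univ : Finset (Fin s))).image
      fun p => s(x u i, x p.1 p.2)

lemma card_jointSwapPairs_le {Δ : ℕ} (hΔ : ∀ v, (H.neighborFinset v).card ≤ Δ) (A : Finset V)
    (u : V) (i : Fin s) : (jointSwapPairs H B x A u i).card ≤ Δ * (s + 2) := by
  refine (Finset.card_union_le _ _).trans ?_
  have h1 := card_swapPairs_le hΔ B u (x u i)
  have h2 := Finset.card_image_le (s := (H.neighborFinset u ∩ (B \ A)) ×ˢ
    (Finset.univ : Finset (Fin s))) (f := fun p => s(x u i, x p.1 p.2))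
  rw [Finset.card_product, Finset.card_univ, Fintype.card_fin] at h2
  have h3 : (H.neighborFinset u ∩ (B \ A)).card * s ≤ Δ * s :=
    Nat.mul_le_mul_right _ ((Finset.card_le_card Finset.inter_subset_left).trans (hΔ u))
  calc _ ≤ 2 * Δ + Δ * s := add_le_add h1 (h2.trans h3)
    _ = _ := by ring

/-- The case `A = ∅` contains all others, so a single small set of target pairs serves every `A` in
the union bound. -/
lemma jointSwapPairs_subset (A : Finset V) (u : V) (i : Fin s) :
    jointSwapPairs H B x A u i ⊆ jointSwapPairs H B x ∅ u i := by
  refine Finset.union_subset_union_right (Finset.image_subset_image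
    (Finset.product_subset_product_left (Finset.inter_subset_inter_left ?_)))
  simp

/-- A pair determines its exchange: either one end is the candidate and the other is neither in `B`
nor a candidate of a vertex in `A`, or one end is `u` and the other a neighbour of the candidate. -/
lemma mem_jointSwapPairs (hx : Candidates H B x) {A : Finset V} (hA : A ⊆ B) {u : V} (hu : u ∈ B)
    {i : Fin s} {e : Sym2 V} (he : e ∈ jointSwapPairs H B x A u i) :
    (∃ z, e = s(x u i, z) ∧ z ∉ B ∧ z ≠ x u i ∧ ∀ u' ∈ A, ∀ i', z ≠ x u' i') ∨
      ∃ y, e = s(u, y) ∧ H.Adj (x u i) y := by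
  simp only [jointSwapPairs, swapPairs, Finset.mem_union, Finset.mem_image, Finset.mem_sdiff,
    SimpleGraph.mem_neighborFinset, Finset.mem_product, Finset.mem_inter, Finset.mem_univ,
    and_true] at he
  rcases he with (⟨w, hw, rfl⟩ | ⟨y, hy, rfl⟩) | ⟨⟨v, j⟩, hv, rfl⟩
  · refine Or.inl ⟨w, rfl, hw.2, ?_, ?_⟩
    · rintro rfl
      exact hx.not_adj_of_mem u hu i u hu hw.1.symm
    · rintro u' hu' i' rfl
      exact hx.not_adj_of_mem u' (hA hu') i' u hu hw.1.symm
  · exact Or.inr ⟨y, rfl, hy⟩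
  · refine Or.inl ⟨_, rfl, hx.notMem v hv.2.1 j, ?_, ?_⟩
    · intro h
      exact hv.1.ne (hx.eq v hv.2.1 u hu j i h).1.symm
    · intro u' hu' i' h
      exact hv.2.2 ((hx.eq v hv.2.1 u' (hA hu') j i' h).1 ▸ hu')

/-- Here it matters that pairs between candidates are required only for neighbours in `B \ A`: for
adjacent `u, v ∈ A`, the pair of `x u i` and `x v j` would belong to both exchanges. -/
lemma disjoint_jointSwapPairs (hx : Candidates H B x) {A : Finset V} (hA : A ⊆ B) {u u' : V}
    (hu : u ∈ A) (hu' : u' ∈ A) {i i' : Fin s} (h : (u, i) ≠ (u', i')) :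
    Disjoint (jointSwapPairs H B x A u i) (jointSwapPairs H B x A u' i') := by
  rw [Finset.disjoint_left]
  intro e he he'
  have hne : x u i ≠ x u' i' := fun h' => by
    obtain ⟨rfl, rfl⟩ := hx.eq u (hA hu) u' (hA hu') i i' h'
    exact h rfl
  rcases mem_jointSwapPairs hx hA (hA hu) he with ⟨z, rfl, hzB, -, hz⟩ | ⟨y, rfl, hy⟩ <;>
    rcases mem_jointSwapPairs hx hA (hA hu') he' with ⟨z', h1, hzB', -, hz'⟩ | ⟨y', h1, hy'⟩ <;>
    rcases Sym2.eq_iff.1 h1 with ⟨e1, e2⟩ | ⟨e1, e2⟩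
  · exact hne e1
  · exact hz' u hu i e1.symm
  · exact hx.notMem u (hA hu) i (e1 ▸ hA hu')
  · exact hzB (e2 ▸ hA hu')
  · exact hx.notMem u' (hA hu') i' (e1 ▸ hA hu)
  · exact hzB' (e1 ▸ hA hu)
  · subst e1 e2
    have := hx.eq_of_adj u (hA hu) i i' y hy hy'
    exact h (by rw [this])
  · exact hx.not_adj_of_mem u' (hA hu') i' u (hA hu) (e1 ▸ hy')

lemma not_isDiag_of_mem_jointSwapPairs (hx : Candidates H B x) {u : V} (hu : u ∈ B) {i : Fin s}
    {e : Sym2 V} (he : e ∈ jointSwapPairs H B x ∅ u i) : ¬ e.IsDiag := by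
  rcases mem_jointSwapPairs hx (Finset.empty_subset B) hu he with ⟨z, rfl, -, hz, -⟩ | ⟨y, rfl, hy⟩
  · rw [Sym2.mk_isDiag_iff]
    exact hz.symm
  · rw [Sym2.mk_isDiag_iff]
    rintro rfl
    exact hx.not_adj_of_mem u hu i u hu hy

/-- A maximal set of compatible exchanges. -/
lemma mem_almostContaining_of_forall_exists (hx : Candidates H B x) {G : SimpleGraph V}
    (hG : NearCopy H B G) {a : ℕ} (ha : 1 ≤ a)
    (hA : ∀ A ∈ B.powersetCard a, ∃ u ∈ A, ∃ i, ∀ e ∈ jointSwapPairs H B x A u i, e ∈ G.edgeSet) :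
    G ∈ almostContaining H (a - 1) := by
  let valid : Finset V × (V → Fin s) → Prop := fun p => p.1 ⊆ B ∧
    (∀ u ∈ p.1, ∀ e ∈ swapPairs H B u (x u (p.2 u)), e ∈ G.edgeSet) ∧
    ∀ u ∈ p.1, ∀ v ∈ p.1, H.Adj u v → G.Adj (x u (p.2 u)) (x v (p.2 v))
  by_cases hBa : B.card < a
  · exact ⟨Equiv.refl V, B, by omega, hG⟩
  have hs : Nonempty (Fin s) := by
    obtain ⟨A, hAB⟩ := Finset.powersetCard_nonempty.2 (not_lt.1 hBa)
    obtain ⟨_, _, i, _⟩ := hA A hAB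
    exact ⟨i⟩
  -- Take a largest compatible set `U` of exchanges. If `a` vertices were left over, call them `A`;
  -- then `U` lies in `B \ A`, and the exchange supplied by `hA` is compatible with whatever
  -- candidates were chosen in `U`, so `U` could be enlarged.
  obtain ⟨⟨U, f⟩, hval, hmax⟩ := Set.exists_max_image {p | valid p} (fun p => p.1.card)
    (Set.toFinite _) ⟨(∅, fun _ => Classical.arbitrary _), by simp [valid]⟩
  obtain ⟨hUB, hU1, hU2⟩ := hval
  have hlt : (B \ U).card < a := by
    by_contra hcon
    obtain ⟨A, hAU, hAc⟩ := Finset.exists_subset_card_eq (not_lt.1 hcon)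
    obtain ⟨u, hu, i, hi⟩ := hA A (Finset.mem_powersetCard.2
      ⟨hAU.trans Finset.sdiff_subset, hAc⟩)
    have huB := Finset.mem_sdiff.1 (hAU hu)
    have hnew : valid (insert u U, Function.update f u i) := by
      have hf : ∀ v ∈ U, Function.update f u i v = f v := fun v hv =>
        Function.update_of_ne (fun h : v = u => huB.2 (h ▸ hv)) _ _
      have hfu : Function.update f u i u = i := Function.update_self _ _ _
      have hadj : ∀ v ∈ U, H.Adj u v → G.Adj (x u i) (x v (f v)) := by
        intro v hv huv
        refine hi s(x u i, x v (f v)) (Finset.mem_union_right _ (Finset.mem_image.2 ⟨(v, f v), ?_, rfl⟩))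
        simp only [Finset.mem_product, Finset.mem_inter, SimpleGraph.mem_neighborFinset,
          Finset.mem_sdiff, Finset.mem_univ, and_true]
        exact ⟨huv, hUB hv, fun h => (Finset.mem_sdiff.1 (hAU h)).2 hv⟩
      refine ⟨Finset.insert_subset huB.1 hUB, ?_, ?_⟩
      · intro v hv
        rcases Finset.mem_insert.1 hv with rfl | hv
        · simp only [hfu]
          exact fun e he => hi e (Finset.mem_union_left _ he)
        · simp only [hf v hv]
          exact hU1 v hv
      · intro v hv w hw hvw
        rcases Finset.mem_insert.1 hv with h1 | h1 <;> rcases Finset.mem_insert.1 hw with h2 | h2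
        · subst h1 h2
          exact (H.irrefl hvw).elim
        · subst h1
          simp only [hfu, hf w h2]
          exact hadj w h2 hvw
        · subst h2
          simp only [hfu, hf v h1]
          exact (hadj v h1 hvw.symm).symm
        · simp only [hf v h1, hf w h2]
          exact hU2 v h1 w h2 hvw
    have := hmax _ hnew
    simp only [Finset.card_insert_of_notMem huB.2] at this
    omega
  refine almostContaining_mono H (by omega : (B \ U).card ≤ a - 1) (hG.swap hUB (fun u => x u (f u))
    (fun u hu v hv h => (hx.eq u (hUB hu) v (hUB hv) _ _ h).1) (fun u hu => hx.notMem u (hUB hu) _)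
    (fun u hu => hx.not_adj_of_mem u (hUB hu) _)
    (fun u hu v hv => hx.not_adj u (hUB hu) v (hUB hv) _ _) ?_ ?_ hU2)
  · intro u hu w huw hw
    refine hU1 u hu s(x u (f u), w) (Finset.mem_union_left _ (Finset.mem_image.2 ⟨w, ?_, rfl⟩))
    simpa using ⟨huw, hw⟩
  · intro u hu y hy
    refine hU1 u hu s(u, y) (Finset.mem_union_right _ (Finset.mem_image.2 ⟨y, ?_, rfl⟩))
    simpa using hy

/-- A union bound over the `a`-subsets `A` of `B` and, for each, over the transversals of its `a *
s` disjoint sets of at most `Δ * (s + 2)` pairs. The bound is useful once `t / n` exceeds `log (Δ *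
(s + 2))` by enough to absorb the choice of `A`. -/
lemma loss_simultaneous_le [Nonempty V] {Δ a : ℕ} (hΔ : ∀ v, (H.neighborFinset v).card ≤ Δ)
    {G : SimpleGraph V} (hG : NearCopy H B G) (ha : 1 ≤ a) (hn : 5 ≤ Fintype.card V)
    (hsep : B.card * s * (Δ ^ 2 + Δ + 1) + B.card * (Δ + 1) ≤ Fintype.card V)
    (htar : 16 * (B.card * (s * (Δ * (s + 2)))) ≤ Fintype.card V) (t : ℕ) :
    loss (almostContaining H (a - 1)) t G ≤ (B.card.choose a : ℝ) * (Δ * (s + 2) : ℕ) ^ (a * s) *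
      Real.exp (-(a * s * (t / Fintype.card V : ℝ))) := by
  obtain ⟨x, hx, -, -⟩ := exists_candidates hΔ B B s hsep subset_rfl
  let R : Finset (Sym2 V) := B.biUnion fun u => Finset.univ.biUnion fun i => jointSwapPairs H B x ∅ u i
  have hRc : R.card ≤ B.card * (s * (Δ * (s + 2))) := by
    refine Finset.card_biUnion_le_card_mul _ _ _ fun u _ => ?_
    refine (Finset.card_biUnion_le_card_mul _ _ _ fun i _ => card_jointSwapPairs_le hΔ ∅ u i).trans ?_
    simp
  have hmemR : ∀ u ∈ B, ∀ i, jointSwapPairs H B x ∅ u i ⊆ R := fun u hu i =>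
    (Finset.subset_biUnion_of_mem (fun i => jointSwapPairs H B x ∅ u i) (Finset.mem_univ i)).trans
      (Finset.subset_biUnion_of_mem
        (fun u => Finset.univ.biUnion fun i => jointSwapPairs H B x ∅ u i) hu)
  have hR : ∀ e ∈ R, ¬ e.IsDiag := by
    intro e he
    simp only [R, Finset.mem_biUnion, Finset.mem_univ, true_and] at he
    obtain ⟨u, hu, i, hi⟩ := he
    exact not_isDiag_of_mem_jointSwapPairs hx hu hi
  have hκ : ∀ A : {A // A ∈ B.powersetCard a}, A.1 ⊆ B ∧ A.1.card = a := fun A =>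
    Finset.mem_powersetCard.1 A.2
  have h := loss_exists_subset_le hR (by omega) hn (κ := {A // A ∈ B.powersetCard a})
    (fun A => A.1 × Fin s) (q := a * s) (M := Δ * (s + 2)) (fun A => by simp [(hκ A).2])
    (fun A p => jointSwapPairs H B x A.1 p.1 p.2)
    (fun A p => (jointSwapPairs_subset _ _ _).trans (hmemR _ ((hκ A).1 p.1.2) _))
    (fun A p p' hpp => disjoint_jointSwapPairs hx (hκ A).1 p.1.2 p'.1.2 (fun h => hpp (by
      rw [Prod.mk.injEq] at h
      exact Prod.ext (Subtype.ext h.1) h.2)))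
    (fun A p => card_jointSwapPairs_le hΔ _ _ _) t G
  refine (loss_mono_set ?_ t G).trans (h.trans (le_of_eq ?_))
  · rintro G' ⟨hGG', hG'⟩
    refine mem_almostContaining_of_forall_exists hx (hG.mono hGG') ha fun A hA => ?_
    obtain ⟨p, hp⟩ := hG' ⟨A, hA⟩
    exact ⟨p.1, p.1.2, p.2, hp⟩
  · rw [Fintype.card_coe, Finset.card_powersetCard, Nat.cast_mul a s]

end simultaneous

/-! ### Repairing an independent set of bad vertices pair by pair -/

lemma missing_anti {V : Type*} {Q : Finset (Sym2 V)} {G G' : SimpleGraph V} (h : G ≤ G') :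
    missing Q G' ≤ missing Q G :=
  Finset.card_le_card fun e he => by
    rw [Finset.mem_filter] at he ⊢
    exact ⟨he.1, fun h' => he.2 (SimpleGraph.edgeSet_mono h h')⟩

lemma missing_lt {V : Type*} {Q : Finset (Sym2 V)} {G G' : SimpleGraph V} (h : G ≤ G') {e : Sym2 V}
    (he : e ∈ Q) (heG : e ∉ G.edgeSet) (heG' : e ∈ G'.edgeSet) : missing Q G' < missing Q G := by
  refine Finset.card_lt_card ((Finset.ssubset_iff_of_subset fun f hf => ?_).2 ⟨e, ?_, ?_⟩)
  · rw [Finset.mem_filter] at hf ⊢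
    exact ⟨hf.1, fun h' => hf.2 (SimpleGraph.edgeSet_mono h h')⟩
  · exact Finset.mem_filter.2 ⟨he, heG⟩
  · rw [Finset.mem_filter, not_and_not_right]
    exact fun _ => heG'

section sequential
variable {V : Type*} [Fintype V]

variable {N : ℕ} {E : V → Fin N → Finset (Sym2 V)} {A₀ : Finset V}

/-- All but `b` vertices of `A₀` have at least `M` candidates which miss at most `d` pairs. -/
def partialSwaps (E : V → Fin N → Finset (Sym2 V)) (A₀ : Finset V) (G₀ : SimpleGraph V)
    (b d M : ℕ) : Set (SimpleGraph V) :=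
  {G | G₀ ≤ G ∧ ∃ A ⊆ A₀, (A₀ \ A).card ≤ b ∧ ∀ u ∈ A, ∃ C : Finset (Fin N), M ≤ C.card ∧
    ∀ i ∈ C, missing (E u i) G ≤ d}

/-- Designate one missing pair for each unfinished candidate and split the candidates of each vertex
into `M` groups of size `g`. If fewer than `M` candidates of a vertex get down to `d` missing pairs,
some whole group has made no progress. For `a` such vertices, `a * g` designated pairs are
unclaimed, and there are only `M ^ a` choices of groups. -/
lemma loss_partialSwaps_step [Nonempty V] (hn : 5 ≤ Fintype.card V)
    (hE : ∀ u ∈ A₀, ∀ i, ∀ e ∈ E u i, ¬ e.IsDiag)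
    (hdisj : ∀ u ∈ A₀, ∀ v ∈ A₀, ∀ i j, (u, i) ≠ (v, j) → Disjoint (E u i) (E v j))
    (htar : 16 * (A₀.card * N) ≤ Fintype.card V) {G₀ G : SimpleGraph V} {a b d M g : ℕ}
    (ha : 1 ≤ a) (hG : G ∈ partialSwaps E A₀ G₀ b (d + 1) (M * g)) (t : ℕ) :
    loss (partialSwaps E A₀ G₀ (b + (a - 1)) d M) t G ≤
      (A₀.card.choose a : ℝ) * (M : ℝ) ^ a * Real.exp (-(a * g * (t / Fintype.card V : ℝ))) := by
  obtain ⟨hG₀, A, hA, hAb, hAC⟩ := hG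
  have hc : ∀ u ∈ A, ∃ c : Fin M × Fin g → Fin N, Function.Injective c ∧
      ∀ p, missing (E u (c p)) G ≤ d + 1 := by
    intro u hu
    obtain ⟨C, hC, hC'⟩ := hAC u hu
    obtain ⟨c⟩ : Nonempty (Fin M × Fin g ↪ C) :=
      Function.Embedding.nonempty_of_card_le (by simpa using hC)
    exact ⟨fun p => c p, Subtype.val_injective.comp c.injective, fun p => hC' _ (c p).2⟩
  choose c hcinj hcm using hc
  have hT : ∀ u i, ∃ S : Finset (Sym2 V), S.card ≤ 1 ∧ (∀ e ∈ S, e ∈ E u i ∧ e ∉ G.edgeSet) ∧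
      (0 < missing (E u i) G → S.Nonempty) := by
    intro u i
    by_cases h : 0 < missing (E u i) G
    · obtain ⟨e, he⟩ := Finset.card_pos.1 h
      exact ⟨{e}, by simp, by simpa using he, fun _ => ⟨e, by simp⟩⟩
    · exact ⟨∅, by simp, by simp, fun h' => (h h').elim⟩
  choose T hT1 hTE hTne using hT
  let R : Finset (Sym2 V) := A₀.biUnion fun u => Finset.univ.biUnion fun i => T u i
  have hRc : R.card ≤ A₀.card * N := by
    refine Finset.card_biUnion_le_card_mul _ _ _ fun u _ => ?_
    refine (Finset.card_biUnion_le_card_mul _ _ 1 fun i _ => hT1 u i).trans ?_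
    simp
  have hTR : ∀ u ∈ A₀, ∀ i, T u i ⊆ R := fun u hu i =>
    (Finset.subset_biUnion_of_mem (fun i => T u i) (Finset.mem_univ i)).trans
      (Finset.subset_biUnion_of_mem (fun u => Finset.univ.biUnion fun i => T u i) hu)
  have hR : ∀ e ∈ R, ¬ e.IsDiag := by
    intro e he
    simp only [R, Finset.mem_biUnion, Finset.mem_univ, true_and] at he
    obtain ⟨u, hu, i, hi⟩ := he
    exact hE u hu i e (hTE u i e hi).1
  have hTd : ∀ u ∈ A₀, ∀ v ∈ A₀, ∀ i j, (u, i) ≠ (v, j) → Disjoint (T u i) (T v j) :=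
    fun u hu v hv i j h => (hdisj u hu v hv i j h).mono (fun e he => (hTE _ _ e he).1)
      (fun e he => (hTE _ _ e he).1)
  let κ := Σ A' : {A' // A' ∈ A.powersetCard a}, (A'.1 → Fin M)
  have hκ : ∀ k : κ, k.1.1 ⊆ A ∧ k.1.1.card = a := fun k => Finset.mem_powersetCard.1 k.1.2
  let S : ∀ k : κ, k.1.1 × Fin g → Finset (Sym2 V) := fun k p =>
    T p.1 (c p.1 ((hκ k).1 p.1.2) (k.2 p.1, p.2))
  -- A group containing an already complete candidate cannot be bad, so only groups with all
  -- designated pairs present need to be hit.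
  let ι := {k : κ // ∀ p, (S k p).Nonempty}
  have hQc : ∀ k : ι, a * g ≤ (Finset.univ.biUnion (S k.1)).card := by
    intro k
    rw [Finset.card_biUnion]
    · calc a * g = ∑ p : k.1.1.1 × Fin g, 1 := by simp [(hκ k.1).2]
        _ ≤ _ := Finset.sum_le_sum fun p _ => Finset.card_pos.2 (k.2 p)
    · rintro ⟨u, i⟩ _ ⟨v, j⟩ _ hne
      refine hTd _ (hA ((hκ k.1).1 u.2)) _ (hA ((hκ k.1).1 v.2)) _ _ fun h => hne ?_
      rw [Prod.mk.injEq] at h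
      obtain ⟨h1, h2⟩ := h
      have h3 := Subtype.ext h1
      subst h3
      have := hcinj _ _ h2
      simp only [Prod.mk.injEq, true_and] at this
      rw [this]
  have h := loss_hit_all_le' hR (by omega) hn (ι := ι) (fun k => Finset.univ.biUnion (S k.1))
    (fun k => Finset.biUnion_subset.2 fun p _ => hTR _ (hA ((hκ k.1).1 p.1.2)) _) hQc t G
  refine (loss_mono_set ?_ t G).trans (h.trans ?_)
  · rintro G' ⟨hGG', hG'⟩
    refine ⟨hG₀.trans hGG', A.filter fun u => ∃ C : Finset (Fin N), M ≤ C.card ∧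
      ∀ i ∈ C, missing (E u i) G' ≤ d, (Finset.filter_subset _ _).trans hA, ?_,
      fun u hu => (Finset.mem_filter.1 hu).2⟩
    set A' := A.filter fun u => ∃ C : Finset (Fin N), M ≤ C.card ∧ ∀ i ∈ C, missing (E u i) G' ≤ d
      with hA'
    have h1 : (A \ A').card < a := by
      by_contra hcon
      obtain ⟨F, hF, hFc⟩ := Finset.exists_subset_card_eq (not_lt.1 hcon)
      have hFA : F ⊆ A := hF.trans Finset.sdiff_subset
      have hbad : ∀ u (hu : u ∈ F), ∃ β, ∀ γ, d < missing (E u (c u (hFA hu) (β, γ))) G' := by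
        intro u hu
        by_contra hno
        push Not at hno
        choose γ hγ using hno
        refine (Finset.mem_sdiff.1 (hF hu)).2 (Finset.mem_filter.2 ⟨hFA hu,
          Finset.univ.image fun β => c u (hFA hu) (β, γ β), ?_, ?_⟩)
        · rw [Finset.card_image_of_injective]
          · simp
          · intro β β' hβ
            have := hcinj u (hFA hu) hβ
            simp only [Prod.mk.injEq] at this
            exact this.1
        · simp only [Finset.mem_image, Finset.mem_univ, true_and, forall_exists_index,
            forall_apply_eq_imp_iff]
          exact hγ
      choose β hβ using hbad
      let k : κ := ⟨⟨F, Finset.mem_powersetCard.2 ⟨hFA, hFc⟩⟩, fun u => β u u.2⟩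
      have hk : ∀ p, (S k p).Nonempty := fun p => hTne _ _
        (lt_of_lt_of_le ((Nat.zero_le d).trans_lt (hβ p.1 p.1.2 p.2)) (missing_anti hGG'))
      obtain ⟨e, he, heG'⟩ := hG' ⟨k, hk⟩
      obtain ⟨p, _, hp⟩ := Finset.mem_biUnion.1 he
      have h2 := hTE _ _ e hp
      have h3 := missing_lt hGG' h2.1 h2.2 heG'
      have h4 := hcm p.1 (hFA p.1.2) (β p.1 p.1.2, p.2)
      have h5 := hβ p.1 p.1.2 p.2
      simp only [k] at h3
      omega
    have h2 : A₀ \ A' ⊆ (A₀ \ A) ∪ (A \ A') := by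
      intro v
      simp only [Finset.mem_union, Finset.mem_sdiff]
      tauto
    have h3 := (Finset.card_le_card h2).trans (Finset.card_union_le _ _)
    omega
  · have hι : Fintype.card ι ≤ A₀.card.choose a * M ^ a := by
      refine (Fintype.card_subtype_le _).trans ?_
      rw [Fintype.card_sigma]
      refine (Finset.sum_le_card_nsmul _ _ (M ^ a) fun k _ => ?_).trans ?_
      · rw [Fintype.card_fun, Fintype.card_coe, Fintype.card_fin, (Finset.mem_powersetCard.1 k.2).2]
      · rw [Finset.card_univ, Fintype.card_coe, Finset.card_powersetCard, smul_eq_mul]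
        exact Nat.mul_le_mul_right _ (Nat.choose_le_choose _ (Finset.card_le_card hA))
    push_cast
    gcongr
    exact_mod_cast hι

/-- Each of `d` phases gains one pair per surviving candidate, keeps a fraction `1 / g` of the
candidates and gives up at most `a - 1` vertices. -/
lemma loss_partialSwaps_le [Nonempty V] (hn : 5 ≤ Fintype.card V)
    (hE : ∀ u ∈ A₀, ∀ i, ∀ e ∈ E u i, ¬ e.IsDiag)
    (hdisj : ∀ u ∈ A₀, ∀ v ∈ A₀, ∀ i j, (u, i) ≠ (v, j) → Disjoint (E u i) (E v j))
    (htar : 16 * (A₀.card * N) ≤ Fintype.card V) {G₀ : SimpleGraph V} {a g t : ℕ} {ε : ℝ}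
    (ha : 1 ≤ a) (hε : 0 ≤ ε) (d : ℕ)
    (hd : ∀ j < d, (A₀.card.choose a : ℝ) * ((g ^ j : ℕ) : ℝ) ^ a *
      Real.exp (-(a * g * (t / Fintype.card V : ℝ))) ≤ ε) {b : ℕ} {G : SimpleGraph V}
    (hG : G ∈ partialSwaps E A₀ G₀ b d (g ^ d)) :
    loss (partialSwaps E A₀ G₀ (b + d * (a - 1)) 0 1) (d * t) G ≤ d * ε := by
  induction d generalizing b G with
  | zero =>
    rw [loss_eq_zero (by simpa using hG)]
    simp
  | succ d ih =>
    have h1 := loss_partialSwaps_step hn hE hdisj htar ha (M := g ^ d) (g := g)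
      (by rwa [pow_succ] at hG) t
    rw [show (d + 1) * t = t + d * t by ring, show b + (d + 1) * (a - 1) =
      b + (a - 1) + d * (a - 1) by ring]
    refine (loss_add_le (B := partialSwaps E A₀ G₀ (b + (a - 1)) d (g ^ d)) (ε := d * ε)
      (by positivity) (fun G' hG' => ih (fun j hj => hd j (by omega)) hG') G).trans ?_
    have h2 := h1.trans (hd d (by omega))
    push_cast
    linarith

/-- A maximal independent subset of `B` dominates it, and closed neighbourhoods have at most `Δ + 1`
vertices. -/
lemma exists_independent {H : SimpleGraph V} {Δ : ℕ} (hΔ : ∀ v, (H.neighborFinset v).card ≤ Δ)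
    (B : Finset V) : ∃ A ⊆ B, (∀ u ∈ A, ∀ v ∈ A, ¬ H.Adj u v) ∧ B.card ≤ A.card * (Δ + 1) := by
  obtain ⟨A, ⟨hAB, hA⟩, hmax⟩ := Set.exists_max_image
    {A : Finset V | A ⊆ B ∧ ∀ u ∈ A, ∀ v ∈ A, ¬ H.Adj u v} Finset.card (Set.toFinite _)
    ⟨∅, by simp⟩
  refine ⟨A, hAB, hA, ?_⟩
  have hcov : B ⊆ A.biUnion fun v => insert v (H.neighborFinset v) := by
    intro b hb
    by_contra hcon
    simp only [Finset.mem_biUnion, Finset.mem_insert, SimpleGraph.mem_neighborFinset, not_exists,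
      not_and, not_or] at hcon
    have hbA : b ∉ A := fun h => (hcon b h).1 rfl
    have := hmax (insert b A) ⟨Finset.insert_subset hb hAB, fun u hu v hv => by
      rcases Finset.mem_insert.1 hu with h1 | h1 <;> rcases Finset.mem_insert.1 hv with h2 | h2
      · subst h1 h2
        exact H.irrefl
      · subst h1
        exact fun h => (hcon v h2).2 h.symm
      · subst h2
        exact (hcon u h1).2
      · exact hA u h1 v h2⟩
    rw [Finset.card_insert_of_notMem hbA] at this
    omega
  refine (Finset.card_le_card hcov).trans (Finset.card_biUnion_le_card_mul _ _ _ fun v _ => ?_)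
  exact (Finset.card_insert_le _ _).trans (Nat.succ_le_succ (hΔ v))

/-- Exchanges at independent vertices do not interact, so each needs only its own at most `2 * Δ`
pairs. This explains the `2 * Δ` phases and the initial `g ^ (2 * Δ)` candidates per vertex.
Neighbours in `B \ A` stay exceptional and are ignored. -/
lemma loss_sequential_le [Nonempty V] {H : SimpleGraph V} {Δ a g : ℕ} {A B : Finset V}
    (hΔ : ∀ v, (H.neighborFinset v).card ≤ Δ) {G : SimpleGraph V} (hG : NearCopy H B G)
    (hAB : A ⊆ B) (hA : ∀ u ∈ A, ∀ v ∈ A, ¬ H.Adj u v) (ha : 1 ≤ a) (hg : 1 ≤ g)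
    (hn : 5 ≤ Fintype.card V)
    (hsep : A.card * g ^ (2 * Δ) * (Δ ^ 2 + Δ + 1) + B.card * (Δ + 1) ≤ Fintype.card V)
    (htar : 16 * (A.card * g ^ (2 * Δ)) ≤ Fintype.card V) (t : ℕ) :
    loss (almostContaining H (B.card - A.card + 2 * Δ * (a - 1))) (2 * Δ * t) G ≤
      2 * Δ * ((A.card.choose a : ℝ) * ((g ^ (2 * Δ) : ℕ) : ℝ) ^ a *
        Real.exp (-(a * g * (t / Fintype.card V : ℝ)))) := by
  obtain ⟨x, hx, hxB, hxadj⟩ := exists_candidates hΔ A B (g ^ (2 * Δ)) hsep hAB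
  have hsub : ∀ u i, swapPairs H B u (x u i) ⊆ jointSwapPairs H A x A u i := by
    intro u i
    refine (Finset.union_subset_union_left (Finset.image_subset_image
      (Finset.sdiff_subset_sdiff subset_rfl hAB))).trans Finset.subset_union_left
  have hmem : G ∈ partialSwaps (fun u i => swapPairs H B u (x u i)) A G 0 (2 * Δ) (g ^ (2 * Δ)) := by
    refine ⟨le_rfl, A, subset_rfl, by simp, fun u _ => ⟨Finset.univ, by simp, fun i _ => ?_⟩⟩
    exact (Finset.card_le_card (Finset.filter_subset _ _)).trans (card_swapPairs_le hΔ B u _)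
  have h := loss_partialSwaps_le hn (E := fun u i => swapPairs H B u (x u i))
    (fun u hu i e he => not_isDiag_of_mem_jointSwapPairs hx hu
      (jointSwapPairs_subset _ _ _ (hsub u i he)))
    (fun u hu v hv i j hne => (disjoint_jointSwapPairs hx subset_rfl hu hv hne).mono
      (hsub u i) (hsub v j)) htar ha (t := t) (g := g)
    (ε := (A.card.choose a : ℝ) * ((g ^ (2 * Δ) : ℕ) : ℝ) ^ a *
        Real.exp (-(a * g * (t / Fintype.card V : ℝ)))) (by positivity) (2 * Δ)
    (fun j hj => by
      gcongr) hmem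
  refine (loss_mono_set ?_ _ _).trans (h.trans (le_of_eq (by push_cast; ring)))
  rintro G' ⟨hGG', U, hU, hUc, hUm⟩
  have hi : ∀ u ∈ U, ∃ i, ∀ e ∈ swapPairs H B u (x u i), e ∈ G'.edgeSet := by
    intro u hu
    obtain ⟨C, hC, hC'⟩ := hUm u hu
    obtain ⟨i, hi⟩ := Finset.card_pos.1 hC
    refine ⟨i, fun e he => ?_⟩
    by_contra hcon
    have h0 := Finset.card_eq_zero.1 (Nat.le_zero.1 (hC' i hi))
    exact Finset.notMem_empty e (h0 ▸ Finset.mem_filter.2 ⟨he, hcon⟩)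
  have hne : Nonempty (Fin (g ^ (2 * Δ))) := ⟨⟨0, Nat.pow_pos hg⟩⟩
  choose! f hf using hi
  have hcard : (B \ U).card ≤ B.card - A.card + 2 * Δ * (a - 1) := by
    have h1 : B \ U ⊆ (B \ A) ∪ (A \ U) := by
      intro v
      simp only [Finset.mem_union, Finset.mem_sdiff]
      tauto
    have h2 := (Finset.card_le_card h1).trans (Finset.card_union_le _ _)
    rw [Finset.card_sdiff_of_subset hAB] at h2
    omega
  refine almostContaining_mono H hcard ((hG.mono hGG').swap (hU.trans hAB) (fun u => x u (f u))
    (fun u hu v hv h => (hx.eq u (hU hu) v (hU hv) _ _ h).1) (fun u hu => hxB u (hU hu) _)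
    (fun u hu => hxadj u (hU hu) _)
    (fun u hu v hv => hx.not_adj u (hU hu) v (hU hv) _ _) ?_ ?_
    (fun u hu v hv huv => (hA u (hU hu) v (hU hv) huv).elim))
  · intro u hu w huw hw
    refine hf u hu s(x u (f u), w) (Finset.mem_union_left _ (Finset.mem_image.2 ⟨w, ?_, rfl⟩))
    simpa using ⟨huw, hw⟩
  · intro u hu y hy
    refine hf u hu s(u, y) (Finset.mem_union_right _ (Finset.mem_image.2 ⟨y, ?_, rfl⟩))
    simpa using hy

lemma card_neighborFinset_le_of_iso {H H' : SimpleGraph V} {Δ : ℕ}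
    (hΔ : ∀ v, (H.neighborFinset v).card ≤ Δ) (f : H ≃g H') (v : V) :
    (H'.neighborFinset v).card ≤ Δ := by
  have h2 := hΔ (f.symm v)
  rw [SimpleGraph.card_neighborFinset_eq_degree] at h2 ⊢
  rwa [← f.degree_eq, f.apply_symm_apply] at h2

/-- One round of repairs reduces the number of bad vertices by a constant factor. -/
lemma loss_reduce_le [Nonempty V] {H : SimpleGraph V} {Δ a g r : ℕ}
    (hΔ : ∀ v, (H.neighborFinset v).card ≤ Δ) {G : SimpleGraph V} (hG : G ∈ almostContaining H r)
    (ha : 1 ≤ a) (hg : 1 ≤ g) (hn : 5 ≤ Fintype.card V)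
    (hsep : r * g ^ (2 * Δ) * (Δ ^ 2 + Δ + 1) + r * (Δ + 1) ≤ Fintype.card V)
    (htar : 16 * (r * g ^ (2 * Δ)) ≤ Fintype.card V) (t : ℕ) :
    loss (almostContaining H (r * Δ / (Δ + 1) + 2 * Δ * (a - 1))) (2 * Δ * t) G ≤
      2 * Δ * ((r.choose a : ℝ) * ((g ^ (2 * Δ) : ℕ) : ℝ) ^ a *
        Real.exp (-(a * g * (t / Fintype.card V : ℝ)))) := by
  obtain ⟨σ, B, hB, hGB⟩ := exists_nearCopy_of_mem_almostContaining hG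
  have hΔ' := card_neighborFinset_le_of_iso hΔ (SimpleGraph.Iso.map σ H)
  obtain ⟨A, hAB, hA, hBA⟩ := exists_independent hΔ' B
  have hAr : A.card ≤ r := (Finset.card_le_card hAB).trans hB
  have h := loss_sequential_le hΔ' hGB hAB hA ha hg hn (le_trans (by gcongr) hsep)
    (le_trans (by gcongr) htar) t
  have hr : B.card - A.card ≤ r * Δ / (Δ + 1) := by
    rw [Nat.le_div_iff_mul_le (by omega), Nat.sub_mul]
    have : B.card * Δ ≤ r * Δ := Nat.mul_le_mul_right _ hB
    rw [Nat.mul_succ] 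
    omega
  refine (loss_mono_set ((almostContaining_mono _ (by omega)).trans
    (almostContaining_map_subset H σ _)) _ _).trans (h.trans ?_)
  have := Nat.choose_le_choose a hAr
  gcongr

/-- Repairing all bad vertices simultaneously. -/
lemma loss_simultaneous_reduce_le [Nonempty V] {H : SimpleGraph V} {Δ a s r : ℕ}
    (hΔ : ∀ v, (H.neighborFinset v).card ≤ Δ) {G : SimpleGraph V} (hG : G ∈ almostContaining H r)
    (ha : 1 ≤ a) (hn : 5 ≤ Fintype.card V)
    (hsep : r * s * (Δ ^ 2 + Δ + 1) + r * (Δ + 1) ≤ Fintype.card V)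
    (htar : 16 * (r * (s * (Δ * (s + 2)))) ≤ Fintype.card V) (t : ℕ) :
    loss (almostContaining H (a - 1)) t G ≤ (r.choose a : ℝ) * (Δ * (s + 2) : ℕ) ^ (a * s) *
      Real.exp (-(a * s * (t / Fintype.card V : ℝ))) := by
  obtain ⟨σ, B, hB, hGB⟩ := exists_nearCopy_of_mem_almostContaining hG
  have hΔ' := card_neighborFinset_le_of_iso hΔ (SimpleGraph.Iso.map σ H)
  have h := loss_simultaneous_le hΔ' hGB ha hn (le_trans (by gcongr) hsep)
    (le_trans (by gcongr) htar) t
  refine (loss_mono_set (almostContaining_map_subset H σ _) _ _).trans (h.trans ?_)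
  have := Nat.choose_le_choose a hB
  gcongr

end sequential

/-! ### Almost all edges -/

/-- The supermartingale condition of `loss_missing_le` follows from `1 - exp (-x) ≥ x / (1 + x)`
once `d` exceeds `1 / p` with a little slack. -/
lemma one_sub_exp_neg_le_mul {p lam d : ℝ} (hp : 0 ≤ p) (hlam : 0 ≤ lam) (hd : 0 ≤ d)
    (h : 1 + lam * d ≤ p * d) : 1 - Real.exp (-lam) ≤ p * (1 - Real.exp (-(lam * d))) := by
  have h1 := Real.add_one_le_exp (-lam)
  have h0 : 0 ≤ lam * d := mul_nonneg hlam hd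
  have h2 : Real.exp (-(lam * d)) ≤ 1 / (1 + lam * d) := by
    rw [Real.exp_neg, ← one_div]
    exact one_div_le_one_div_of_le (by linarith) (by linarith [Real.add_one_le_exp (lam * d)])
  have h3 : lam * d / (1 + lam * d) ≤ 1 - Real.exp (-(lam * d)) := by
    have : lam * d / (1 + lam * d) = 1 - 1 / (1 + lam * d) := by
      field_simp
      ring
    linarith
  have h4 : lam ≤ p * (lam * d / (1 + lam * d)) := by
    rw [← mul_div_assoc, le_div_iff₀ (by linarith)]
    nlinarith
  have h5 := mul_le_mul_of_nonneg_left h3 hp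
  linarith

lemma choose_mul_pow_le {r a : ℕ} {c y : ℝ} (hy : 0 ≤ y) (hc : (r : ℝ) ≤ c * a) :
    (r.choose a : ℝ) * y ^ a ≤ (Real.exp 1 * c * y) ^ a := by
  have h1 : (r.choose a : ℝ) ≤ (r : ℝ) ^ a / a.factorial := Nat.choose_le_pow_div a r
  have h2 : (r : ℝ) ^ a / a.factorial ≤ (c * a) ^ a / a.factorial := by gcongr
  have h3 : (a : ℝ) ^ a / a.factorial ≤ Real.exp 1 ^ a := by
    rw [← Real.exp_nat_mul, mul_one]
    exact Real.pow_div_factorial_le_exp _ (Nat.cast_nonneg a) a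
  rcases Nat.eq_zero_or_pos a with rfl | ha
  · simp
  have hc0 : 0 ≤ c := by
    by_contra hcon
    have ha' : (0 : ℝ) < a := by exact_mod_cast ha
    have : c * a < 0 := mul_neg_of_neg_of_pos (not_le.1 hcon) ha'
    linarith [Nat.cast_nonneg (α := ℝ) r]
  have h4 : (c * a) ^ a / a.factorial = c ^ a * ((a : ℝ) ^ a / a.factorial) := by
    rw [mul_pow]; ring
  calc (r.choose a : ℝ) * y ^ a ≤ (c ^ a * Real.exp 1 ^ a) * y ^ a := by
        gcongr
        refine (h1.trans h2).trans ?_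
        rw [h4]
        gcongr
    _ = _ := by rw [mul_pow, mul_pow]; ring

lemma missing_le_card {V : Type*} (Q : Finset (Sym2 V)) (G : SimpleGraph V) :
    missing Q G ≤ Q.card :=
  Finset.card_le_card (Finset.filter_subset _ _)

section stage
variable {V : Type*} [Fintype V] {H : SimpleGraph V} {Δ : ℕ}

lemma two_mul_card_edgeFinset_le (hΔ : ∀ v, (H.neighborFinset v).card ≤ Δ) :
    2 * H.edgeFinset.card ≤ Δ * Fintype.card V := by
  rw [← H.sum_degrees_eq_twice_card_edges]
  refine (Finset.sum_le_card_nsmul _ _ Δ fun v _ => ?_).trans (by simp [mul_comm])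
  rw [← SimpleGraph.card_neighborFinset_eq_degree]
  exact hΔ v

/-- Keep the labelling and declare one endpoint of each missing edge exceptional. -/
lemma mem_almostContaining_of_missing_le {G : SimpleGraph V} {r : ℕ}
    (h : missing H.edgeFinset G ≤ r) : G ∈ almostContaining H r := by
  refine ⟨Equiv.refl V, (H.edgeFinset.filter fun e => e ∉ G.edgeSet).image fun e => (Quot.out e).1,
    Finset.card_image_le.trans h, fun u v huv hu hv => ?_⟩
  by_contra hcon
  have hmem : s(u, v) ∈ H.edgeFinset.filter fun e => e ∉ G.edgeSet := by
    rw [Finset.mem_filter, SimpleGraph.mem_edgeFinset]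
    exact ⟨huv, hcon⟩
  have hout := Sym2.out_fst_mem s(u, v)
  have himg := Finset.mem_image_of_mem (fun e : Sym2 V => (Quot.out e).1) hmem
  rcases Sym2.mem_iff.1 hout with h' | h'
  · exact hu (by simpa only [h'] using himg)
  · exact hv (by simpa only [h'] using himg)

variable [Nonempty V]

lemma le_treeAvg_hit_of_subset (hΔ : ∀ v, (H.neighborFinset v).card ≤ Δ)
    (hΔn : Δ ≤ Fintype.card V) (hn : 5 ≤ Fintype.card V) {Q : Finset (Sym2 V)}
    (hQ : Q ⊆ H.edgeFinset) {x : ℝ} (hx : 0 ≤ x) (hxQ : x * Fintype.card V ≤ Q.card) :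
    x / (x + 15) ≤ treeAvg (fun T => if ∃ e ∈ Q, e ∈ T.1.edgeSet then 1 else 0) := by
  have hdiag : ∀ e ∈ Q, ¬ e.IsDiag := fun e he =>
    H.not_isDiag_of_mem_edgeSet (SimpleGraph.mem_edgeFinset.1 (hQ he))
  refine le_trans ?_ (le_treeAvg_hit (Δ := Δ) hdiag (fun v => ?_) hΔn hn)
  · have hn' : (0 : ℝ) < Fintype.card V := by exact_mod_cast (by omega : 0 < Fintype.card V)
    have hQ0 : (0 : ℝ) ≤ Q.card := Nat.cast_nonneg _
    rw [div_le_div_iff₀ (by linarith) (by linarith)]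
    nlinarith
  · refine le_trans ?_ (hΔ v)
    refine Finset.card_le_card_of_surjOn (fun w => s(v, w)) fun e he => ?_
    simp only [Finset.coe_filter, Set.mem_ofPred_eq] at he
    obtain ⟨w, rfl⟩ := Sym2.mem_iff_exists.1 he.2
    refine ⟨w, ?_, rfl⟩
    simpa using hQ he.1

/-- While more than `κ * n` edges are missing, a round succeeds with probability at least `κ / (κ +
15)`. The excess over the number of edges is thus of order `Δ * n / κ`, which is at most of order `κ
* n` because `Δ < κ ^ 2`. -/
lemma loss_missing_first_le (hΔ : ∀ v, (H.neighborFinset v).card ≤ Δ)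
    (hΔn : Δ ≤ Fintype.card V) (hn : 5 ≤ Fintype.card V) {κ : ℕ} (hκ : Δ < κ ^ 2) :
    loss {G | missing H.edgeFinset G ≤ κ * Fintype.card V}
      (Δ * Fintype.card V / 2 + 18 * κ * Fintype.card V) ⊥ ≤ Real.exp (-(Fintype.card V / 32)) := by
  set n := Fintype.card V with hn0
  have hκ0 : 0 < κ := by
    rcases Nat.eq_zero_or_pos κ with rfl | h
    · simp at hκ
    · exact h
  have hκ1 : (1 : ℝ) ≤ κ := by exact_mod_cast hκ0
  have hn' : (5 : ℝ) ≤ n := by exact_mod_cast hn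
  have hp := fun Q' (hQ' : Q' ⊆ H.edgeFinset) (h : κ * n < Q'.card) =>
    le_treeAvg_hit_of_subset hΔ hΔn hn hQ' (x := κ) (by positivity) (by
      rw [← hn0]; exact_mod_cast h.le)
  have h := loss_missing_le (Q := H.edgeFinset) (m := κ * n) (p := κ / (κ + 15))
    -- The first factor of `d` is slack over `1 / p`. Since `d ≤ 1 + 31 / κ`, the budget is exceeded
    -- by at least `κ * n` rounds, which yields the exponent `-n / 32`.
    (lam := 1 / (32 * κ)) (d := (1 + 1 / κ) * ((κ + 15) / κ)) hp (by positivity) (by positivity)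
    (one_sub_exp_neg_le_mul (by positivity) (by positivity) (by positivity) ?_)
    (Δ * n / 2 + 18 * κ * n) ⊥
  · rcases h with h | h
    · refine h.trans ?_
      rw [Real.exp_le_exp]
      have h1 : ((missing H.edgeFinset ⊥ : ℕ) : ℝ) ≤ Δ * n / 2 := by
        have h2 := two_mul_card_edgeFinset_le hΔ
        have h3 := missing_le_card H.edgeFinset ⊥
        rw [le_div_iff₀ (by norm_num)]
        exact_mod_cast (by rw [← hn0] at h2; omega : missing H.edgeFinset ⊥ * 2 ≤ Δ * n)
      have h2 : (Δ * n / 2 : ℝ) ≤ ((Δ * n / 2 : ℕ) : ℝ) + 1 := by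
        rw [div_le_iff₀ (by norm_num)]
        exact_mod_cast (by omega : Δ * n ≤ (Δ * n / 2 + 1) * 2)
      have h3 : (1 + 1 / (κ : ℝ)) * ((κ + 15) / κ) ≤ 1 + 31 / κ := by
        have e1 : (1 + 1 / (κ : ℝ)) * ((κ + 15) / κ) = 1 + 16 / κ + 15 / κ * (1 / κ) := by
          field_simp
          ring
        have e2 : 15 / (κ : ℝ) * (1 / κ) ≤ 15 / κ * 1 := by
          gcongr
          rw [div_le_one (by linarith)]
          exact hκ1
        rw [e1]
        have e3 : 31 / (κ : ℝ) = 16 / κ + 15 / κ := by ring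
        linarith
      have h4 : (1 + 1 / (κ : ℝ)) * ((κ + 15) / κ) * (missing H.edgeFinset ⊥ : ℕ) ≤
          (1 + 31 / κ) * (Δ * n / 2) := by gcongr
      have h5 : (1 + 31 / (κ : ℝ)) * (Δ * n / 2) ≤ Δ * n / 2 + 16 * κ * n := by
        have hΔκ : (Δ : ℝ) ≤ κ ^ 2 := by exact_mod_cast hκ.le
        have e1 : 31 / (κ : ℝ) * (Δ * n / 2) ≤ 31 / κ * (κ ^ 2 * n / 2) := by gcongr
        have e2 : 31 / (κ : ℝ) * (κ ^ 2 * n / 2) = 31 / 2 * κ * n := by field_simp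
        have e3 : (0 : ℝ) ≤ κ * n := by positivity
        nlinarith
      have h6 : (1 + 1 / (κ : ℝ)) * ((κ + 15) / κ) * (missing H.edgeFinset ⊥ : ℕ) -
          ((Δ * n / 2 + 18 * κ * n : ℕ) : ℝ) ≤ -(κ * n) := by
        push_cast at h2 ⊢
        have e3 : (1 : ℝ) ≤ κ * n := by nlinarith
        nlinarith
      calc _ ≤ 1 / (32 * (κ : ℝ)) * (-(κ * n)) := mul_le_mul_of_nonneg_left h6 (by positivity)
        _ = _ := by field_simp
    · rw [loss_eq_zero h]
      positivity
  · have e0 : (κ : ℝ) / (κ + 15) * ((1 + 1 / κ) * ((κ + 15) / κ)) = 1 + 1 / κ := by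
      field_simp
    have e1 : 1 / (32 * (κ : ℝ)) * ((1 + 1 / κ) * ((κ + 15) / κ)) ≤ 1 / (32 * κ) * (2 * 16) := by
      gcongr
      · have : 1 / (κ : ℝ) ≤ 1 := by rw [div_le_one (by linarith)]; exact hκ1
        linarith
      · rw [div_le_iff₀ (by linarith)]; linarith
    have e2 : 1 / (32 * (κ : ℝ)) * (2 * 16) = 1 / κ := by field_simp; norm_num
    rw [e0]
    linarith

lemma loss_missing_second_le (hΔ : ∀ v, (H.neighborFinset v).card ≤ Δ)
    (hΔn : Δ ≤ Fintype.card V) (hn : 5 ≤ Fintype.card V) {κ : ℕ} (hκ : 0 < κ) {G : SimpleGraph V}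
    (hG : missing H.edgeFinset G ≤ κ * Fintype.card V) :
    loss {G | 16 * missing H.edgeFinset G ≤ Fintype.card V} (500 * κ * Fintype.card V) G ≤
      Real.exp (-(Fintype.card V / 32)) := by
  set n := Fintype.card V with hn0
  have hκ1 : (1 : ℝ) ≤ κ := by exact_mod_cast hκ
  have hset : {G : SimpleGraph V | 16 * missing H.edgeFinset G ≤ n} =
      {G | missing H.edgeFinset G ≤ n / 16} := by
    ext G
    simp only [Set.mem_ofPred_eq]
    omega
  rw [hset]
  have hp := fun Q' (hQ' : Q' ⊆ H.edgeFinset) (h : n / 16 < Q'.card) =>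
    le_treeAvg_hit_of_subset hΔ hΔn hn hQ' (x := 1 / 16) (by positivity) (by
      rw [← hn0, div_mul_eq_mul_div, one_mul, div_le_iff₀ (by norm_num)]
      exact_mod_cast (by omega : n ≤ Q'.card * 16))
  rcases loss_missing_le (Q := H.edgeFinset) (m := n / 16) (p := 1 / 16 / (1 / 16 + 15))
    -- Here `p = 1 / 241` and `d = 2 / p`; the spare `18 * κ * n` rounds give the exponent.
    (lam := 1 / 482) (d := 482) hp (by norm_num) (by norm_num)
    (one_sub_exp_neg_le_mul (by norm_num) (by norm_num) (by norm_num) (by norm_num))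
    (500 * κ * n) G with h | h
  · refine h.trans ?_
    rw [Real.exp_le_exp]
    have h1 : ((missing H.edgeFinset G : ℕ) : ℝ) ≤ κ * n := by exact_mod_cast hG
    have h2 : (n : ℝ) ≤ κ * n := le_mul_of_one_le_left (Nat.cast_nonneg _) hκ1
    push_cast
    linarith
  · rw [loss_eq_zero h]
    positivity

/-- If every `a`-subset of the missing edges is hit, fewer than `a` of them remain. -/
lemma loss_wait_le (hn : 5 ≤ Fintype.card V) {G : SimpleGraph V}
    (hG : 16 * missing H.edgeFinset G ≤ Fintype.card V) {a : ℕ} (ha : 1 ≤ a) (t : ℕ) :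
    loss (almostContaining H (a - 1)) t G ≤
      ((Fintype.card V).choose a : ℝ) * Real.exp (-(t / Fintype.card V : ℝ)) ^ a := by
  set R := H.edgeFinset.filter fun e => e ∉ G.edgeSet with hR
  have hRc : R.card = missing H.edgeFinset G := rfl
  have hmem : ∀ S : {S // S ∈ R.powersetCard a}, S.1 ⊆ R ∧ S.1.card = a := fun S =>
    Finset.mem_powersetCard.1 S.2
  have h := loss_hit_all_le' (R := R) (fun e he => H.not_isDiag_of_mem_edgeSet
    (SimpleGraph.mem_edgeFinset.1 (Finset.mem_filter.1 he).1)) (by omega) hn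
    (ι := {S // S ∈ R.powersetCard a}) (fun S => S.1) (fun S => (hmem S).1)
    (fun S => (hmem S).2.ge) t G
  refine (loss_mono_set ?_ t G).trans (h.trans ?_)
  · rintro G' ⟨hGG', hG'⟩
    apply mem_almostContaining_of_missing_le
    by_contra hcon
    have hsub : (H.edgeFinset.filter fun e => e ∉ G'.edgeSet) ⊆ R := by
      intro e he
      rw [hR, Finset.mem_filter]
      rw [Finset.mem_filter] at he
      exact ⟨he.1, fun h' => he.2 (SimpleGraph.edgeSet_mono hGG' h')⟩
    have hcard : a ≤ (H.edgeFinset.filter fun e => e ∉ G'.edgeSet).card := by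
      unfold missing at hcon
      omega
    obtain ⟨S, hS, hSc⟩ := Finset.exists_subset_card_eq hcard
    obtain ⟨e, he, he'⟩ := hG' ⟨S, Finset.mem_powersetCard.2 ⟨hS.trans hsub, hSc⟩⟩
    exact (Finset.mem_filter.1 (hS he)).2 he'
  · rw [Fintype.card_coe, Finset.card_powersetCard, ← Real.exp_nat_mul, mul_neg]
    gcongr
    omega

end stage

/-! ### The last exceptional vertices -/

lemma loss_chain_le {V : Type*} [Finite V] [Nonempty V] {A : ℕ → Set (SimpleGraph V)} {k : ℕ}
    {ε : ℝ} (hε : 0 ≤ ε) (h : ∀ i, ∀ G ∈ A i, loss (A (i + 1)) k G ≤ ε) {G : SimpleGraph V}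
    (hG : G ∈ A 0) (i : ℕ) : loss (A i) (i * k) G ≤ i * ε := by
  induction i with
  | zero => rw [loss_eq_zero hG]; simp
  | succ i ih =>
    rw [add_mul, one_mul]
    refine (loss_add_le hε (h i) G).trans ?_
    push_cast
    linarith

/-- With `u = √h`, use `2 * h ≤ exp (2 * u)`; the hypothesis says `64 * (Δ + 1) ≤ u`. -/
lemma two_mul_pow_le_exp {Δ h : ℕ} (hh : 4096 * (Δ + 1) ^ 2 ≤ h) :
    (2 * h : ℝ) ^ (4 * Δ + 4) ≤ Real.exp (h / 8) := by
  have hh' : (4096 * (Δ + 1) ^ 2 : ℝ) ≤ h := by exact_mod_cast hh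
  have hpos : (0 : ℝ) < h := lt_of_lt_of_le (by positivity) hh'
  set u := Real.sqrt h with hu
  have hu2 : u * u = h := Real.mul_self_sqrt hpos.le
  have hu0 : 0 < u := Real.sqrt_pos.2 hpos
  have hu1 : 64 * (Δ + 1 : ℝ) ≤ u := Real.le_sqrt_of_sq_le (by nlinarith)
  have h2u : (2 * h : ℝ) ≤ Real.exp (2 * u) := by
    have h1 := Real.quadratic_le_exp_of_nonneg (x := 2 * u) (by positivity)
    nlinarith
  calc (2 * h : ℝ) ^ (4 * Δ + 4) ≤ Real.exp (2 * u) ^ (4 * Δ + 4) := by gcongr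
    _ = Real.exp ((4 * Δ + 4 : ℕ) * (2 * u)) := by rw [Real.exp_nat_mul]
    _ ≤ _ := by
      rw [Real.exp_le_exp]
      push_cast
      nlinarith

lemma iterate_contraction_le {Δ b r R : ℕ} (hb : b * (2 * (Δ + 1)) ≤ r) (hrR : r ≤ R) (i : ℕ) :
    (fun x => x * Δ / (Δ + 1) + b)^[i] R ≤ R := by
  induction i with
  | zero => simp
  | succ i ih =>
    rw [Function.iterate_succ_apply']
    set x := (fun x => x * Δ / (Δ + 1) + b)^[i] R
    have h1 : x * Δ / (Δ + 1) + b = (x * Δ + b * (Δ + 1)) / (Δ + 1) := by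
      rw [Nat.add_mul_div_right _ _ (Nat.succ_pos Δ)]
    show x * Δ / (Δ + 1) + b ≤ R
    rw [h1]
    apply Nat.div_le_of_le_mul
    nlinarith

/-- The affine contraction has a fixed point of at most `r / 2`, and every `Δ + 1` iterations at
least halve the rest; `m + 1` halvings bring it below `(r + 1) / 2`. -/
lemma iterate_contraction_le_of_lt {Δ b r R m : ℕ} (hb : b * (2 * (Δ + 1)) ≤ r)
    (hR : R < 2 ^ m * (r + 1)) :
    (fun x => x * Δ / (Δ + 1) + b)^[(Δ + 1) * (m + 1)] R ≤ r := by
  set q : ℝ := Δ / (Δ + 1) with hq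
  have hq0 : 0 ≤ q := by positivity
  have hkey : ∀ i : ℕ, (((fun x => x * Δ / (Δ + 1) + b)^[i] R : ℕ) : ℝ) ≤ r / 2 + q ^ i * R := by
    intro i
    induction i with
    | zero =>
      simp only [Function.iterate_zero, id_eq, pow_zero, one_mul]
      linarith [(Nat.cast_nonneg r : (0 : ℝ) ≤ r)]
    | succ i ih =>
      rw [Function.iterate_succ_apply']
      set x := (fun x => x * Δ / (Δ + 1) + b)^[i] R
      have h1 : ((x * Δ / (Δ + 1) : ℕ) : ℝ) ≤ q * x := by
        refine Nat.cast_div_le.trans ?_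
        push_cast
        rw [hq]
        apply le_of_eq
        ring
      have h2 : (b : ℝ) ≤ r / 2 * (1 - q) := by
        have h3 : 1 - q = 1 / (Δ + 1) := by rw [hq]; field_simp; ring
        rw [h3, div_mul_div_comm, mul_one, le_div_iff₀ (by positivity)]
        exact_mod_cast hb
      have h4 := mul_le_mul_of_nonneg_left ih hq0
      push_cast
      rw [pow_succ]
      nlinarith
  have hqN : q ^ ((Δ + 1) * (m + 1)) ≤ (1 / 2) ^ (m + 1) := by
    rw [pow_mul]
    refine pow_le_pow_left₀ (by positivity) ?_ _
    have h1 : q ≤ Real.exp (-(1 / (Δ + 1))) := by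
      have := Real.add_one_le_exp (-(1 / (Δ + 1 : ℝ)))
      have h3 : q = -(1 / (Δ + 1 : ℝ)) + 1 := by rw [hq]; field_simp; ring
      rwa [h3]
    calc q ^ (Δ + 1) ≤ Real.exp (-(1 / (Δ + 1))) ^ (Δ + 1) := by gcongr
      _ = Real.exp (-1) := by
        rw [← Real.exp_nat_mul]
        congr 1
        push_cast
        field_simp
      _ ≤ 1 / 2 := by
        rw [Real.exp_neg, ← one_div]
        exact one_div_le_one_div_of_le (by norm_num) (by linarith [Real.add_one_le_exp (1 : ℝ)])
  have h := hkey ((Δ + 1) * (m + 1))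
  have hR' : (R : ℝ) < 2 ^ m * (r + 1) := by exact_mod_cast hR
  have h1 : q ^ ((Δ + 1) * (m + 1)) * R ≤ (1 / 2) ^ (m + 1) * R := by gcongr
  have h2 : (1 / 2 : ℝ) ^ (m + 1) * R < (1 / 2) ^ (m + 1) * (2 ^ m * (r + 1)) := by gcongr
  have h3 : (1 / 2 : ℝ) ^ (m + 1) * (2 ^ m * (r + 1)) = (r + 1) / 2 := by
    rw [pow_succ]
    have : (1 / 2 : ℝ) ^ m * 2 ^ m = 1 := by rw [← mul_pow]; norm_num
    linear_combination (r + 1 : ℝ) / 2 * this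
  have h4 : (((fun x => x * Δ / (Δ + 1) + b)^[(Δ + 1) * (m + 1)] R : ℕ) : ℝ) < (r + 1 : ℕ) := by
    push_cast
    linarith [(Nat.cast_nonneg r : (0 : ℝ) ≤ r)]
  exact Nat.lt_succ_iff.1 (by exact_mod_cast h4)

section late
variable {V : Type*} [Fintype V] [Nonempty V] {H : SimpleGraph V} {Δ : ℕ}

/-- The number of exceptional vertices allowed at scale `h`. -/
def lateBound (n Δ h : ℕ) : ℕ := n / (16 * (Δ + 1) ^ 2 * h ^ (4 * Δ))

lemma lateBound_eq_zero {n h : ℕ} (hΔ : 0 < Δ) (hnh : n < h) : lateBound n Δ h = 0 := by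
  apply Nat.div_eq_of_lt
  have h0 : 0 < h := by omega
  calc n < h ^ 1 := by simpa using hnh
    _ ≤ h ^ (4 * Δ) := Nat.pow_le_pow_right h0 (by omega)
    _ ≤ _ := Nat.le_mul_of_pos_left _ (by positivity)

lemma lateBound_mul_le (n Δ h : ℕ) : lateBound n Δ h * (16 * (Δ + 1) ^ 2 * h ^ (4 * Δ)) ≤ n :=
  Nat.div_mul_le_self _ _

lemma lt_lateBound_mul (n Δ : ℕ) {h : ℕ} (hh : 0 < h) :
    n < 16 * (Δ + 1) ^ 2 * h ^ (4 * Δ) * (lateBound n Δ h + 1) :=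
  Nat.lt_mul_div_succ n (by positivity)

lemma lateBound_two_mul_le (n Δ h : ℕ) (hh : 0 < h) : lateBound n Δ (2 * h) ≤ lateBound n Δ h := by
  apply Nat.div_le_div_left
  · gcongr
    omega
  · positivity

lemma lateBound_lt (n Δ : ℕ) {h : ℕ} (hh : 0 < h) :
    lateBound n Δ h < 2 ^ (4 * Δ) * (lateBound n Δ (2 * h) + 1) := by
  apply Nat.div_lt_of_lt_mul
  have := lt_lateBound_mul n Δ (h := 2 * h) (by omega)
  rw [mul_pow] at this
  calc n < _ := this
    _ = _ := by ring

/-- With `g = h ^ 2`, the `h ^ (4 * Δ)` candidates fit into the graph by the definition of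
`lateBound`, and `n / h + 1` rounds per phase give failure `exp (-a * h)` before the union bound.
The choice of `a` makes the additive loss `2 * Δ * (a - 1)` small against the target, and large
enough to give `n ≤ exp (h / 8 + a)`, whence the bound `1 / n ^ 3`. -/
lemma loss_late_reduce_le (hΔ : ∀ v, (H.neighborFinset v).card ≤ Δ) (hΔ0 : 0 < Δ)
    (hn : 5 ≤ Fintype.card V) {h : ℕ} (hh : 4096 * (Δ + 1) ^ 2 ≤ h) {x a : ℕ}
    (ha : a = lateBound (Fintype.card V) Δ (2 * h) / (4 * Δ * (Δ + 1)) + 1)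
    (hx : x ≤ lateBound (Fintype.card V) Δ h) {G : SimpleGraph V}
    (hG : G ∈ almostContaining H x) :
    loss (almostContaining H (x * Δ / (Δ + 1) + 2 * Δ * (a - 1)))
      (2 * Δ * (Fintype.card V / h + 1)) G ≤ 2 * Δ * (1 / (Fintype.card V : ℝ) ^ 3) := by
  set n := Fintype.card V with hn0
  have hh0 : 0 < h := lt_of_lt_of_le (by positivity) hh
  have ha1 : 1 ≤ a := ha ▸ Nat.le_add_left 1 _
  have hxn : x * (16 * (Δ + 1) ^ 2 * h ^ (4 * Δ)) ≤ n :=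
    (Nat.mul_le_mul_right _ hx).trans (lateBound_mul_le n Δ h)
  have hpow : (h ^ 2) ^ (2 * Δ) = h ^ (4 * Δ) := by rw [← pow_mul]; congr 1; ring
  have hP : 1 ≤ h ^ (4 * Δ) := Nat.one_le_pow _ _ hh0
  have hmain := loss_reduce_le hΔ hG ha1 (g := h ^ 2) (Nat.one_le_pow _ _ hh0) hn
    (by
      refine le_trans ?_ hxn
      rw [hpow]
      have e1 : x * (Δ + 1) ≤ x * h ^ (4 * Δ) * (Δ + 1) := by
        rw [mul_assoc]
        exact Nat.mul_le_mul_left _ (Nat.le_mul_of_pos_left _ hP)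
      calc _ ≤ x * h ^ (4 * Δ) * (Δ ^ 2 + Δ + 1) + x * h ^ (4 * Δ) * (Δ + 1) := by gcongr
        _ = x * h ^ (4 * Δ) * (Δ ^ 2 + 2 * Δ + 2) := by ring
        _ ≤ x * h ^ (4 * Δ) * (16 * (Δ + 1) ^ 2) := by gcongr; nlinarith
        _ = _ := by ring)
    (by
      refine le_trans ?_ hxn
      rw [hpow]
      calc 16 * (x * h ^ (4 * Δ)) = x * (16 * 1 * h ^ (4 * Δ)) := by ring
        _ ≤ _ := by gcongr; exact Nat.one_le_pow _ _ (Nat.succ_pos _))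
    (n / h + 1)
  refine hmain.trans ?_
  gcongr
  rw [hpow, ← hn0]
  have hnR : (5 : ℝ) ≤ n := by exact_mod_cast hn
  have hhR : (0 : ℝ) < h := by exact_mod_cast hh0
  have haR : (1 : ℝ) ≤ a := by exact_mod_cast ha1
  have hhR' : (4096 * (Δ + 1) ^ 2 : ℝ) ≤ h := by exact_mod_cast hh
  have hΔR : (0 : ℝ) ≤ Δ := Nat.cast_nonneg _
  have hexp : Real.exp (-((a : ℝ) * (h ^ 2 : ℕ) * ((n / h + 1 : ℕ) / n : ℝ))) ≤
      Real.exp (-h) ^ a := by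
    rw [← Real.exp_nat_mul, Real.exp_le_exp, mul_neg, neg_le_neg_iff, mul_assoc]
    gcongr
    have h1 : (n / h : ℝ) ≤ ((n / h + 1 : ℕ) : ℝ) := by
      rw [div_le_iff₀ hhR]
      exact_mod_cast (Nat.lt_mul_div_succ n hh0).le.trans_eq (mul_comm _ _)
    rw [← mul_div_assoc, le_div_iff₀ (by linarith)]
    calc (h : ℝ) * n = h ^ 2 * (n / h) := by field_simp
      _ ≤ _ := by push_cast at h1 ⊢; gcongr
  have had : lateBound n Δ (2 * h) + 1 ≤ 4 * Δ * (Δ + 1) * a := by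
    rw [ha]
    exact Nat.lt_mul_div_succ _ (by positivity)
  have hxa : (x : ℝ) ≤ (2 ^ (4 * Δ) * (4 * Δ * (Δ + 1)) : ℝ) * a := by
    have h1 : x ≤ 2 ^ (4 * Δ) * (4 * Δ * (Δ + 1) * a) :=
      hx.trans ((lateBound_lt n Δ hh0).le.trans (Nat.mul_le_mul_left _ had))
    have h2 : (x : ℝ) ≤ 2 ^ (4 * Δ) * (4 * Δ * (Δ + 1) * a) := by exact_mod_cast h1
    linarith
  have hA := two_mul_pow_le_exp hh
  have hna : (n : ℝ) ≤ Real.exp (h / 8) * Real.exp a := by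
    have h1 : n ≤ 16 * (Δ + 1) ^ 2 * (2 * h) ^ (4 * Δ) * (4 * Δ * (Δ + 1) * a) :=
      (lt_lateBound_mul n Δ (h := 2 * h) (by omega)).le.trans (Nat.mul_le_mul_left _ had)
    have h2 : (n : ℝ) ≤ 16 * (Δ + 1) ^ 2 * (2 * h) ^ (4 * Δ) * (4 * Δ * (Δ + 1) * a) := by
      exact_mod_cast h1
    have h3 : (64 * Δ * (Δ + 1) ^ 3 : ℝ) ≤ (2 * h) ^ 4 := by
      calc (64 * Δ * (Δ + 1) ^ 3 : ℝ) ≤ (4096 * (Δ + 1) ^ 2) ^ 2 := by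
            have : (Δ : ℝ) * (Δ + 1) ^ 3 ≤ (Δ + 1) * (Δ + 1) ^ 3 := by gcongr; linarith
            nlinarith
        _ ≤ h ^ 2 := by gcongr
        _ ≤ (2 * h) ^ 4 := by
          have : (1 : ℝ) ≤ h := by exact_mod_cast hh0
          have h5 : (1 : ℝ) ≤ h ^ 2 := one_le_pow₀ this
          nlinarith
    calc (n : ℝ) ≤ (64 * Δ * (Δ + 1) ^ 3) * (2 * h) ^ (4 * Δ) * a := by linarith
      _ ≤ (2 * h) ^ 4 * (2 * h) ^ (4 * Δ) * Real.exp a := by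
        gcongr
        linarith [Real.add_one_le_exp (a : ℝ)]
      _ = (2 * h) ^ (4 * Δ + 4) * Real.exp a := by ring
      _ ≤ _ := by gcongr
  have hbase : Real.exp 1 * (2 ^ (4 * Δ) * (4 * Δ * (Δ + 1)) : ℝ) *
      ((h ^ (4 * Δ) : ℕ) * Real.exp (-h)) ≤ Real.exp (-(7 * h / 8)) := by
    have h1 : Real.exp 1 * (4 * Δ * (Δ + 1)) ≤ (2 * h) ^ 4 := by
      have h2 : (4 * Δ * (Δ + 1) : ℝ) ≤ h := by nlinarith
      have h3 : Real.exp 1 ≤ h := by nlinarith [Real.exp_one_lt_d9]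
      have h4 : (1 : ℝ) ≤ h := by exact_mod_cast hh0
      have h5 : (1 : ℝ) ≤ h ^ 2 := one_le_pow₀ h4
      calc Real.exp 1 * (4 * Δ * (Δ + 1)) ≤ h * h := by gcongr
        _ ≤ _ := by nlinarith
    push_cast
    calc _ = Real.exp 1 * (4 * Δ * (Δ + 1)) * (2 * h : ℝ) ^ (4 * Δ) * Real.exp (-h) := by
          rw [mul_pow]; ring
      _ ≤ (2 * h) ^ 4 * (2 * h : ℝ) ^ (4 * Δ) * Real.exp (-h) := by gcongr
      _ = (2 * h) ^ (4 * Δ + 4) * Real.exp (-h) := by ring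
      _ ≤ Real.exp (h / 8) * Real.exp (-h) := by gcongr
      _ = _ := by rw [← Real.exp_add]; congr 1; ring
  calc _ ≤ (x.choose a : ℝ) * ((h ^ (4 * Δ) : ℕ) : ℝ) ^ a * Real.exp (-h) ^ a := by gcongr
    _ = (x.choose a : ℝ) * ((h ^ (4 * Δ) : ℕ) * Real.exp (-h)) ^ a := by rw [mul_pow]; ring
    _ ≤ _ := choose_mul_pow_le (by positivity) hxa
    _ ≤ Real.exp (-(7 * h / 8)) ^ a := by gcongr
    _ = Real.exp (-(a * (7 * h / 8))) := by rw [← Real.exp_nat_mul]; congr 1; ring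
    _ ≤ _ := by
      rw [Real.exp_neg, ← one_div]
      refine one_div_le_one_div_of_le (by positivity) ?_
      calc (n : ℝ) ^ 3 ≤ (Real.exp (h / 8) * Real.exp a) ^ 3 := by gcongr
        _ = Real.exp (3 * (h / 8 + a)) := by
          rw [← Real.exp_add, ← Real.exp_nat_mul]
          norm_num
        _ ≤ _ := by
          rw [Real.exp_le_exp]
          have : (24 : ℝ) ≤ h := by nlinarith
          nlinarith

/-- Doubling `h` lowers the bound by a factor of about `2 ^ (4 * Δ)`, so `(Δ + 1) * (4 * Δ + 1)`
reductions reach the next scale. -/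
lemma loss_late_level_le (hΔ : ∀ v, (H.neighborFinset v).card ≤ Δ) (hΔ0 : 0 < Δ)
    (hn : 5 ≤ Fintype.card V) {h : ℕ} (hh : 4096 * (Δ + 1) ^ 2 ≤ h) {G : SimpleGraph V}
    (hG : G ∈ almostContaining H (lateBound (Fintype.card V) Δ h)) :
    loss (almostContaining H (lateBound (Fintype.card V) Δ (2 * h)))
      ((Δ + 1) * (4 * Δ + 1) * (2 * Δ * (Fintype.card V / h + 1))) G ≤
        ((Δ + 1) * (4 * Δ + 1) : ℕ) * (2 * Δ * (1 / (Fintype.card V : ℝ) ^ 3)) := by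
  have hh0 : 0 < h := lt_of_lt_of_le (by positivity) hh
  set n := Fintype.card V with hn0
  set r := lateBound n Δ (2 * h)
  set a := r / (4 * Δ * (Δ + 1)) + 1 with ha
  have hb : 2 * Δ * (a - 1) * (2 * (Δ + 1)) ≤ r := by
    rw [ha, Nat.add_sub_cancel]
    calc _ = r / (4 * Δ * (Δ + 1)) * (4 * Δ * (Δ + 1)) := by ring
      _ ≤ r := Nat.div_mul_le_self _ _
  refine (loss_mono_set (almostContaining_mono H
    (iterate_contraction_le_of_lt hb (lateBound_lt n Δ hh0))) _ G).trans ?_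
  refine loss_chain_le
    (A := fun i => almostContaining H ((fun x => x * Δ / (Δ + 1) + 2 * Δ * (a - 1))^[i]
      (lateBound n Δ h))) (by positivity) (fun i G' hG' => ?_) (by simpa using hG) _
  simp only [Function.iterate_succ_apply']
  exact loss_late_reduce_le hΔ hΔ0 hn hh ha
    (iterate_contraction_le hb (lateBound_two_mul_le n Δ h hh0) i) hG'

/-- The time spent at scale `h` is proportional to `n / h`, so doubling `h` gives a geometric
series. Once `h > n`, no exceptional vertex is allowed. -/
lemma loss_late_le (hΔ : ∀ v, (H.neighborFinset v).card ≤ Δ) (hΔ0 : 0 < Δ)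
    (hn : 5 ≤ Fintype.card V) (j : ℕ) {h : ℕ} (hh : 4096 * (Δ + 1) ^ 2 ≤ h)
    (hj : Fintype.card V < 2 ^ j * h) {G : SimpleGraph V}
    (hG : G ∈ almostContaining H (lateBound (Fintype.card V) Δ h)) :
    loss (almostContaining H 0) ((Δ + 1) * (4 * Δ + 1) * (2 * Δ * (4 * Fintype.card V / h))) G ≤
        j * (((Δ + 1) * (4 * Δ + 1) : ℕ) * (2 * Δ * (1 / (Fintype.card V : ℝ) ^ 3))) := by
  induction j generalizing h G with
  | zero =>
    rw [lateBound_eq_zero hΔ0 (by simpa using hj)] at hG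
    rw [loss_eq_zero hG]
    simp
  | succ j ih =>
    rcases lt_or_ge (Fintype.card V) h with hlt | hle
    · rw [lateBound_eq_zero hΔ0 hlt] at hG
      rw [loss_eq_zero hG]
      positivity
    have hh0 : 0 < h := lt_of_lt_of_le (by positivity) hh
    set n := Fintype.card V with hn0
    have hrounds : n / h + 1 + 4 * n / (2 * h) ≤ 4 * n / h := by
      have h1 : 1 ≤ n / h := (Nat.one_le_div_iff hh0).2 hle
      have h2 : 4 * n / (2 * h) = 2 * n / h := by
        rw [show 4 * n = 2 * (2 * n) by ring, Nat.mul_div_mul_left _ _ (by norm_num)]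
      rw [h2, Nat.le_div_iff_mul_le hh0]
      have h3 := Nat.div_mul_le_self n h
      have h4 := Nat.div_mul_le_self (2 * n) h
      nlinarith
    have hle' : (Δ + 1) * (4 * Δ + 1) * (2 * Δ * (n / h + 1)) +
        (Δ + 1) * (4 * Δ + 1) * (2 * Δ * (4 * n / (2 * h))) ≤
        (Δ + 1) * (4 * Δ + 1) * (2 * Δ * (4 * n / h)) := by
      rw [← mul_add, ← mul_add]
      gcongr
    refine (loss_antitone G hle').trans ?_
    refine (loss_add_le (by positivity) (fun G' hG' => ih (h := 2 * h) (by omega) ?_ hG') G).trans ?_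
    · rw [pow_succ] at hj
      linarith
    · have := loss_late_level_le hΔ hΔ0 hn hh hG
      push_cast at this ⊢
      linarith

end late

/-! ### Spanning copies -/

lemma mul_pow_six_le_two_pow {κ : ℕ} (hκ : 2 ≤ κ) : 256 * κ ^ 6 ≤ 2 ^ (10 * κ) := by
  calc 256 * κ ^ 6 ≤ 16 ^ κ * (2 ^ κ) ^ 6 := by
        gcongr
        · exact (Nat.pow_le_pow_right (by norm_num) hκ : 16 ^ 2 ≤ 16 ^ κ)
        · exact Nat.lt_two_pow_self.le
    _ = 2 ^ (10 * κ) := by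
      rw [show (16 : ℕ) = 2 ^ 4 by norm_num, ← pow_mul, ← pow_mul, ← pow_add]
      congr 1
      ring

lemma mul_pow_four_le_two_pow {κ : ℕ} (hκ : 2 ≤ κ) : 4096 * κ ^ 4 ≤ 2 ^ (10 * κ) := by
  calc 4096 * κ ^ 4 ≤ 64 ^ κ * (2 ^ κ) ^ 4 := by
        gcongr
        · exact (Nat.pow_le_pow_right (by norm_num) hκ : 64 ^ 2 ≤ 64 ^ κ)
        · exact Nat.lt_two_pow_self.le
    _ = 2 ^ (10 * κ) := by
      rw [show (64 : ℕ) = 2 ^ 6 by norm_num, ← pow_mul, ← pow_mul, ← pow_add]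
      congr 1
      ring

lemma two_pow_le_exp (m : ℕ) : (2 : ℝ) ^ m ≤ Real.exp m := by
  rw [← mul_one (m : ℝ), Real.exp_nat_mul]
  gcongr
  linarith [Real.add_one_le_exp (1 : ℝ)]

section spanning
variable {V : Type*} [Fintype V] [Nonempty V] {H : SimpleGraph V} {Δ κ : ℕ}

/-- The entropy of the remaining set is about `log (s ^ 4) ≤ 40 * κ` per edge, below the `100 * κ`
gained by waiting. -/
lemma loss_wait_sparse_le (hn : 5 ≤ Fintype.card V) (hκ : 2 ≤ κ) {G : SimpleGraph V}
    (hG : 16 * missing H.edgeFinset G ≤ Fintype.card V) :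
    loss (almostContaining H (Fintype.card V / (2 ^ (10 * κ)) ^ 4)) (100 * κ * Fintype.card V) G ≤
      1 / Fintype.card V := by
  have h := loss_wait_le hn hG (a := Fintype.card V / (2 ^ (10 * κ)) ^ 4 + 1)
    (Nat.le_add_left 1 _)
    (100 * κ * Fintype.card V)
  rw [Nat.add_sub_cancel] at h
  refine h.trans ?_
  set n := Fintype.card V with hn0
  set a := n / (2 ^ (10 * κ)) ^ 4 + 1 with ha
  have hnR : (5 : ℝ) ≤ n := by exact_mod_cast hn
  have haR : (1 : ℝ) ≤ a := by exact_mod_cast Nat.le_add_left 1 _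
  have hκR : (2 : ℝ) ≤ κ := by exact_mod_cast hκ
  have hs : ((2 : ℝ) ^ (10 * κ)) ^ 4 ≤ Real.exp (40 * κ) := by
    rw [← pow_mul]
    refine (two_pow_le_exp _).trans_eq ?_
    congr 1
    push_cast
    ring
  have hna : (n : ℝ) ≤ Real.exp (40 * κ) * a := by
    have h1 : n ≤ (2 ^ (10 * κ)) ^ 4 * a := (Nat.lt_mul_div_succ n (by positivity)).le
    have h2 : (n : ℝ) ≤ (2 ^ (10 * κ)) ^ 4 * a := by exact_mod_cast h1
    exact h2.trans (by gcongr)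
  refine (choose_mul_pow_le (by positivity) hna).trans ?_
  have ht : (((100 * κ * n : ℕ) : ℝ) / n) = 100 * κ := by
    push_cast
    field_simp
  rw [ht, ← Real.exp_add, ← Real.exp_add, ← Real.exp_nat_mul]
  have hna' : (n : ℝ) ≤ Real.exp (40 * κ + a) := by
    rw [Real.exp_add]
    refine hna.trans ?_
    gcongr
    linarith [Real.add_one_le_exp (a : ℝ)]
  calc _ ≤ Real.exp (-(40 * κ + a)) := by
        rw [Real.exp_le_exp]
        nlinarith
    _ ≤ 1 / n := by
      rw [Real.exp_neg, ← one_div]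
      exact one_div_le_one_div_of_le (by positivity) hna'

/-- Each of the `a * s` candidates costs `log (Δ * (s + 2)) ≤ 20 * κ` and gains `100 * κ`. The net
`80 * κ * s` per vertex outweighs the entropy, about `s`, of choosing it among `n`. -/
lemma loss_simultaneous_sparse_le (hΔ : ∀ v, (H.neighborFinset v).card ≤ Δ)
    (hn : 5 ≤ Fintype.card V) (hκ : 2 ≤ κ) (hΔκ : Δ < κ ^ 2) {G : SimpleGraph V}
    (hG : G ∈ almostContaining H (Fintype.card V / (2 ^ (10 * κ)) ^ 4)) :
    loss (almostContaining H ⌊Fintype.card V * Real.exp (-(2 ^ (10 * κ) : ℕ))⌋₊)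
      (100 * κ * Fintype.card V) G ≤ 1 / Fintype.card V := by
  have hs6 := mul_pow_six_le_two_pow hκ
  have hsR : ((2 ^ (10 * κ) : ℕ) : ℝ) ≤ Real.exp (10 * κ) := by
    have := two_pow_le_exp (10 * κ)
    push_cast at this ⊢
    exact this
  generalize 2 ^ (10 * κ) = s at hs6 hsR hG ⊢
  set n := Fintype.card V with hn0
  set r := n / s ^ 4 with hr
  have hrn : r * s ^ 4 ≤ n := Nat.div_mul_le_self _ _
  have hκ3 : (κ ^ 2) ^ 3 = κ ^ 6 := by ring
  have hκpos : 4 ≤ κ ^ 2 := by nlinarith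
  have hDs : 256 * (Δ + 1) ^ 3 ≤ s := by
    refine le_trans ?_ hs6
    rw [← hκ3]
    gcongr
    omega
  have hD1 : 1 ≤ (Δ + 1) ^ 2 := Nat.one_le_pow _ _ (Nat.succ_pos _)
  have hD2 : (Δ + 1) ^ 2 ≤ (Δ + 1) ^ 3 := Nat.pow_le_pow_right (Nat.succ_pos _) (by norm_num)
  have hDs2 : 256 * (Δ + 1) ^ 2 ≤ s := by omega
  have hDs1 : 256 * (Δ + 1) ≤ s := 
    (Nat.mul_le_mul_left _ (Nat.le_self_pow (by norm_num) _)).trans hDs2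
  have hs256 : 256 ≤ s := by omega
  have hs0 : 0 < s := by omega
  have hs2 : s ^ 2 ≤ s ^ 4 := Nat.pow_le_pow_right hs0 (by norm_num)
  have hs3 : s ^ 3 ≤ s ^ 4 := Nat.pow_le_pow_right hs0 (by norm_num)
  have hΔs : Δ * (s + 2) ≤ s ^ 2 := by nlinarith
  have h := loss_simultaneous_reduce_le hΔ hG (a := ⌊n * Real.exp (-(s : ℕ))⌋₊ + 1) (s := s)
    (Nat.le_add_left 1 _) hn
    (by
      refine le_trans ?_ hrn
      calc _ = r * (s * (Δ ^ 2 + Δ + 1) + (Δ + 1)) := by ring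
        _ ≤ r * s ^ 4 := by
          gcongr
          have h1 : Δ ^ 2 + Δ + 1 ≤ (Δ + 1) ^ 2 := by nlinarith
          have h2 : s * (Δ ^ 2 + Δ + 1) * 2 ≤ s * s := by nlinarith
          have h3 : (Δ + 1) * 2 ≤ s * s := by nlinarith
          nlinarith)
    (by
      refine le_trans ?_ hrn
      calc _ = r * (16 * s * (Δ * (s + 2))) := by ring
        _ ≤ r * (s * s * s ^ 2) := by gcongr; omega
        _ = r * s ^ 4 := by ring)
    (100 * κ * n)
  rw [Nat.add_sub_cancel] at h
  refine h.trans ?_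
  rw [← hn0]
  set a := ⌊n * Real.exp (-(s : ℕ))⌋₊ + 1 with ha
  have hnR : (5 : ℝ) ≤ n := by exact_mod_cast hn
  have haR : (1 : ℝ) ≤ a := by exact_mod_cast Nat.le_add_left 1 _
  have hκR : (2 : ℝ) ≤ κ := by exact_mod_cast hκ
  have hs256R : (256 : ℝ) ≤ s := by exact_mod_cast hs256
  have hna : (n : ℝ) ≤ Real.exp s * a := by
    have h1 := (Nat.lt_floor_add_one ((n : ℝ) * Real.exp (-(s : ℕ)))).le
    have h2 : (n : ℝ) = Real.exp s * (n * Real.exp (-(s : ℕ))) := by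
      rw [mul_left_comm, ← Real.exp_add, add_neg_cancel, Real.exp_zero, mul_one]
    rw [h2, ha]
    push_cast
    gcongr
  have hra : (r : ℝ) ≤ Real.exp s * a :=
    le_trans (by exact_mod_cast Nat.div_le_self _ _) hna
  have ht : (((100 * κ * n : ℕ) : ℝ) / n) = 100 * κ := by
    push_cast
    field_simp
  have hΔsR : ((Δ * (s + 2) : ℕ) : ℝ) ≤ Real.exp (20 * κ) := by
    calc ((Δ * (s + 2) : ℕ) : ℝ) ≤ (s : ℝ) ^ 2 := by exact_mod_cast hΔs
      _ ≤ Real.exp (10 * κ) ^ 2 := by gcongr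
      _ = _ := by rw [← Real.exp_nat_mul]; congr 1; push_cast; ring
  have hna' : (n : ℝ) ≤ Real.exp (s + a) := by
    rw [Real.exp_add]
    refine hna.trans ?_
    gcongr
    linarith [Real.add_one_le_exp (a : ℝ)]
  rw [ht]
  calc _ ≤ (r.choose a : ℝ) * Real.exp (20 * κ) ^ (a * s) * Real.exp (-(a * s * (100 * κ))) := by
        gcongr
    _ = (r.choose a : ℝ) * Real.exp (-(80 * s * κ)) ^ a := by
      rw [mul_assoc, ← Real.exp_nat_mul, ← Real.exp_nat_mul, ← Real.exp_add]
      congr 2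
      push_cast
      ring
    _ ≤ _ := choose_mul_pow_le (by positivity) hra
    _ ≤ Real.exp (-(s + a)) := by
      rw [← Real.exp_add, ← Real.exp_add, ← Real.exp_nat_mul, Real.exp_le_exp]
      have h1 : (s : ℝ) * 2 ≤ s * κ := by gcongr
      have h2 : (s : ℝ) ≤ s * a := le_mul_of_one_le_right (by linarith) haR
      have h3 : 1 + (s : ℝ) + -(80 * s * κ) ≤ -(3 * s) := by nlinarith
      have h4 := mul_le_mul_of_nonneg_left h3 (by linarith : (0 : ℝ) ≤ a)
      nlinarith
    _ ≤ 1 / n := by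
      rw [Real.exp_neg, ← one_div]
      exact one_div_le_one_div_of_le (by positivity) hna'

/-- Either no exceptional vertex is left, or `exp s ≤ n`. The late scales start at `h = s`; as `s`
dominates `(Δ + 1) ^ 3`, they fit into `n` rounds. -/
lemma loss_finish_le (hΔ : ∀ v, (H.neighborFinset v).card ≤ Δ) (hΔ0 : 0 < Δ)
    (hn : 5 ≤ Fintype.card V) {s : ℕ} (hs3 : 256 * (Δ + 1) ^ 3 ≤ s)
    (hs2 : 4096 * (Δ + 1) ^ 2 ≤ s) {G : SimpleGraph V}
    (hG : G ∈ almostContaining H ⌊Fintype.card V * Real.exp (-(s : ℕ))⌋₊) :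
    loss (almostContaining H 0) (Fintype.card V) G ≤ 1 / Fintype.card V := by
  set n := Fintype.card V with hn0
  rcases Nat.eq_zero_or_pos ⌊n * Real.exp (-(s : ℕ))⌋₊ with h0 | h0
  · rw [h0] at hG
    rw [loss_eq_zero hG]
    positivity
  have hs0 : 0 < s := lt_of_lt_of_le (by positivity) hs2
  have hnR : (5 : ℝ) ≤ n := by exact_mod_cast hn
  have hsn : Real.exp s ≤ n := by
    have h1 := (Nat.one_le_floor_iff _).1 h0
    rwa [Real.exp_neg, ← div_eq_mul_inv, le_div_iff₀ (Real.exp_pos _), one_mul] at h1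
  have hsnN : s ≤ n := by
    have h1 : (s : ℝ) ≤ n := by linarith [Real.add_one_le_exp (s : ℝ)]
    exact_mod_cast h1
  have hlate : ⌊n * Real.exp (-(s : ℕ))⌋₊ ≤ lateBound n Δ s := by
    rw [lateBound, Nat.le_div_iff_mul_le (by positivity)]
    have hA := two_mul_pow_le_exp hs2
    have h1 : (16 * (Δ + 1) ^ 2 * s ^ (4 * Δ) : ℝ) ≤ Real.exp s := by
      have h2 : (16 * (Δ + 1) ^ 2 : ℝ) ≤ (2 * s) ^ 4 := by
        have h3 : (4096 * (Δ + 1) ^ 2 : ℝ) ≤ s := by exact_mod_cast hs2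
        have h4 : (1 : ℝ) ≤ 2 * s := by
          have : (1 : ℝ) ≤ s := by exact_mod_cast hs0
          linarith
        have h5 : (2 * s : ℝ) ≤ (2 * s) ^ 4 := le_self_pow₀ h4 (by norm_num)
        nlinarith [sq_nonneg (Δ + 1 : ℝ)]
      calc (16 * (Δ + 1) ^ 2 * s ^ (4 * Δ) : ℝ) ≤ (2 * s) ^ 4 * (2 * s) ^ (4 * Δ) := by
            gcongr
            have : (0 : ℝ) ≤ s := Nat.cast_nonneg _
            linarith
        _ = (2 * s) ^ (4 * Δ + 4) := by ring
        _ ≤ Real.exp (s / 8) := hA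
        _ ≤ _ := by
          rw [Real.exp_le_exp]
          have : (0 : ℝ) ≤ s := Nat.cast_nonneg _
          linarith
    have h2 : (⌊n * Real.exp (-(s : ℕ))⌋₊ : ℝ) ≤ n * Real.exp (-(s : ℕ)) :=
      Nat.floor_le (by positivity)
    have h3 : (⌊n * Real.exp (-(s : ℕ))⌋₊ : ℝ) * (16 * (Δ + 1) ^ 2 * s ^ (4 * Δ)) ≤ n := by
      calc _ ≤ n * Real.exp (-(s : ℕ)) * Real.exp s := by gcongr
        _ = n := by rw [mul_assoc, ← Real.exp_add, neg_add_cancel, Real.exp_zero, mul_one]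
    exact_mod_cast h3
  have hNΔ : (Δ + 1) * (4 * Δ + 1) * (2 * Δ) * 4 ≤ s := by
    refine le_trans ?_ hs3
    calc (Δ + 1) * (4 * Δ + 1) * (2 * Δ) * 4 ≤
          (Δ + 1) * (4 * (Δ + 1)) * (2 * (Δ + 1)) * 4 := by gcongr <;> omega
      _ = 32 * (Δ + 1) ^ 3 := by ring
      _ ≤ _ := by gcongr; norm_num
  have hrounds : (Δ + 1) * (4 * Δ + 1) * (2 * Δ * (4 * n / s)) ≤ n := by
    have h1 : 4 * n / s * s ≤ 4 * n := Nat.div_mul_le_self _ _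
    have h2 := Nat.mul_le_mul_left (4 * n / s) hNΔ
    nlinarith
  have h := loss_late_le hΔ hΔ0 hn n hs2 (by
    calc n < 2 ^ n := Nat.lt_two_pow_self
      _ ≤ 2 ^ n * s := Nat.le_mul_of_pos_right _ hs0) (almostContaining_mono H hlate hG)
  refine (loss_antitone G hrounds).trans (h.trans ?_)
  have hN : (((Δ + 1) * (4 * Δ + 1) : ℕ) : ℝ) * (2 * Δ) ≤ n := by
    exact_mod_cast (by omega : (Δ + 1) * (4 * Δ + 1) * (2 * Δ) ≤ n)
  rw [← hn0]
  calc (n : ℝ) * (((Δ + 1) * (4 * Δ + 1) : ℕ) * (2 * Δ * (1 / (n : ℝ) ^ 3))) =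
        n * ((((Δ + 1) * (4 * Δ + 1) : ℕ) : ℝ) * (2 * Δ)) * (1 / (n : ℝ) ^ 3) := by ring
    _ ≤ n * n * (1 / (n : ℝ) ^ 3) := by gcongr
    _ = 1 / n := by field_simp

lemma loss_spanning_le (hΔ : ∀ v, (H.neighborFinset v).card ≤ Δ) (hΔ0 : 0 < Δ)
    (hΔn : Δ ≤ Fintype.card V) (hn : 5 ≤ Fintype.card V) (hκ : 2 ≤ κ) (hΔκ : Δ < κ ^ 2) :
    loss {G : SimpleGraph V | H.IsContained G}
      (Δ * Fintype.card V / 2 + 720 * κ * Fintype.card V) ⊥ ≤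
        2 * Real.exp (-(Fintype.card V / 32)) + 3 / Fintype.card V := by
  set n := Fintype.card V with hn0
  have hs3 : 256 * (Δ + 1) ^ 3 ≤ 2 ^ (10 * κ) := by
    refine le_trans ?_ (mul_pow_six_le_two_pow hκ)
    rw [show κ ^ 6 = (κ ^ 2) ^ 3 by ring]
    gcongr
    omega
  have hs2 : 4096 * (Δ + 1) ^ 2 ≤ 2 ^ (10 * κ) := by
    refine le_trans ?_ (mul_pow_four_le_two_pow hκ)
    rw [show κ ^ 4 = (κ ^ 2) ^ 2 by ring]
    gcongr
    omega
  have h0 : (0 : ℝ) ≤ 1 / n := by positivity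
  -- The phases are composed from the last to the first, each success set being the starting
  -- condition of the next phase.
  have h1 := fun G hG => loss_finish_le (G := G) hΔ hΔ0 hn hs3 hs2 hG
  have h2 := fun G hG => (loss_add_le (k := 100 * κ * n) h0 h1 G).trans
    (add_le_add_left (loss_simultaneous_sparse_le hΔ hn hκ hΔκ hG) _)
  have h3 := fun G hG => (loss_add_le (k := 100 * κ * n) (by positivity) h2 G).trans
    (add_le_add_left (loss_wait_sparse_le hn hκ hG) _)
  have h4 := fun G hG => (loss_add_le (k := 500 * κ * n) (by positivity) h3 G).trans
    (add_le_add_left (loss_missing_second_le hΔ hΔn hn (by omega : 0 < κ) hG) _)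
  have h5 := (loss_add_le (k := Δ * n / 2 + 18 * κ * n) (by positivity) h4 ⊥).trans
    (add_le_add_left (loss_missing_first_le hΔ hΔn hn hΔκ) _)
  refine (loss_mono_set (fun G hG => isContained_of_mem_almostContaining_zero hG) _ _).trans ?_
  refine (loss_antitone ⊥ ?_).trans (h5.trans ?_)
  · have : n ≤ κ * n := Nat.le_mul_of_pos_left _ (by omega)
    nlinarith
  · apply le_of_eq
    ring

end spanning

/-! ### The number of rounds -/

/-- The horizon for which Builder plans on `n` vertices with maximum degree `Δ`. -/
def horizon (Δ n : ℕ) : ℕ := Δ * n / 2 + 720 * (Nat.sqrt Δ + 1) * n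

/-- An upper bound for the probability that Builder fails within the horizon. -/
def failureBound (n : ℕ) : ℝ := 2 * Real.exp (-(n / 32)) + 3 / n

lemma failureBound_nonneg (n : ℕ) : 0 ≤ failureBound n := by
  unfold failureBound
  positivity

lemma tendsto_failureBound : Tendsto failureBound atTop (𝓝 0) := by
  have h1 : Tendsto (fun n : ℕ => (n : ℝ) / 32) atTop atTop :=
    tendsto_natCast_atTop_atTop.atTop_div_const (by norm_num)
  have h2 := ((Real.tendsto_exp_neg_atTop_nhds_zero.comp h1).const_mul 2).add
    (tendsto_const_div_atTop_nhds_zero_nat (3 : ℝ))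
  unfold failureBound
  simpa using h2

/-- The strategy for embedding `H`. -/
def embeddingStrategy {n : ℕ} (H : SimpleGraph (Fin n)) (Δ : ℕ) : BuilderStrategy (Fin n) :=
  optimalStrategy {G | H.IsContained G} (horizon Δ n)

section
variable {n : ℕ} {H : SimpleGraph (Fin n)} {Δ : ℕ}

lemma le_successProb_embeddingStrategy (hn : 5 ≤ n) (hΔ : ∀ v, (H.neighborFinset v).card ≤ Δ)
    (hΔn : Δ ≤ n) {m : ℕ} (hm : 0 < Δ → horizon Δ n ≤ m) :
    ENNReal.ofReal (1 - failureBound n) ≤ successProb (embeddingStrategy H Δ) H m := by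
  have : Nonempty (Fin n) := ⟨⟨0, by omega⟩⟩
  rcases Nat.eq_zero_or_pos Δ with rfl | hpos
  · have hH : H = ⊥ := by
      rw [eq_bot_iff]
      intro u v huv
      have h1 := Finset.card_eq_zero.1 (Nat.le_zero.1 (hΔ u))
      have h2 : v ∈ H.neighborFinset u := (H.mem_neighborFinset u v).2 huv
      rw [h1] at h2
      simp at h2
    have h1 : successProb (embeddingStrategy H 0) H m = 1 := by
      rw [successProb]
      convert measure_univ (μ := offerLaw (Fin n))
      rw [Set.eq_univ_iff_forall]
      intro T
      exact SimpleGraph.IsContained.of_le (hH.le.trans bot_le)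
    rw [h1]
    exact ENNReal.ofReal_le_one.2 (by linarith [failureBound_nonneg n])
  · refine le_trans ?_ (successProb_mono _ H (hm hpos))
    refine le_trans (ENNReal.ofReal_le_ofReal ?_) (le_successProb_optimalStrategy H _)
    have h := loss_spanning_le hΔ hpos (by simpa using hΔn) (by simpa using hn)
      (κ := Nat.sqrt Δ + 1) (by have := Nat.sqrt_pos.2 hpos; omega) (Nat.lt_succ_sqrt' Δ)
    rw [Fintype.card_fin] at h
    rw [horizon, failureBound]
    linarith

/-- The mean exceeds the horizon by at least `720 * κ * n`. Chernoff's bound with parameter `1 / (2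
* κ)` suffices since `Δ ≤ κ ^ 2`. -/
lemma one_sub_exp_le_poissonMeasure_Ici (Δ n : ℕ) {r : ℝ≥0}
    (hr : (r : ℝ) = Δ * n / 2 + 1440 * (Nat.sqrt Δ + 1) * n) :
    ENNReal.ofReal (1 - Real.exp (-n)) ≤ poissonMeasure r (Set.Ici (horizon Δ n)) := by
  have hΔκ : ((Δ : ℕ) : ℝ) ≤ ((Nat.sqrt Δ + 1 : ℕ) : ℝ) ^ 2 := by
    exact_mod_cast (Nat.lt_succ_sqrt' Δ).le
  have hκ : (1 : ℝ) ≤ ((Nat.sqrt Δ + 1 : ℕ) : ℝ) := by exact_mod_cast Nat.le_add_left 1 _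
  have hm : (horizon Δ n : ℝ) ≤ Δ * n / 2 + 720 * ((Nat.sqrt Δ + 1 : ℕ) : ℝ) * n := by
    rw [horizon]
    push_cast
    gcongr
    exact Nat.cast_div_le.trans (by push_cast; rfl)
  have hr' : (r : ℝ) = Δ * n / 2 + 1440 * ((Nat.sqrt Δ + 1 : ℕ) : ℝ) * n := by
    rw [hr]; push_cast; rfl
  generalize ((Nat.sqrt Δ + 1 : ℕ) : ℝ) = κ at *
  have hn : (0 : ℝ) ≤ n := Nat.cast_nonneg n
  have hΔ0 : (0 : ℝ) ≤ Δ := Nat.cast_nonneg Δ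
  have h1 := poissonMeasure_Iio_le r (horizon Δ n) (t := 1 / (2 * κ)) (by positivity)
  have h2 : 1 / (2 * κ + 1) ≤ 1 - Real.exp (-(1 / (2 * κ))) := by
    have h3 : Real.exp (-(1 / (2 * κ))) ≤ 1 / (1 + 1 / (2 * κ)) := by
      rw [Real.exp_neg, ← one_div]
      exact one_div_le_one_div_of_le (by positivity)
        (by linarith [Real.add_one_le_exp (1 / (2 * κ))])
    have h4 : 1 / (1 + 1 / (2 * κ)) = 1 - 1 / (2 * κ + 1) := by
      field_simp
      ring
    linarith
  have hexp : 1 / (2 * κ) * (horizon Δ n : ℝ) - r * (1 - Real.exp (-(1 / (2 * κ)))) ≤ -n := by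
    have h3 : 1 / (2 * κ) * (horizon Δ n : ℝ) ≤
        1 / (2 * κ) * (Δ * n / 2 + 720 * κ * n) := by gcongr
    have h4 := mul_le_mul_of_nonneg_left h2 r.coe_nonneg
    rw [hr'] at h4 ⊢
    have h5 : 1 / (2 * κ) * (Δ * n / 2 + 720 * κ * n) -
        (Δ * n / 2 + 1440 * κ * n) * (1 / (2 * κ + 1)) =
        n * ((Δ / 2 + 720 * κ * (1 - 2 * κ)) / (2 * κ * (2 * κ + 1))) := by
      field_simp
      ring
    have h6 : (Δ / 2 + 720 * κ * (1 - 2 * κ)) / (2 * κ * (2 * κ + 1)) ≤ -1 := by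
      rw [div_le_iff₀ (by positivity)]
      nlinarith
    have h7 := mul_le_mul_of_nonneg_left h6 hn
    linarith
  have h3 : poissonMeasure r (Set.Ici (horizon Δ n)) = 1 - poissonMeasure r (Set.Iio (horizon Δ n)) := by
    rw [← Set.compl_Iio, prob_compl_eq_one_sub (by measurability)]
  rw [h3, ENNReal.ofReal_sub _ (Real.exp_pos _).le, ENNReal.ofReal_one]
  exact tsub_le_tsub_left (h1.trans (ENNReal.ofReal_le_ofReal (Real.exp_le_exp.2 hexp))) _

lemma le_poissonSuccessProb_embeddingStrategy (hn : 5 ≤ n)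
    (hΔ : ∀ v, (H.neighborFinset v).card ≤ Δ) (hΔn : Δ ≤ n) {r : ℝ≥0}
    (hr : 0 < Δ → (r : ℝ) = Δ * n / 2 + 1440 * (Nat.sqrt Δ + 1) * n) :
    ENNReal.ofReal (1 - failureBound n) * ENNReal.ofReal (1 - Real.exp (-n)) ≤
      poissonSuccessProb (embeddingStrategy H Δ) H r := by
  have : Nonempty (Fin n) := ⟨⟨0, by omega⟩⟩
  rcases Nat.eq_zero_or_pos Δ with rfl | hpos
  · refine le_trans ?_ (le_poissonSuccessProb _ H 0 r)
    refine mul_le_mul' (le_successProb_embeddingStrategy hn hΔ hΔn (by simp)) ?_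
    have h1 : (Set.Ici 0 : Set ℕ) = Set.univ := Set.Ici_bot
    rw [h1, measure_univ]
    exact ENNReal.ofReal_le_one.2 (by linarith [Real.exp_pos (-(n : ℝ))])
  · refine le_trans ?_ (le_poissonSuccessProb _ H (horizon Δ n) r)
    exact mul_le_mul' (le_successProb_embeddingStrategy hn hΔ hΔn fun _ => le_rfl)
      (one_sub_exp_le_poissonMeasure_Ici Δ n (hr hpos))

end

/-- The relative number of additional rounds. -/
def overhead (c : ℝ≥0) (Δ : ℕ) : ℝ≥0 := c * (Nat.sqrt Δ + 1) / Δ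

lemma tendsto_overhead (c : ℝ≥0) : Tendsto (overhead c) atTop (𝓝 0) := by
  rw [← NNReal.tendsto_coe]
  have h1 : Tendsto (fun Δ : ℕ => (c : ℝ) * ((Real.sqrt Δ)⁻¹ + (Δ : ℝ)⁻¹)) atTop (𝓝 0) := by
    have h2 := ((tendsto_inv_atTop_zero.comp
      (Real.tendsto_sqrt_atTop.comp (tendsto_natCast_atTop_atTop (R := ℝ)))).add
      (tendsto_inv_atTop_zero.comp (tendsto_natCast_atTop_atTop (R := ℝ)))).const_mul (c : ℝ)
    simpa using h2
  refine squeeze_zero (fun _ => NNReal.coe_nonneg _) (fun Δ => ?_) h1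
  have h3 : (overhead c Δ : ℝ) = c * (((Nat.sqrt Δ : ℝ) + 1) / Δ) := by
    rw [overhead]
    push_cast
    ring
  rw [h3, add_div, one_div, ← Real.sqrt_div_self]
  gcongr
  exact Real.nat_sqrt_le_real_sqrt

lemma one_add_overhead_mul (c : ℝ≥0) {Δ : ℕ} (hΔ : 0 < Δ) (n : ℕ) :
    (((1 + overhead c Δ) * ((Δ : ℝ≥0) * (n : ℝ≥0) / 2) : ℝ≥0) : ℝ) =
      Δ * n / 2 + c / 2 * (Nat.sqrt Δ + 1) * n := by
  have : (Δ : ℝ) ≠ 0 := by exact_mod_cast hΔ.ne'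
  rw [overhead]
  push_cast
  field_simp

lemma horizon_le_floor {Δ : ℕ} (hΔ : 0 < Δ) (n : ℕ) :
    horizon Δ n ≤ ⌊(1 + overhead 1440 Δ) * ((Δ : ℝ≥0) * (n : ℝ≥0) / 2)⌋₊ := by
  apply Nat.le_floor
  rw [← NNReal.coe_le_coe, one_add_overhead_mul 1440 hΔ n, horizon]
  push_cast
  have : ((Δ * n / 2 : ℕ) : ℝ) ≤ Δ * n / 2 := Nat.cast_div_le.trans (by push_cast; rfl)
  linarith

end

theorem theorem1p3 :
    (∃ f : ℕ → ℝ≥0, Tendsto f atTop (𝓝 0) ∧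
      ∀ (H : (n : ℕ) → SimpleGraph (Fin n)) [∀ n, DecidableRel (H n).Adj],
        ∃ S : (n : ℕ) → BuilderStrategy (Fin n),
          Tendsto
            (fun n : ℕ => successProb (S n) (H n)
              ⌊(1 + f (H n).maxDegree) * (((H n).maxDegree : ℝ≥0) * (n : ℝ≥0) / 2)⌋₊)
            atTop (𝓝 1)) ∧
    (∃ f : ℕ → ℝ≥0, Tendsto f atTop (𝓝 0) ∧
      ∀ (H : (n : ℕ) → SimpleGraph (Fin n)) [∀ n, DecidableRel (H n).Adj],
        ∃ S : (n : ℕ) → BuilderStrategy (Fin n),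
          Tendsto
            (fun n : ℕ => poissonSuccessProb (S n) (H n)
              ((1 + f (H n).maxDegree) * (((H n).maxDegree : ℝ≥0) * (n : ℝ≥0) / 2)))
            atTop (𝓝 1)) := by
  have hdeg : ∀ (n : ℕ) (H : SimpleGraph (Fin n)) [DecidableRel H.Adj] (v : Fin n)
      [Fintype (H.neighborSet v)], (H.neighborFinset v).card ≤ H.maxDegree := by
    intro n H _ v _
    rw [SimpleGraph.card_neighborFinset_eq_degree]
    convert H.degree_le_maxDegree v
  have hlt : ∀ (n : ℕ) (H : SimpleGraph (Fin n)) [DecidableRel H.Adj], 5 ≤ n →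
      H.maxDegree ≤ n := by
    intro n H _ hn
    refine SimpleGraph.maxDegree_le_of_forall_degree_le _ _ fun v => ?_
    simpa using (H.degree_lt_card_verts v).le
  have hone : Tendsto (fun n => ENNReal.ofReal (1 - failureBound n)) atTop (𝓝 1) := by
    have := ENNReal.tendsto_ofReal (tendsto_failureBound.const_sub 1)
    simpa using this
  have hexp : Tendsto (fun n : ℕ => ENNReal.ofReal (1 - Real.exp (-n))) atTop (𝓝 1) := by
    have := ENNReal.tendsto_ofReal ((Real.tendsto_exp_neg_atTop_nhds_zero.comp
      (tendsto_natCast_atTop_atTop (R := ℝ))).const_sub 1)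
    simpa using this
  -- Multiplication by `Δ * n / 2` halves these constants: `1440` gives the horizon's `720`, and
  -- `2880` gives the Poisson mean's `1440`. For `Δ = 0` the overhead is `0`, and `H` has no edges.
  refine ⟨⟨overhead 1440, tendsto_overhead _, fun H _ =>
    ⟨fun n => embeddingStrategy (H n) (H n).maxDegree, ?_⟩⟩,
    ⟨overhead 2880, tendsto_overhead _, fun H _ =>
    ⟨fun n => embeddingStrategy (H n) (H n).maxDegree, ?_⟩⟩⟩
  · refine tendsto_of_tendsto_of_tendsto_of_le_of_le' hone tendsto_const_nhds ?_ ?_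
    · filter_upwards [eventually_ge_atTop 5] with n hn
      exact le_successProb_embeddingStrategy hn (fun v => by convert hdeg n (H n) v) (hlt n _ hn)
        fun hpos => horizon_le_floor hpos n
    · filter_upwards [eventually_ge_atTop 5] with n hn
      have : Nonempty (Fin n) := ⟨⟨0, by omega⟩⟩
      exact successProb_le_one _ _ _
  · have hprod := ENNReal.Tendsto.mul hone (Or.inl one_ne_zero) hexp (Or.inl one_ne_zero)
    rw [one_mul] at hprod
    refine tendsto_of_tendsto_of_tendsto_of_le_of_le' hprod tendsto_const_nhds ?_ ?_
    · filter_upwards [eventually_ge_atTop 5] with n hn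
      refine le_poissonSuccessProb_embeddingStrategy hn (fun v => by convert hdeg n (H n) v) (hlt n _ hn)
        fun hpos => ?_
      rw [one_add_overhead_mul 2880 hpos n]
      norm_num
    · filter_upwards [eventually_ge_atTop 5] with n hn
      have : Nonempty (Fin n) := ⟨⟨0, by omega⟩⟩
      exact poissonSuccessProb_le_one _ _ _
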